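/- Let $R$ be a local Noetherian ring with infinite residue field such that $2$ is invertible in $R$ and $\operatorname{Spec} R$ is irreducible. Let $p\ge 1$, $q\ge 3$ be integers and put $n=p+2$. Let $B_0$, $B_1$, $B_2$ be free $R$-modules of ranks $q-2$, $p+q$, $2n$, where $B_2$ carries a perfect symmetric bilinear form $\langle\cdot,\cdot\rangle$ and has a hyperbolic basis, i.e. a basis $e_1,\dots,e_n,e_1',\dots,e_n'$ with $\langle e_i,e_j\rangle=\langle e_i',e_j'\rangle=0$ and $\langle e_i,e_j'\rangle=\delta_{ij}$. Let $$\mathbb B\colon\ 0\to B_0^*\xrightarrow{\delta_4=\delta_1^*}B_1^*\xrightarrow{\delta_3=\delta_2^*}B_2^*\cong B_2\xrightarrow{\delta_2}B_1\xrightarrow{\delta_1}B_0$$ be an acyclic self-dual complex, where $B_2^*\cong B_2$ is given by the form. For a decomposition $B_2=H\oplus H^*$ into totally isotropic submodules (the second being identified with the dual of $H$ by the form), let $V_{\rm even}=\bigwedge^{\rm even}H$ and $V_{\rm odd}=\bigwedge^{\rm odd}H$, and let $x=f+f'\in H\oplus H^*$ act on $\bigwedge H$ by $x\cdot s=f\wedge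 s+f'\lrcorner s$, where $\lrcorner$ is contraction. Spinor coordinates of $\mathbb B$ with respect to the decomposition are an element $a\in V_{\rm odd}$ that is annihilated by the action of $\operatorname{im}\delta_3$ and that does not vanish at any prime outside the support of $\operatorname{coker}\delta_1$; in other words, outside that support, $a$ gives the homogeneous coordinates of the isotropic summand $\operatorname{im}\delta_3$ under the spinor embedding of the orthogonal Grassmannian in $\mathbb P(V_{\rm odd})$. Given $a$, let $w\colon V_{\rm even}^*\to B_1^*$ be a lift along $\delta_3$ of the dual $V_{\rm even}^*\to B_2^*\cong B_2$ of the map $x\mapsto x\cdot a$, and consider $$\mathbb A\colon\ 0\to B_0^*\oplus R\xrightarrow{d_3}B_1^*\xrightarrow{d_2}H^*\xrightarrow{d_1}R,$$ where $d_3=[\,\delta_4\ \ w|_R\,]$ with $R=\bigwedge^0H^*\subset V_{\rm even}^*$, where $d_2$ is the dual of $\delta_2|_H$, and where $d_1$ is the restriction of $a\in V_{\rm odd}=(V_{\rm odd}^*)^*$ to $H^*=\bigwedge^1 H^*\subset V_{\rm odd}^*$. Then: (1) If $R$ is a unique factorization domain, then $\mathbb B$ has spinor coordinates with respect to some decomposition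 $B_2=H\oplus H^*$. (2) If $\mathbb B$ has spinor coordinates with respect to some decomposition (in particular, if $R$ is a unique factorization domain), then there is a decomposition $B_2=H\oplus H^*$ with respect to which spinor coordinates exist and such that, for every choice of spinor coordinates $a$, a lift $w$ exists and, for every choice of the lift $w$, the sequence $\mathbb A$ is an acyclic complex and the ideal $I=\operatorname{im}d_1$ is either a perfect ideal of grade $3$ or the unit ideal. Here the grade of $I$ is the least $i$ with $\operatorname{Ext}^i_R(R/I,R)\neq0$, and $I$ is perfect if the projective dimension of $R/I$ equals this grade. -/

import Mathlib

open CategoryTheory Module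

universe u v

noncomputable section

/-- The grade of an `R`-module `M`: the least `i` with `Ext^i(M, R) ≠ 0` (`⊤` if there is none). -/
def moduleGrade (R M : Type u) [CommRing R] [AddCommGroup M] [Module R M] : ℕ∞ :=
  sInf {n : ℕ∞ | ∃ i : ℕ, n = i ∧
    Nontrivial (Abelian.Ext (ModuleCat.of R M) (ModuleCat.of R R) i)}

/-- `M` is perfect if its projective dimension equals its grade. -/
def IsPerfectModule (R M : Type u) [CommRing R] [AddCommGroup M] [Module R M] : Prop :=
  projectiveDimension (ModuleCat.of R M) = ((moduleGrade R M : ℕ∞) : WithBot ℕ∞)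

/-- The data of a sequence `0 → B₀* → B₁* → B₂* ≅ B₂ → B₁ → B₀` which is self-dual with respect to
a perfect symmetric bilinear form on `B₂`. -/
structure SelfDualSequence (R : Type u) [CommRing R] (B₀ B₁ B₂ : Type v)
    [AddCommGroup B₀] [Module R B₀] [AddCommGroup B₁] [Module R B₁]
    [AddCommGroup B₂] [Module R B₂] where
  /-- the symmetric bilinear form on the middle module -/
  form : LinearMap.BilinForm R B₂
  form_symm : ∀ x y, form x y = form y x
  form_bijective : Function.Bijective form
  δ₁ : B₁ →ₗ[R] B₀
  δ₂ : B₂ →ₗ[R] B₁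

/-- A decomposition of a module with a symmetric bilinear form as a direct sum of two totally
isotropic submodules `H` and `H'`. When the form is perfect, it identifies `H'` with the dual
`H*`. -/
structure IsotropicDecomposition {R : Type u} [CommRing R] {E : Type v} [AddCommGroup E]
    [Module R E] (form : LinearMap.BilinForm R E) where
  H : Submodule R E
  H' : Submodule R E
  isCompl : IsCompl H H'
  isotropic : ∀ x ∈ H, ∀ y ∈ H, form x y = 0
  isotropic' : ∀ x ∈ H', ∀ y ∈ H', form x y = 0

/-- A hyperbolic basis of rank `2 n`: vectors `e i` (`inl`) and `e' i` (`inr`) with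
`⟨e i, e j⟩ = ⟨e' i, e' j⟩ = 0` and `⟨e i, e' j⟩ = δ_{ij}`. -/
def HasHyperbolicBasis {R : Type u} [CommRing R] {E : Type v} [AddCommGroup E]
    [Module R E] (form : LinearMap.BilinForm R E) (n : ℕ) : Prop :=
  ∃ e : Basis (Fin n ⊕ Fin n) R E,
    (∀ i j, form (e (.inl i)) (e (.inl j)) = 0) ∧
    (∀ i j, form (e (.inr i)) (e (.inr j)) = 0) ∧
    (∀ i j, form (e (.inl i)) (e (.inr j)) = if i = j then 1 else 0)

namespace IsotropicDecomposition

variable {R : Type u} [CommRing R] {E : Type v} [AddCommGroup E] [Module R E]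
  {form : LinearMap.BilinForm R E} (D : IsotropicDecomposition form)

/-- The even half-spinor module `⋀^even H`. -/
abbrev VEven : Submodule R (ExteriorAlgebra R D.H) :=
  CliffordAlgebra.evenOdd (0 : QuadraticForm R D.H) 0

/-- The odd half-spinor module `⋀^odd H`. -/
abbrev VOdd : Submodule R (ExteriorAlgebra R D.H) :=
  CliffordAlgebra.evenOdd (0 : QuadraticForm R D.H) 1

/-- The Clifford action of `E = H ⊕ H'` on `⋀ H`: for `x = f + f'`, one has
`x • s = f ∧ s + (contraction of s by ⟨f', -⟩)`. Since `H` is isotropic, `⟨x, -⟩` and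
`⟨f', -⟩` agree on `H`. -/
def cliffordAction : E →ₗ[R] ExteriorAlgebra R D.H →ₗ[R] ExteriorAlgebra R D.H :=
  (LinearMap.mul R (ExteriorAlgebra R D.H)) ∘ₗ (ExteriorAlgebra.ι R) ∘ₗ
      (D.H.projectionOnto D.H' D.isCompl)
    + (CliffordAlgebra.contractLeft (Q := (0 : QuadraticForm R D.H))) ∘ₗ
      D.H.subtype.dualMap ∘ₗ form

theorem contractLeft_mem_VEven (d : Dual R D.H) {s : ExteriorAlgebra R D.H} (hs : s ∈ D.VOdd) :
    CliffordAlgebra.contractLeft (Q := (0 : QuadraticForm R D.H)) d s ∈ D.VEven := by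
  induction s, hs using CliffordAlgebra.odd_induction with
  | ι v =>
    rw [CliffordAlgebra.contractLeft_ι, Algebra.algebraMap_eq_smul_one]
    exact D.VEven.smul_mem _ (Submodule.one_le.mp (CliffordAlgebra.one_le_evenOdd_zero _))
  | add x y hx hy ihx ihy =>
    rw [map_add]
    exact add_mem ihx ihy
  | ι_mul_ι_mul m₁ m₂ x hx ih =>
    rw [mul_assoc, CliffordAlgebra.contractLeft_ι_mul, CliffordAlgebra.contractLeft_ι_mul]
    have h1 (m : D.H) : CliffordAlgebra.ι (0 : QuadraticForm R D.H) m * x ∈ D.VEven := by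
      have := CliffordAlgebra.evenOdd_mul_le (0 : QuadraticForm R D.H) 1 1
        (Submodule.mul_mem_mul (CliffordAlgebra.ι_mem_evenOdd_one _ m) hx)
      simpa [show (1 : ZMod 2) + 1 = 0 from rfl] using this
    refine sub_mem (D.VEven.smul_mem _ (h1 m₂)) ?_
    rw [mul_sub, mul_smul_comm, ← mul_assoc]
    refine sub_mem (D.VEven.smul_mem _ (h1 m₁)) ?_
    have := CliffordAlgebra.evenOdd_mul_le (0 : QuadraticForm R D.H) 0 0
      (Submodule.mul_mem_mul (CliffordAlgebra.ι_mul_ι_mem_evenOdd_zero _ m₁ m₂) ih)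
    simpa using this

theorem cliffordAction_mem_VEven (x : E) {s : ExteriorAlgebra R D.H} (hs : s ∈ D.VOdd) :
    D.cliffordAction x s ∈ D.VEven := by
  refine add_mem ?_ (D.contractLeft_mem_VEven _ hs)
  have := CliffordAlgebra.evenOdd_mul_le (0 : QuadraticForm R D.H) 1 1
    (Submodule.mul_mem_mul (CliffordAlgebra.ι_mem_evenOdd_one _
      (D.H.projectionOnto D.H' D.isCompl x)) hs)
  simpa [show (1 : ZMod 2) + 1 = 0 from rfl] using this

/-- For an odd spinor `a`, the map `H ⊕ H' → ⋀^even H`, `x ↦ x • a`. -/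
def actOn (a : D.VOdd) : E →ₗ[R] D.VEven :=
  (D.cliffordAction.flip (a : ExteriorAlgebra R D.H)).codRestrict D.VEven
    fun x => D.cliffordAction_mem_VEven x a.2

/-- The inclusion of `H* = ⋀^1 H*` in the dual of `⋀^odd H`. -/
def dualInclOdd : Dual R D.H →ₗ[R] Dual R D.VOdd :=
  (ExteriorAlgebra.ιInv ∘ₗ D.VOdd.subtype).dualMap

/-- The element `1 ∈ R = ⋀^0 H*` in the dual of `⋀^even H`. -/
def dualOneEven : Dual R D.VEven :=
  (ExteriorAlgebra.algebraMapInv (R := R) (M := D.H)).toLinearMap ∘ₗ D.VEven.subtype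

/-- `d₁ : H* → R`, the restriction of the dual of the spinor coordinates
`a : R → ⋀^odd H` to `H* = ⋀^1 H*`. -/
def d₁ (a : D.VOdd) : Dual R D.H →ₗ[R] R := (Dual.eval R D.VOdd a) ∘ₗ D.dualInclOdd

/-- The ideal generated by the entries of `d₁`. -/
def idealOf (a : D.VOdd) : Ideal R := LinearMap.range (D.d₁ a)

end IsotropicDecomposition

namespace SelfDualSequence

variable {R : Type u} [CommRing R] {B₀ B₁ B₂ : Type v}
  [AddCommGroup B₀] [Module R B₀] [AddCommGroup B₁] [Module R B₁]
  [AddCommGroup B₂] [Module R B₂] (B : SelfDualSequence R B₀ B₁ B₂)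

/-- The isomorphism `B₂ ≅ B₂*` given by the form. -/
def formEquiv : B₂ ≃ₗ[R] Dual R B₂ := LinearEquiv.ofBijective B.form B.form_bijective

/-- `δ₃` is the dual of `δ₂`, through `B₂* ≅ B₂`. -/
def δ₃ : Dual R B₁ →ₗ[R] B₂ := B.formEquiv.symm.toLinearMap ∘ₗ B.δ₂.dualMap

/-- `δ₄` is the dual of `δ₁`. -/
def δ₄ : Dual R B₀ →ₗ[R] Dual R B₁ := B.δ₁.dualMap

/-- `0 → B₀* → B₁* → B₂ → B₁ → B₀` is an acyclic complex: exact except at `B₀`. -/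
structure IsAcyclic : Prop where
  injective : Function.Injective B.δ₄
  exact₃ : Function.Exact B.δ₄ B.δ₃
  exact₂ : Function.Exact B.δ₃ B.δ₂
  exact₁ : Function.Exact B.δ₂ B.δ₁

variable (D : IsotropicDecomposition B.form)

/-- `a ∈ ⋀^odd H` is a system of spinor coordinates for `B`: over the complement `U` of the support
of the module `B₀ / im δ₁`, where `im δ₃` is an isotropic direct summand of rank `n`, the element
`a` has no zero, and it is the pure spinor of `im δ₃`, i.e. it spans the line of spinors that are
annihilated by the Clifford action of `im δ₃`. So `a` consists of homogeneous coordinates of the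
morphism from `U` to the projective space of `⋀^odd H` that is given by `im δ₃` and the spinor
embedding of the orthogonal Grassmannian. (Existence of such an odd `a` means in particular that
`im δ₃` and `H'` belong to different families of isotropic subspaces.) -/
structure IsSpinorCoordinates (a : D.VOdd) : Prop where
  annihilated : ∀ φ : Dual R B₁, D.actOn a (B.δ₃ φ) = 0
  nonvanishing : ∀ P : PrimeSpectrum R, P ∉ Module.support R (B₀ ⧸ LinearMap.range B.δ₁) →
    ∃ l : Dual R D.VOdd, l a ∉ P.asIdeal

/-- `B` admits spinor coordinates with respect to some decomposition of `B₂`. -/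
def HasSpinorCoordinates : Prop :=
  ∃ (D : IsotropicDecomposition B.form) (a : D.VOdd), B.IsSpinorCoordinates D a

/-- `w : (⋀^even H)* → B₁*` is a lift along `δ₃` of the dual of `x ↦ x • a`. -/
def IsSpinorLift (a : D.VOdd) (w : Dual R D.VEven →ₗ[R] Dual R B₁) : Prop :=
  B.δ₃ ∘ₗ w = B.formEquiv.symm.toLinearMap ∘ₗ (D.actOn a).dualMap

/-- `d₃ = [δ₄, w|_R] : B₀* ⊕ R → B₁*`. -/
def d₃ (w : Dual R D.VEven →ₗ[R] Dual R B₁) : (Dual R B₀ × R) →ₗ[R] Dual R B₁ :=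
  B.δ₄.coprod (LinearMap.toSpanSingleton R (Dual R B₁) (w D.dualOneEven))

/-- `d₂ : B₁* → H*`, the dual of the restriction of `δ₂` to `H`. -/
def d₂ : Dual R B₁ →ₗ[R] Dual R D.H := (B.δ₂ ∘ₗ D.H.subtype).dualMap

/-- `0 → B₀* ⊕ R → B₁* → H* → R` is an acyclic complex: exact except at `R`, so it is a
resolution of the quotient of `R` by the image of `d₁`. -/
structure IsAcyclicA (a : D.VOdd) (w : Dual R D.VEven →ₗ[R] Dual R B₁) : Prop where
  injective : Function.Injective (B.d₃ D w)
  exact₂ : Function.Exact (B.d₃ D w) (B.d₂ D)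
  exact₁ : Function.Exact (B.d₂ D) (D.d₁ a)

end SelfDualSequence

end

/-!
In hyperbolic coordinates `B₂ ≃ Rⁿ × Rⁿ` spinors are functions on subsets of `{1, …, n}` and
`im δ₃` acts by Clifford multiplication.

Acyclicity and perfection. Each entry `a {i}` of `d₁` multiplies the cycles of `𝔸` into
boundaries, so a regular sequence of length three in `I` forces `𝔸` to be acyclic. Dualizing
shows `Ext³ (R ⧸ I, R) ≠ 0` unless `I = R`. The spinor coordinates taken together have grade
three, because they vanish only where `δ₁` fails to be surjective.

Generic decompositions. The three shears in the planes of a triple of basis vectors in `T` add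
multiples of the coordinates of `a` at `T` to those at `T` minus two elements. For a generic
choice of these multiples, which exists because the residue field is infinite, the coordinate at
`T` can be dropped without lowering the grade. Repeating this from the largest odd `T` downwards
leaves the coordinates of degree one.

Factorial rings. A product of Clifford actions of elements of `im δ₃` gives a nonzero annihilated
spinor. Over a domain annihilated spinors are proportional, as each independent null vector halves
the space of spinors. Dividing out a greatest common divisor makes the spinor nonvanishing outside
the support of `coker δ₁`, and if the result is even, exchanging one `eᵢ` with `eᵢ'` makes it odd.
-/

/-! ### Regular sequences at a prime -/

section RegularAt

variable {A : Type u} [CommRing A] {P Q c : Ideal A} {x z w : A}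

/-- `x` is a nonzerodivisor on the localization of `A ⧸ c` at `P`, with denominators cleared. -/
def IsRegularModAt (P c : Ideal A) (x : A) : Prop :=
  ∀ g, x * g ∈ c → ∃ s ∉ P, s * g ∈ c

/-- The list, read from its last entry to its head, is a weakly regular sequence on the
localization of `A` at `P`. -/
def IsRegularSeqAt (P : Ideal A) : List A → Prop
  | [] => True
  | x :: l => IsRegularModAt P (Ideal.ofList l) x ∧ IsRegularSeqAt P l

/-- The prime `P` contains a sequence of length `k` that is regular on the localization of `A ⧸ c`
at `P` and has `P` as an associated prime of its quotient; so this localization has depth `k`. -/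
def HasDepthAt (P : Ideal A) : ℕ → Ideal A → Prop
  | 0, c => P ∈ associatedPrimes A (A ⧸ c)
  | k + 1, c => ∃ x ∈ P, IsRegularModAt P c x ∧ HasDepthAt P k (Ideal.span {x} ⊔ c)

/-- The ideal `F` contains a sequence of length `k` that is weakly regular at `P`; so the
localization of `F` at `P` has grade at least `k`, or is the unit ideal. -/
def LocalGradeGE (P F : Ideal A) (k : ℕ) : Prop :=
  ∃ l : List A, l.length = k ∧ (∀ x ∈ l, x ∈ F) ∧ IsRegularSeqAt P l

theorem mem_span_singleton_sup_iff_exists_sub_mem {g : A} :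
    g ∈ Ideal.span {x} ⊔ c ↔ ∃ h, g - x * h ∈ c := by
  simp only [Ideal.mem_span_singleton_sup]
  constructor
  · rintro ⟨a, b, hb, rfl⟩
    exact ⟨a, by rwa [mul_comm, add_sub_cancel_left]⟩
  · rintro ⟨a, ha⟩
    exact ⟨a, _, ha, by ring⟩

theorem IsRegularModAt.mono (h : IsRegularModAt P c x) (hQ : Q ≤ P) : IsRegularModAt Q c x :=
  fun g hg => let ⟨s, hs, hsg⟩ := h g hg; ⟨s, fun hs' => hs (hQ hs'), hsg⟩

theorem IsRegularSeqAt.mono (hQ : Q ≤ P) :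
    ∀ {l : List A}, IsRegularSeqAt P l → IsRegularSeqAt Q l
  | [], _ => trivial
  | _ :: _, h => ⟨h.1.mono hQ, h.2.mono hQ⟩

theorem exists_notMem_forall_mul_mem [hP : P.IsPrime] {K : Ideal A} (hK : K.FG)
    (h : ∀ g ∈ K, ∃ s ∉ P, s * g ∈ c) : ∃ s ∉ P, ∀ g ∈ K, s * g ∈ c := by
  obtain ⟨T, rfl⟩ := hK
  choose! s hs hsg using fun g (hg : g ∈ T) => h g (Ideal.subset_span hg)
  refine ⟨∏ g ∈ T, s g, ?_, fun g hg => ?_⟩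
  · rw [hP.prod_mem_iff]
    rintro ⟨g, hg, hgP⟩
    exact hs g hg hgP
  · suffices hT : Submodule.span A T ≤ Submodule.comap (LinearMap.mulLeft A (∏ g ∈ T, s g)) c from
      hT hg
    refine Submodule.span_le.mpr fun y hy => ?_
    exact c.mem_of_dvd (mul_dvd_mul_right (Finset.dvd_prod_of_mem s hy) y) (hsg y hy)

theorem mem_associatedPrimes_quotient_iff [IsNoetherianRing A] :
    P ∈ associatedPrimes A (A ⧸ c) ↔ P.IsPrime ∧ ∃ g, ∀ s, s ∈ P ↔ s * g ∈ c := by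
  refine isAssociatedPrime_iff.trans (and_congr_right fun _ => ?_)
  have key (g s : A) : s ∈ Submodule.colon ⊥ {Ideal.Quotient.mk c g} ↔ s * g ∈ c := by
    rw [Submodule.mem_colon_singleton, Submodule.mem_bot, Algebra.smul_def,
      Ideal.Quotient.algebraMap_eq, ← map_mul, Ideal.Quotient.eq_zero_iff_mem]
  simp only [Ideal.Quotient.mk_surjective.exists, SetLike.ext_iff, key]

theorem mem_associatedPrimes_quotient_of_locally [IsNoetherianRing A] [hP : P.IsPrime] {g : A}
    (h : ∀ y ∈ P, ∃ s ∉ P, s * (y * g) ∈ c) (h' : ∀ s, s * g ∈ c → s ∈ P) :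
    P ∈ associatedPrimes A (A ⧸ c) := by
  obtain ⟨s, hs, hsg⟩ := exists_notMem_forall_mul_mem
    (c := Submodule.comap (LinearMap.mulRight A g) c) (IsNoetherian.noetherian P) fun y hy => by
      obtain ⟨s, hs, hsy⟩ := h y hy
      exact ⟨s, hs, by simpa [mul_assoc] using hsy⟩
  refine mem_associatedPrimes_quotient_iff.mpr ⟨hP, s * g, fun y => ⟨fun hy => ?_, fun hy => ?_⟩⟩
  · have : s * y * g ∈ c := hsg y hy
    rwa [mul_left_comm, ← mul_assoc]
  · exact (hP.mem_or_mem (h' (y * s) (by rwa [mul_assoc]))).resolve_right hs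

theorem isRegularModAt_iff_forall_associatedPrimes [IsNoetherianRing A] [P.IsPrime] :
    IsRegularModAt P c x ↔ ∀ Q ∈ associatedPrimes A (A ⧸ c), Q ≤ P → x ∉ Q := by
  refine ⟨fun h Q hQ hQP hx => ?_, fun h g hg => ?_⟩
  · obtain ⟨-, g, hg⟩ := mem_associatedPrimes_quotient_iff.mp hQ
    obtain ⟨s, hs, hsg⟩ := h g ((hg x).mp hx)
    exact hs (hQP ((hg s).mpr hsg))
  · by_contra! hcon
    let N : Submodule A (A ⧸ c) := A ∙ (Ideal.Quotient.mk c g)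
    have mem_annihilator (s : A) : s ∈ Module.annihilator A N ↔ s * g ∈ c := by
      rw [Submodule.mem_annihilator_span_singleton, Algebra.smul_def,
        Ideal.Quotient.algebraMap_eq, ← map_mul, Ideal.Quotient.eq_zero_iff_mem]
    have hNP : Module.annihilator A N ≤ P := fun s hs => by
      by_contra hsP
      exact hcon s hsP ((mem_annihilator s).mp hs)
    obtain ⟨Q, hQ, hQP⟩ := Ideal.exists_minimalPrimes_le hNP
    refine h Q (associatedPrimes.subset_of_injective N.injective_subtype
      (Module.associatedPrimes.minimalPrimes_annihilator_subset_associatedPrimes A N hQ)) hQP ?_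
    exact hQ.1.2 ((mem_annihilator x).mpr hg)

theorem exists_mem_forall_isRegularModAt [IsNoetherianRing A] [P.IsPrime] (F : Ideal A)
    {C : Set (Ideal A)} (hC : C.Finite)
    (h : ∀ c ∈ C, ∀ Q ∈ associatedPrimes A (A ⧸ c), Q ≤ P → ¬ F ≤ Q) :
    ∃ x ∈ F, ∀ c ∈ C, IsRegularModAt P c x := by
  let T : Set (Ideal A) := ⋃ c ∈ C, {Q ∈ associatedPrimes A (A ⧸ c) | Q ≤ P}
  have hT : T.Finite := hC.biUnion fun c _ =>
    (associatedPrimes.finite A (A ⧸ c)).subset (Set.sep_subset _ _)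
  have hprime : ∀ Q ∈ T, Q.IsPrime := fun Q hQ => by
    obtain ⟨c, -, hQ, -⟩ := Set.mem_iUnion₂.mp hQ
    exact hQ.1
  have hFT : ¬ (F : Set A) ⊆ ⋃ Q ∈ T, (Q : Set A) := fun hcover => by
    obtain ⟨Q, hQ, hFQ⟩ :=
      (F.subset_union_prime_finite hT (f := id) ⊥ ⊥ fun Q hQ _ _ => hprime Q hQ).mp hcover
    obtain ⟨c, hc, hQc, hQP⟩ := Set.mem_iUnion₂.mp hQ
    exact h c hc Q hQc hQP hFQ
  obtain ⟨x, hxF, hx⟩ := Set.not_subset.mp hFT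
  refine ⟨x, hxF, fun c hc => isRegularModAt_iff_forall_associatedPrimes.mpr
    fun Q hQ hQP hxQ => hx (Set.mem_biUnion (Set.mem_biUnion hc ⟨hQ, hQP⟩) hxQ)⟩

theorem IsRegularModAt.exchange (hP : P.IsPrime) (hx : IsRegularModAt P c x)
    (hwx : IsRegularModAt P (Ideal.span {x} ⊔ c) w) : IsRegularModAt P (Ideal.span {w} ⊔ c) x := by
  simp only [IsRegularModAt, mem_span_singleton_sup_iff_exists_sub_mem] at hwx ⊢
  rintro g ⟨k, hk⟩
  obtain ⟨s, hs, k', hk'⟩ := hwx k ⟨g, by simpa using c.neg_mem hk⟩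
  obtain ⟨t, ht, htg⟩ := hx (s * g - w * k') (by
    convert add_mem (c.mul_mem_left s hk) (c.mul_mem_left w hk') using 1
    ring)
  exact ⟨t * s, hP.mul_notMem ht hs, t * k', by convert htg using 1; ring⟩

/-- If `g` has annihilator `P` modulo `(x) + c`, write `z g = x g'` modulo `c`: then `g'` has
annihilator `P` modulo `(z) + c`. -/
theorem mem_associatedPrimes_span_sup_swap [IsNoetherianRing A] (hx : IsRegularModAt P c x)
    (hz : IsRegularModAt P c z) (hzP : z ∈ P)
    (h : P ∈ associatedPrimes A (A ⧸ (Ideal.span {x} ⊔ c))) :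
    P ∈ associatedPrimes A (A ⧸ (Ideal.span {z} ⊔ c)) := by
  obtain ⟨hP, g, hg⟩ := mem_associatedPrimes_quotient_iff.mp h
  simp only [mem_span_singleton_sup_iff_exists_sub_mem] at hg
  obtain ⟨g', hg'⟩ := (hg z).mp hzP
  refine mem_associatedPrimes_quotient_of_locally (g := g') (fun y hy => ?_) fun s hs => ?_
  · obtain ⟨k, hk⟩ := (hg y).mp hy
    obtain ⟨r, hr, hrg⟩ := hx (y * g' - z * k) (by
      convert sub_mem (c.mul_mem_left z hk) (c.mul_mem_left y hg') using 1
      ring)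
    refine ⟨r, hr, mem_span_singleton_sup_iff_exists_sub_mem.mpr ⟨r * k, ?_⟩⟩
    convert hrg using 1
    ring
  · obtain ⟨k, hk⟩ := mem_span_singleton_sup_iff_exists_sub_mem.mp hs
    obtain ⟨r, hr, hrg⟩ := hz (s * g - x * k) (by
      convert add_mem (c.mul_mem_left s hg') (c.mul_mem_left x hk) using 1
      ring)
    have hrs : r * s ∈ P := (hg _).mpr ⟨r * k, by convert hrg using 1; ring⟩
    exact (hP.mem_or_mem hrs).resolve_left hr

theorem HasDepthAt.span_singleton_sup [IsNoetherianRing A] [hP : P.IsPrime] {k : ℕ}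
    (h : HasDepthAt P (k + 1) c) (hzP : z ∈ P) (hz : IsRegularModAt P c z) :
    HasDepthAt P k (Ideal.span {z} ⊔ c) := by
  induction k generalizing c z with
  | zero =>
    obtain ⟨x, -, hx, hPx⟩ := h
    exact mem_associatedPrimes_span_sup_swap hx hz hzP hPx
  | succ k ih =>
    obtain ⟨x, hxP, hx, h⟩ := h
    have hPx : P ∉ associatedPrimes A (A ⧸ (Ideal.span {x} ⊔ c)) := fun hPx => by
      obtain ⟨y, hyP, hy, -⟩ := h
      exact isRegularModAt_iff_forall_associatedPrimes.mp hy P hPx le_rfl hyP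
    have hPz : P ∉ associatedPrimes A (A ⧸ (Ideal.span {z} ⊔ c)) := fun hPz =>
      hPx (mem_associatedPrimes_span_sup_swap hz hx hxP hPz)
    obtain ⟨w, hwP, hw⟩ := exists_mem_forall_isRegularModAt (P := P) P
      (Set.toFinite {Ideal.span {x} ⊔ c, Ideal.span {z} ⊔ c}) (by
        rintro d hd Q hQ hQP hPQ
        obtain rfl := le_antisymm hQP hPQ
        rcases hd with rfl | rfl <;> contradiction)
    have hwx : IsRegularModAt P (Ideal.span {x} ⊔ c) w := hw _ (by simp)
    have hwz : IsRegularModAt P (Ideal.span {z} ⊔ c) w := hw _ (by simp)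
    have hxw : HasDepthAt P k (Ideal.span {x} ⊔ (Ideal.span {w} ⊔ c)) := by
      rw [sup_left_comm]
      exact ih h hwP hwx
    have hzw := ih (c := Ideal.span {w} ⊔ c) ⟨x, hxP, hx.exchange hP hwx, hxw⟩ hzP
      (hz.exchange hP hwz)
    exact ⟨w, hwP, hwz, by rwa [sup_left_comm]⟩

theorem IsRegularSeqAt.hasDepthAt : ∀ {l : List A} {k : ℕ}, IsRegularSeqAt P l →
    (∀ x ∈ l, x ∈ P) → HasDepthAt P k (Ideal.ofList l) → HasDepthAt P (k + l.length) ⊥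
  | [], k, _, _, h => by simpa using h
  | x :: l, k, h, hl, hk => by
    obtain ⟨hx, hl⟩ := List.forall_mem_cons.mp hl
    rw [List.length_cons, add_comm l.length, ← add_assoc]
    exact h.2.hasDepthAt hl ⟨x, hx, h.1, by rwa [← Ideal.ofList_cons]⟩

theorem IsRegularSeqAt.exists_add_length_eq [IsNoetherianRing A] [P.IsPrime] {j : ℕ}
    (hj : HasDepthAt P j ⊥) : ∀ {l : List A}, IsRegularSeqAt P l → (∀ x ∈ l, x ∈ P) →
    ∃ i, i + l.length = j ∧ HasDepthAt P i (Ideal.ofList l)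
  | [], _, _ => ⟨j, rfl, by simpa using hj⟩
  | x :: l, h, hl => by
    obtain ⟨hx, hl⟩ := List.forall_mem_cons.mp hl
    obtain ⟨i, hi, hd⟩ := h.2.exists_add_length_eq hj hl
    cases i with
    | zero => exact absurd hx (isRegularModAt_iff_forall_associatedPrimes.mp h.1 P hd le_rfl)
    | succ i =>
      refine ⟨i, by rw [List.length_cons]; omega, ?_⟩
      rw [Ideal.ofList_cons]
      exact hd.span_singleton_sup hx h.1

theorem IsRegularSeqAt.length_le_of_mem_associatedPrimes [IsNoetherianRing A] [P.IsPrime]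
    {l m : List A} (hl : IsRegularSeqAt P l) (hlP : ∀ x ∈ l, x ∈ P) (hm : IsRegularSeqAt P m)
    (hmP : ∀ x ∈ m, x ∈ P) (hP : P ∈ associatedPrimes A (A ⧸ Ideal.ofList l)) :
    m.length ≤ l.length := by
  obtain ⟨i, hi, -⟩ := hm.exists_add_length_eq (hl.hasDepthAt (k := 0) hlP hP) hmP
  omega

namespace LocalGradeGE

variable {F : Ideal A} {k : ℕ}

theorem mono {G : Ideal A} (h : LocalGradeGE P F k) (hQ : Q ≤ P) (hF : F ≤ G) :
    LocalGradeGE Q G k :=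
  let ⟨l, hl, hlF, hreg⟩ := h
  ⟨l, hl, fun x hx => hF (hlF x hx), hreg.mono hQ⟩

theorem of_forall_associatedPrimes [IsNoetherianRing A] [P.IsPrime]
    (h : ∀ l : List A, l.length < k → (∀ x ∈ l, x ∈ F) → IsRegularSeqAt P l →
      ∀ Q ∈ associatedPrimes A (A ⧸ Ideal.ofList l), Q ≤ P → ¬ F ≤ Q) : LocalGradeGE P F k := by
  induction k with
  | zero => exact ⟨[], rfl, by simp, trivial⟩
  | succ k ih =>
    obtain ⟨l, hl, hlF, hreg⟩ := ih fun l hl => h l (by omega)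
    obtain ⟨x, hxF, hx⟩ := exists_mem_forall_isRegularModAt (P := P) F
      (Set.finite_singleton (Ideal.ofList l)) (by
        rintro _ rfl
        exact h l (by omega) hlF hreg)
    exact ⟨x :: l, by simp [hl], by simpa [hxF] using hlF, hx _ rfl, hreg⟩

theorem not_le_of_mem_associatedPrimes [IsNoetherianRing A] (hF : LocalGradeGE Q F k)
    {l : List A} (hl : IsRegularSeqAt Q l) (hlQ : ∀ x ∈ l, x ∈ Q) (hlk : l.length < k)
    (hQ : Q ∈ associatedPrimes A (A ⧸ Ideal.ofList l)) : ¬ F ≤ Q := by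
  intro hle
  have := hQ.1
  obtain ⟨m, hm, hmF, hmreg⟩ := hF
  have := hl.length_le_of_mem_associatedPrimes hlQ hmreg (fun x hx => hle (hmF x hx)) hQ
  omega

theorem of_sup_span_singleton [IsNoetherianRing A] [P.IsPrime] {v : A}
    (h : LocalGradeGE P (F ⊔ Ideal.span {v}) k)
    (hv : ∀ Q : Ideal A, Q.IsPrime → v ∉ Q → LocalGradeGE Q F k) :
    LocalGradeGE P F k := by
  refine of_forall_associatedPrimes fun l hlk hlF hl Q hQ hQP hFQ => ?_
  have hlQ : ∀ x ∈ l, x ∈ Q := fun x hx => hFQ (hlF x hx)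
  by_cases hvQ : v ∈ Q
  · exact (h.mono hQP le_rfl).not_le_of_mem_associatedPrimes (hl.mono hQP) hlQ hlk hQ
      (sup_le hFQ ((Ideal.span_singleton_le_iff_mem Q).mpr hvQ))
  · exact (hv Q hQ.1 hvQ).not_le_of_mem_associatedPrimes (hl.mono hQP) hlQ hlk hQ hFQ

end LocalGradeGE

end RegularAt

/-! ### Regular sequences and specialization of polynomials -/

section Lifting

variable {A : Type u} [CommRing A] {P c : Ideal A} {x w : A}

/-- If `w g ∈ c`, then `g` is locally a multiple `x k` modulo `c`, and again `w k ∈ c`. So the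
localization of `(c : w) / c` is `x` times itself, and it vanishes by Nakayama's lemma. -/
theorem IsRegularModAt.of_span_singleton_sup [IsNoetherianRing A] [hP : P.IsPrime] (hxP : x ∈ P)
    (hx : IsRegularModAt P c x) (hw : IsRegularModAt P (Ideal.span {x} ⊔ c) w) :
    IsRegularModAt P c w := by
  let L := Localization.AtPrime P
  let K : Ideal A := Submodule.comap (LinearMap.mulLeft A w) c
  have hK : ∀ g ∈ K, ∃ s ∉ P, s * g ∈ c ⊔ P * K := by
    intro g hg
    have hwg : w * g ∈ c := hg
    obtain ⟨s, hs, hsg⟩ := hw g (Ideal.mem_sup_right hwg)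
    obtain ⟨k, hk⟩ := mem_span_singleton_sup_iff_exists_sub_mem.mp hsg
    obtain ⟨t, ht, htk⟩ := hx (w * k) (by
      convert sub_mem (c.mul_mem_left s hwg) (c.mul_mem_left w hk) using 1
      ring)
    have htK : t * k ∈ K := by
      change w * (t * k) ∈ c
      rwa [mul_left_comm]
    refine ⟨t * s, hP.mul_notMem ht hs, ?_⟩
    convert Submodule.add_mem_sup (c.mul_mem_left t hk) (Ideal.mul_mem_mul hxP htK) using 1
    ring
  have hKL : K.map (algebraMap A L) ≤
      c.map (algebraMap A L) ⊔ IsLocalRing.maximalIdeal L • K.map (algebraMap A L) := by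
    rw [Ideal.map_le_iff_le_comap, smul_eq_mul, ← Localization.AtPrime.map_eq_maximalIdeal,
      ← Ideal.map_mul, ← Ideal.map_sup]
    intro g hg
    obtain ⟨s, hs, hsg⟩ := hK g hg
    exact (IsLocalization.algebraMap_mem_map_algebraMap_iff P.primeCompl L _ g).mpr ⟨s, hs, hsg⟩
  have hKc := Submodule.le_of_le_smul_of_le_jacobson_bot (IsNoetherian.noetherian _)
    (IsLocalRing.maximalIdeal_le_jacobson _) hKL
  intro g hg
  obtain ⟨s, hs, hsg⟩ := (IsLocalization.algebraMap_mem_map_algebraMap_iff P.primeCompl L _ g).mp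
    (hKc (Ideal.mem_map_of_mem _ (show g ∈ K from hg)))
  exact ⟨s, hs, hsg⟩

variable {B : Type v} [CommRing B] {φ : A →+* B}

theorem IsRegularModAt.comap (hφ : Function.Surjective φ) {n : Ideal B}
    (h : IsRegularModAt n (c.map φ) (φ w)) : IsRegularModAt (n.comap φ) (RingHom.ker φ ⊔ c) w := by
  simp only [IsRegularModAt, sup_comm _ c, ← Ideal.comap_map_of_surjective' φ hφ,
    Ideal.mem_comap, map_mul]
  intro g hg
  obtain ⟨s, hs, hsg⟩ := h (φ g) hg
  obtain ⟨s, rfl⟩ := hφ s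
  exact ⟨s, hs, hsg⟩

theorem IsRegularSeqAt.of_map [IsNoetherianRing A] (hφ : Function.Surjective φ)
    (hker : RingHom.ker φ = Ideal.span {x}) (hx : ∀ g, x * g = 0 → g = 0) {n : Ideal B}
    [hn : n.IsPrime] : ∀ {l : List A}, IsRegularSeqAt n (l.map φ) →
      IsRegularSeqAt (n.comap φ) l ∧ IsRegularModAt (n.comap φ) (Ideal.ofList l) x
  | [], _ => by
    refine ⟨trivial, fun g hg => ⟨1, Ideal.IsPrime.one_notMem inferInstance, ?_⟩⟩
    rw [Ideal.ofList_nil, Ideal.mem_bot] at hg ⊢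
    rw [hx g hg, mul_zero]
  | f :: l, ⟨hf, hl⟩ => by
    obtain ⟨ihl, ihx⟩ := IsRegularSeqAt.of_map hφ hker hx hl
    have hxn : x ∈ n.comap φ := by
      have : φ x = 0 := (RingHom.mem_ker (f := φ)).mp (hker ▸ Ideal.mem_span_singleton_self x)
      simp [this]
    rw [← Ideal.map_ofList] at hf
    have hfx := hf.comap hφ
    rw [hker] at hfx
    refine ⟨⟨ihx.of_span_singleton_sup hxn hfx, ihl⟩, ?_⟩
    rw [Ideal.ofList_cons]
    exact ihx.exchange inferInstance hfx

theorem LocalGradeGE.comap [IsNoetherianRing A] (hφ : Function.Surjective φ)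
    (hker : RingHom.ker φ = Ideal.span {x}) (hx : ∀ g, x * g = 0 → g = 0) {n : Ideal B}
    [n.IsPrime] {F : Ideal A} {k : ℕ} (h : LocalGradeGE n (F.map φ) k) :
    LocalGradeGE (n.comap φ) F k := by
  obtain ⟨l, hl, hlF, hreg⟩ := h
  choose! ψ hψF hψ using fun y (hy : y ∈ F.map φ) => (Ideal.mem_map_iff_of_surjective φ hφ).mp hy
  have hlψ : (l.map ψ).map φ = l := by
    rw [List.map_map]
    exact (List.map_congr_left fun y hy => hψ y (hlF y hy)).trans (List.map_id l)
  refine ⟨l.map ψ, by simp [hl], ?_, (IsRegularSeqAt.of_map hφ hker hx (hlψ.symm ▸ hreg)).1⟩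
  intro x hx
  obtain ⟨y, hy, rfl⟩ := List.mem_map.mp hx
  exact hψF y (hlF y hy)

end Lifting

section Specialization

open Polynomial

variable {A : Type u} [CommRing A]

theorem mem_map_evalRingHom_iff {a : A} {c : Ideal A[X]} {h : A[X]} :
    eval a h ∈ c.map (evalRingHom a) ↔ ∃ v, h - (X - C a) * v ∈ c := by
  rw [← mem_span_singleton_sup_iff_exists_sub_mem, ← ker_evalRingHom, sup_comm,
    ← Ideal.comap_map_of_surjective' _ fun b => ⟨C b, by simp⟩]
  rfl

theorem IsRegularModAt.map_evalRingHom {p : Ideal A} {c : Ideal A[X]} {f r : A[X]} {a : A}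
    (hr : ∀ g, f * g ∈ c → r * g ∈ c) (hrp : eval a r ∉ p)
    (ha : ∀ v, (X - C a) * v ∈ Ideal.span {f} ⊔ c → v ∈ Ideal.span {f} ⊔ c) :
    IsRegularModAt p (c.map (evalRingHom a)) (eval a f) := by
  intro g hg
  obtain ⟨v, hv⟩ := mem_map_evalRingHom_iff.mp (show eval a (f * C g) ∈ _ by simpa)
  obtain ⟨w, hw⟩ := mem_span_singleton_sup_iff_exists_sub_mem.mp
    (ha v (mem_span_singleton_sup_iff_exists_sub_mem.mpr ⟨C g, by simpa using c.neg_mem hv⟩))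
  have hmem := hr (C g - (X - C a) * w) (by
    convert add_mem hv (c.mul_mem_left (X - C a) hw) using 1
    ring)
  refine ⟨eval a r, hrp, ?_⟩
  simpa using Ideal.mem_map_of_mem (evalRingHom a) hmem

theorem finite_setOf_eval_mem {p : Ideal A} [hp : p.IsPrime] {K : Type*} {σ : K → A}
    (hσ : Pairwise fun s t => IsUnit (σ s - σ t)) {h : A[X]} (hh : h ∉ p.map C) :
    {s | eval (σ s) h ∈ p}.Finite := by
  have hne : h.map (Ideal.Quotient.mk p) ≠ 0 := fun h0 => hh <| Ideal.mem_map_C_iff.mpr fun i => by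
    rw [← Ideal.Quotient.eq_zero_iff_mem, ← coeff_map, h0, coeff_zero]
  have hinj : Function.Injective fun s => Ideal.Quotient.mk p (σ s) := by
    intro s t hst
    by_contra hne
    exact hp.ne_top (p.eq_top_of_isUnit_mem (Ideal.Quotient.eq.mp hst) (hσ hne))
  refine ((finite_setOfPred_isRoot hne).preimage hinj.injOn).subset fun s hs => ?_
  simp only [Set.mem_preimage, Set.mem_ofPred_eq, IsRoot.def]
  rw [Polynomial.eval_map, eval₂_hom]
  exact Ideal.Quotient.eq_zero_iff_mem.mpr hs

/-- A linear form `X - σ s` that is a zero divisor modulo `c` lies in one of the finitely many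
associated primes of `c`, and none of these contains two such forms. -/
theorem finite_setOf_X_sub_C_mul_mem [IsNoetherianRing A] {K : Type*} {σ : K → A}
    (hσ : Pairwise fun s t => IsUnit (σ s - σ t)) (c : Ideal A[X]) :
    {s | ∃ v, (X - C (σ s)) * v ∈ c ∧ v ∉ c}.Finite := by
  have hfin : (⋃ Q ∈ associatedPrimes A[X] (A[X] ⧸ c), {s | X - C (σ s) ∈ Q}).Finite := by
    refine (associatedPrimes.finite _ _).biUnion fun Q hQ => Set.Subsingleton.finite ?_
    intro s hs t ht
    by_contra hne
    refine hQ.1.ne_top (Q.eq_top_of_isUnit_mem ?_ ((hσ hne).map C))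
    simpa using sub_mem (Set.mem_ofPred.mp ht) (Set.mem_ofPred.mp hs)
  refine hfin.subset fun s ⟨v, hv, hvc⟩ => ?_
  suffices hzd : X - C (σ s) ∈ ⋃ Q ∈ associatedPrimes A[X] (A[X] ⧸ c), (Q : Set A[X]) by
    simpa using hzd
  rw [biUnion_associatedPrimes_eq_zero_divisors]
  refine ⟨Ideal.Quotient.mk c v, fun h => hvc (Ideal.Quotient.eq_zero_iff_mem.mp h), ?_⟩
  exact Ideal.Quotient.eq_zero_iff_mem.mpr hv

theorem IsRegularSeqAt.finite_setOf_not_eval [IsNoetherianRing A] {p : Ideal A} [p.IsPrime]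
    {K : Type*} {σ : K → A} (hσ : Pairwise fun s t => IsUnit (σ s - σ t)) :
    ∀ {l : List A[X]}, IsRegularSeqAt (p.map C) l →
      {s | ¬ IsRegularSeqAt p (l.map (evalRingHom (σ s)))}.Finite
  | [], _ => by simp [IsRegularSeqAt]
  | f :: l, ⟨hf, hl⟩ => by
    have : (p.map (C : A →+* A[X])).IsPrime := inferInstance
    obtain ⟨r, hr, hrc⟩ := exists_notMem_forall_mul_mem (P := p.map C) (IsNoetherian.noetherian
      (Submodule.comap (LinearMap.mulLeft A[X] f) (Ideal.ofList l))) hf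
    refine ((IsRegularSeqAt.finite_setOf_not_eval hσ hl).union
      ((finite_setOf_X_sub_C_mul_mem hσ (Ideal.span {f} ⊔ Ideal.ofList l)).union
        (finite_setOf_eval_mem hσ hr))).subset fun s hs => ?_
    by_contra! hcon
    simp only [Set.mem_union, Set.mem_ofPred_eq, not_or, not_not, not_exists, not_and] at hcon
    obtain ⟨hreg, hzd, hrp⟩ := hcon
    refine hs ⟨?_, hreg⟩
    rw [← Ideal.map_ofList]
    exact IsRegularModAt.map_evalRingHom hrc hrp hzd

theorem LocalGradeGE.exists_eval [IsNoetherianRing A] {p : Ideal A} [p.IsPrime] {K : Type*}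
    [Infinite K] {σ : K → A} (hσ : Pairwise fun s t => IsUnit (σ s - σ t)) {F : Ideal A[X]}
    {k : ℕ} (h : LocalGradeGE (p.map C) F k) :
    ∃ s, LocalGradeGE p (F.map (evalRingHom (σ s))) k := by
  obtain ⟨l, hl, hlF, hreg⟩ := h
  obtain ⟨s, hs⟩ := (hreg.finite_setOf_not_eval hσ).infinite_compl.nonempty
  refine ⟨s, l.map (evalRingHom (σ s)), by simp [hl], fun x hx => ?_, not_not.mp hs⟩
  obtain ⟨y, hy, rfl⟩ := List.mem_map.mp hx
  exact Ideal.mem_map_of_mem _ (hlF y hy)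

theorem IsRegularSeqAt.map_C {P : Ideal A[X]} [hP : P.IsPrime] :
    ∀ {l : List A}, IsRegularSeqAt (P.comap C) l → IsRegularSeqAt P (l.map C)
  | [], _ => trivial
  | f :: l, ⟨hf, hl⟩ => by
    refine ⟨fun g hg => ?_, hl.map_C⟩
    simp only [← Ideal.map_ofList, Ideal.mem_map_C_iff, coeff_C_mul] at hg ⊢
    choose s hs hsg using fun i => hf _ (hg i)
    refine ⟨C (∏ i ∈ g.support, s i), ?_, fun i => ?_⟩
    · rw [map_prod, hP.prod_mem_iff]
      rintro ⟨i, -, hi⟩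
      exact hs i hi
    · rw [coeff_C_mul]
      by_cases hi : i ∈ g.support
      · exact Ideal.mem_of_dvd _ (mul_dvd_mul_right (Finset.dvd_prod_of_mem s hi) _) (hsg i)
      · rw [notMem_support_iff.mp hi, mul_zero]
        exact zero_mem _

theorem C_pow_mul_mem_of_linear_mul_mem {c : Ideal A} {u v : A} {g : A[X]} {N : ℕ}
    (hg : g.degree < N) (h : (C u + X * C v) * g ∈ c.map C) : C v ^ N * g ∈ c.map C := by
  rw [degree_lt_iff_coeff_zero] at hg
  induction N generalizing g with
  | zero =>
    have : g = 0 := by ext i; simpa using hg i (Nat.zero_le i)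
    simp [this]
  | succ N ih =>
    have hcoeff : v * g.coeff N ∈ c := by
      simpa [add_mul, mul_assoc, hg (N + 1) le_rfl] using Ideal.mem_map_C_iff.mp h (N + 1)
    have hmon : monomial N (v * g.coeff N) ∈ c.map C := by
      rw [← C_mul_X_pow_eq_monomial]
      exact Ideal.mul_mem_right _ _ (Ideal.mem_map_of_mem _ hcoeff)
    have hlower := ih (g := C v * g - monomial N (v * g.coeff N)) (fun i hi => by
      rw [coeff_sub, coeff_C_mul, coeff_monomial]
      split_ifs with hiN
      · rw [hiN, sub_self]
      · rw [hg i (by omega), mul_zero, sub_zero]) (by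
      convert sub_mem (Ideal.mul_mem_left _ (C v) h) (Ideal.mul_mem_left _ (C u + X * C v) hmon)
        using 1
      ring)
    convert add_mem hlower (Ideal.mul_mem_left _ (C v ^ N) hmon) using 1
    ring

theorem IsRegularSeqAt.cons_linear {P : Ideal A[X]} [hP : P.IsPrime] {l : List A}
    (h : IsRegularSeqAt (P.comap C) l) (u : A) {v : A} (hv : C v ∉ P) :
    IsRegularSeqAt P ((C u + X * C v) :: l.map C) := by
  refine ⟨fun g hg => ?_, h.map_C⟩
  rw [← Ideal.map_ofList] at hg ⊢
  exact ⟨C v ^ (g.natDegree + 1), fun hm => hv (hP.mem_of_pow_mem _ hm),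
    C_pow_mul_mem_of_linear_mul_mem
      (degree_le_natDegree.trans_lt (by exact_mod_cast g.natDegree.lt_succ_self)) hg⟩

/-- The generic member `a + X b` of the pencil of families spanned by `a` and `b`. -/
noncomputable def genericPencil {ι : Type*} (a b : ι → A) (i : ι) : A[X] := C (a i) + X * C (b i)

theorem LocalGradeGE.genericPencil_sup_span_singleton [IsNoetherianRing A] {n : Ideal A}
    [n.IsPrime] {ι : Type*} {a : ι → A} (b : ι → A) {v : A} {k : ℕ}
    (h : LocalGradeGE n (Ideal.span (Set.range a) ⊔ Ideal.span {v}) k) :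
    LocalGradeGE (n.comap (evalRingHom 0))
      (Ideal.span (Set.range (genericPencil a b)) ⊔ Ideal.span {C v}) k := by
  refine LocalGradeGE.comap (x := X) (fun a => ⟨C a, by simp⟩) (by simp [ker_evalRingHom])
    (fun g hg => isRegular_X.left (by simpa using hg)) ?_
  convert h using 2
  rw [Ideal.map_sup, Ideal.map_span, Ideal.map_span, ← Set.range_comp, Set.image_singleton]
  congr 3
  · ext i
    simp [genericPencil]
  · simp

theorem map_C_le_comap_evalRingHom_zero {p n : Ideal A} (h : p ≤ n) :
    p.map C ≤ n.comap (evalRingHom 0) :=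
  Ideal.map_le_iff_le_comap.mpr fun r hr => by simpa using h hr

theorem exists_pairwise_isUnit_sub (R : Type u) [CommRing R] [IsLocalRing R] :
    ∃ σ : IsLocalRing.ResidueField R → R, Pairwise fun s t => IsUnit (σ s - σ t) := by
  refine ⟨Function.surjInv IsLocalRing.residue_surjective, fun s t hst => ?_⟩
  have h := Function.surjInv_eq (IsLocalRing.residue_surjective (R := R))
  refine (isUnit_map_iff (IsLocalRing.residue R) _).mp ?_
  rw [map_sub, h, h]
  exact (sub_ne_zero.mpr hst).isUnit

/-- At a prime not containing `v`, the three linear polynomials with leading coefficients `b i₁`,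
`c i₂`, `d i₃` already form a regular sequence, so only the primes containing `v` matter; there the
hypothesis on `a` applies after specializing all variables to `0`. -/
theorem LocalGradeGE.genericPencil_genericPencil_genericPencil [IsNoetherianRing A] {ι : Type*}
    {a b c d : ι → A} {v : A} {i₁ i₂ i₃ : ι} (hb₁ : b i₁ ∣ v) (hc₁ : c i₁ = 0) (hd₁ : d i₁ = 0)
    (hc₂ : c i₂ ∣ v) (hd₂ : d i₂ = 0) (hd₃ : d i₃ ∣ v) {p : Ideal A} [p.IsPrime]
    (h : LocalGradeGE p (Ideal.span (Set.range a) ⊔ Ideal.span {v}) 3) :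
    LocalGradeGE (((p.map C).map C).map C) (Ideal.span (Set.range
      (genericPencil (genericPencil (genericPencil a b) (C ∘ c)) (C ∘ C ∘ d)))) 3 := by
  set f₁ : ι → A[X] := genericPencil a b
  set f₂ : ι → A[X][X] := genericPencil f₁ (C ∘ c) with hf₂
  set f₃ : ι → A[X][X][X] := genericPencil f₂ (C ∘ C ∘ d) with hf₃
  have h₁ := h.genericPencil_sup_span_singleton b
  have h₂ := h₁.genericPencil_sup_span_singleton (C ∘ c)
  have h₃ := h₂.genericPencil_sup_span_singleton (C ∘ C ∘ d)
  refine (h₃.mono (map_C_le_comap_evalRingHom_zero (map_C_le_comap_evalRingHom_zero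
    (map_C_le_comap_evalRingHom_zero le_rfl))) le_rfl).of_sup_span_singleton fun Q hQ hv => ?_
  have notMem_of_dvd {r : A} (hr : r ∣ v) : C (C (C r)) ∉ Q := fun hrQ =>
    hv (Q.mem_of_dvd (map_dvd C (map_dvd C (map_dvd C hr))) hrQ)
  have hreg₁ : IsRegularSeqAt ((Q.comap C).comap C) [f₁ i₁] :=
    IsRegularSeqAt.cons_linear (l := []) trivial (a i₁) (notMem_of_dvd hb₁)
  have hreg₂ : IsRegularSeqAt (Q.comap C) [f₂ i₂, C (f₁ i₁)] :=
    hreg₁.cons_linear (f₁ i₂) (notMem_of_dvd hc₂)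
  have hreg₃ : IsRegularSeqAt Q [f₃ i₃, C (f₂ i₂), C (C (f₁ i₁))] :=
    hreg₂.cons_linear (f₂ i₃) (notMem_of_dvd hd₃)
  have h₃₂ : f₃ i₂ = C (f₂ i₂) := by simp [hf₃, genericPencil, hd₂]
  have h₃₁ : f₃ i₁ = C (C (f₁ i₁)) := by simp [hf₃, hf₂, genericPencil, hc₁, hd₁]
  refine ⟨_, rfl, ?_, hreg₃⟩
  simp only [List.forall_mem_cons, List.not_mem_nil, false_imp_iff, implies_true, and_true]
  exact ⟨Ideal.subset_span ⟨i₃, rfl⟩, Ideal.subset_span ⟨i₂, h₃₂⟩, Ideal.subset_span ⟨i₁, h₃₁⟩⟩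

theorem LocalGradeGE.exists_linear_family {R : Type u} [CommRing R] [IsNoetherianRing R]
    [IsLocalRing R] [Infinite (IsLocalRing.ResidueField R)] {ι : Type*} {a b c d : ι → R} {v : R}
    {i₁ i₂ i₃ : ι} (hb₁ : b i₁ ∣ v) (hc₁ : c i₁ = 0) (hd₁ : d i₁ = 0) (hc₂ : c i₂ ∣ v)
    (hd₂ : d i₂ = 0) (hd₃ : d i₃ ∣ v) {p : Ideal R} [p.IsPrime]
    (h : LocalGradeGE p (Ideal.span (Set.range a) ⊔ Ideal.span {v}) 3) :
    ∃ x y z : R, LocalGradeGE p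
      (Ideal.span (Set.range fun i => a i + x * b i + y * c i + z * d i)) 3 := by
  obtain ⟨σ, hσ⟩ := exists_pairwise_isUnit_sub R
  have hgeneric := h.genericPencil_genericPencil_genericPencil hb₁ hc₁ hd₁ hc₂ hd₂ hd₃
  obtain ⟨z, hz⟩ := hgeneric.exists_eval (σ := C ∘ C ∘ σ) fun s t hst => by
    simpa using ((hσ hst).map C).map C
  obtain ⟨y, hy⟩ := hz.exists_eval (σ := C ∘ σ) fun s t hst => by
    simpa using (hσ hst).map C
  obtain ⟨x, hx⟩ := hy.exists_eval hσ
  refine ⟨σ x, σ y, σ z, hx.mono le_rfl ?_⟩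
  rw [Ideal.map_map, Ideal.map_map, Ideal.map_span, Ideal.span_le]
  rintro _ ⟨_, ⟨i, rfl⟩, rfl⟩
  refine Ideal.subset_span ⟨i, ?_⟩
  simp only [genericPencil, Function.comp_apply, RingHom.comp_apply, coe_evalRingHom, eval_add,
    eval_mul, eval_C, eval_X]

end Specialization

/-! ### The spinor module in coordinates -/

section LinearCombination

variable {R A ι κ : Type*} [CommRing R] [Ring A] [Algebra R A] [Fintype ι] [Fintype κ]

theorem linearCombination_mul_add_mul_linearCombination (a : ι → R) (b : κ → R) (f : ι → A)
    (g : κ → A) :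
    Fintype.linearCombination R f a * Fintype.linearCombination R g b +
      Fintype.linearCombination R g b * Fintype.linearCombination R f a =
      ∑ i, ∑ j, (a i * b j) • (f i * g j + g j * f i) := by
  simp only [Fintype.linearCombination_apply, Finset.sum_mul_sum, smul_mul_smul_comm]
  rw [Finset.sum_comm (s := (Finset.univ : Finset κ))]
  simp only [← Finset.sum_add_distrib, smul_add, mul_comm (b _)]

theorem linearCombination_mul_self_eq_zero {f : ι → A} (hsq : ∀ i, f i * f i = 0)
    (hanti : ∀ i j, f i * f j + f j * f i = 0) (a : ι → R) :
    Fintype.linearCombination R f a * Fintype.linearCombination R f a = 0 := by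
  rw [Fintype.linearCombination_apply, Finset.sum_mul_sum, ← Finset.sum_product']
  refine Finset.sum_involution (fun x _ => x.swap) ?_ ?_ (by simp) (by simp)
  · rintro ⟨i, j⟩ -
    simp only [Prod.swap, smul_mul_smul_comm, mul_comm (a j), ← smul_add, hanti, smul_zero]
  · rintro ⟨i, j⟩ - h heq
    obtain rfl : j = i := congrArg Prod.fst heq
    exact h (by simp [hsq])

end LinearCombination

/-- The free module on the subsets of `Fin n`: the exterior algebra of `Rⁿ` in coordinates. -/
abbrev Spinor (R : Type u) (n : ℕ) : Type u := Finset (Fin n) → R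

/-- The module `Rⁿ ⊕ Rⁿ`, which carries the hyperbolic form `Spinor.hyp`. -/
abbrev HyperbolicSpace (R : Type u) (n : ℕ) : Type u := (Fin n → R) × (Fin n → R)

namespace Spinor

variable {R : Type u} [CommRing R] {n : ℕ}

/-- The sign of moving `i` past the smaller elements of `K`. -/
def sgn (R : Type u) [CommRing R] {n : ℕ} (i : Fin n) (K : Finset (Fin n)) : R :=
  (-1) ^ (K.filter (· < i)).card

theorem sgn_mul_self (i : Fin n) (K : Finset (Fin n)) : sgn R i K * sgn R i K = 1 := by
  rw [sgn, ← mul_pow, neg_one_mul, neg_neg, one_pow]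

theorem sgn_insert {i j : Fin n} {K : Finset (Fin n)} (hj : j ∉ K) :
    sgn R i (insert j K) = if j < i then -sgn R i K else sgn R i K := by
  rw [sgn, Finset.filter_insert]
  split_ifs
  · rw [Finset.card_insert_of_notMem (by simp [hj]), pow_succ, sgn, mul_neg_one]
  · rfl

theorem sgn_erase {i j : Fin n} {K : Finset (Fin n)} (hj : j ∈ K) :
    sgn R i (K.erase j) = if j < i then -sgn R i K else sgn R i K := by
  conv_rhs => rw [← Finset.insert_erase hj]
  rw [sgn_insert (Finset.notMem_erase j K)]
  split_ifs <;> simp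

/-- Exterior multiplication by the `i`-th basis vector. -/
def create (i : Fin n) : Module.End R (Spinor R n) where
  toFun s K := if i ∈ K then sgn R i K * s (K.erase i) else 0
  map_add' s t := by ext K; simp only [Pi.add_apply]; split_ifs <;> ring
  map_smul' r s := by
    ext K; simp only [Pi.smul_apply, smul_eq_mul, RingHom.id_apply]; split_ifs <;> ring

/-- Contraction with the `i`-th dual basis vector. -/
def annih (i : Fin n) : Module.End R (Spinor R n) where
  toFun s K := if i ∈ K then 0 else sgn R i K * s (insert i K)
  map_add' s t := by ext K; simp only [Pi.add_apply]; split_ifs <;> ring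
  map_smul' r s := by
    ext K; simp only [Pi.smul_apply, smul_eq_mul, RingHom.id_apply]; split_ifs <;> ring

theorem create_apply (i : Fin n) (s : Spinor R n) (K : Finset (Fin n)) :
    create i s K = if i ∈ K then sgn R i K * s (K.erase i) else 0 := rfl

theorem annih_apply (i : Fin n) (s : Spinor R n) (K : Finset (Fin n)) :
    annih i s K = if i ∈ K then 0 else sgn R i K * s (insert i K) := rfl

theorem create_mul_self (i : Fin n) : create (R := R) i * create i = 0 := by
  ext
  simp [create_apply]

theorem annih_annih_self (i : Fin n) (s : Spinor R n) : annih i (annih i s) = 0 := by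
  ext
  simp [annih_apply]

theorem create_mul_create (i j : Fin n) :
    create (R := R) i * create j + create j * create i = 0 := by
  refine LinearMap.ext fun s => funext fun K => ?_
  simp only [LinearMap.add_apply, Module.End.mul_apply, create_apply, Pi.add_apply,
    LinearMap.zero_apply, Pi.zero_apply, Finset.mem_erase]
  rcases eq_or_ne i j with rfl | hij
  · simp
  by_cases hi : i ∈ K <;> by_cases hj : j ∈ K <;> simp only [hi, hj, hij, hij.symm, ne_eq,
    not_false_eq_true, and_self, if_true, if_false, and_false, mul_zero, add_zero]
  rw [sgn_erase hi, sgn_erase hj, Finset.erase_right_comm]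
  rcases lt_or_gt_of_ne hij with h | h <;> simp only [h, h.not_gt, if_true, if_false] <;> ring

theorem annih_mul_annih (i j : Fin n) :
    annih (R := R) i * annih j + annih j * annih i = 0 := by
  refine LinearMap.ext fun s => funext fun K => ?_
  simp only [LinearMap.add_apply, Module.End.mul_apply, annih_apply, Pi.add_apply,
    LinearMap.zero_apply, Pi.zero_apply, Finset.mem_insert]
  rcases eq_or_ne i j with rfl | hij
  · simp
  by_cases hi : i ∈ K <;> by_cases hj : j ∈ K <;> simp only [hi, hj, hij, hij.symm, or_self,
    if_true, if_false, or_true, mul_zero, add_zero]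
  rw [sgn_insert hi, sgn_insert hj, Finset.insert_comm]
  rcases lt_or_gt_of_ne hij with h | h <;> simp only [h, h.not_gt, if_true, if_false] <;> ring

theorem create_mul_annih_self (i : Fin n) :
    create (R := R) i * annih i + annih i * create i = 1 := by
  refine LinearMap.ext fun s => funext fun K => ?_
  simp only [LinearMap.add_apply, Module.End.mul_apply, annih_apply, create_apply, Pi.add_apply,
    Module.End.one_apply]
  by_cases hi : i ∈ K
  · simp [hi, sgn_erase hi, ← mul_assoc, sgn_mul_self]
  · simp [hi, sgn_insert hi, ← mul_assoc, sgn_mul_self]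

theorem create_mul_annih_of_ne {i j : Fin n} (hij : i ≠ j) :
    create (R := R) i * annih j + annih j * create i = 0 := by
  refine LinearMap.ext fun s => funext fun K => ?_
  simp only [LinearMap.add_apply, Module.End.mul_apply, annih_apply, create_apply, Pi.add_apply,
    Finset.mem_insert, Finset.mem_erase]
  by_cases hi : i ∈ K <;> by_cases hj : j ∈ K <;> simp only [hi, hj, hij, hij.symm, ne_eq,
    not_false_eq_true, and_self, if_true, if_false, and_false, or_true, or_self,
    mul_zero, add_zero, LinearMap.zero_apply, Pi.zero_apply]
  rw [sgn_insert hj, sgn_erase hi, Finset.erase_insert_of_ne hij.symm]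
  rcases lt_or_gt_of_ne hij with h | h <;> simp only [h, h.not_gt, if_true, if_false] <;> ring

theorem create_mul_annih (i j : Fin n) :
    create (R := R) i * annih j + annih j * create i = if i = j then 1 else 0 := by
  split_ifs with h
  · exact h ▸ create_mul_annih_self i
  · exact create_mul_annih_of_ne h

/-- The Clifford action of `(α, β)`: exterior multiplication by `α` plus contraction with `β`. -/
noncomputable def act : HyperbolicSpace R n →ₗ[R] Module.End R (Spinor R n) :=
  (Fintype.linearCombination R create).coprod (Fintype.linearCombination R annih)

theorem act_eq (x : HyperbolicSpace R n) :
    act x = Fintype.linearCombination R create x.1 + Fintype.linearCombination R annih x.2 :=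
  LinearMap.coprod_apply ..

theorem act_apply (x : HyperbolicSpace R n) (s : Spinor R n) :
    act x s = ∑ i, (x.1 i • create i s + x.2 i • annih i s) := by
  simp [act_eq, Fintype.linearCombination_apply, Finset.sum_add_distrib]

/-- The hyperbolic form on `Rⁿ ⊕ Rⁿ`. -/
def hyp : LinearMap.BilinForm R (HyperbolicSpace R n) :=
  LinearMap.mk₂ R (fun x y => x.1 ⬝ᵥ y.2 + x.2 ⬝ᵥ y.1)
    (fun x x' y => by simp [add_dotProduct]; abel) (fun r x y => by simp [mul_add])
    (fun x y y' => by simp [dotProduct_add]; abel) (fun r x y => by simp [mul_add])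

theorem hyp_apply (x y : HyperbolicSpace R n) : hyp x y = x.1 ⬝ᵥ y.2 + x.2 ⬝ᵥ y.1 := rfl

theorem hyp_comm (x y : HyperbolicSpace R n) : hyp x y = hyp y x := by
  rw [hyp_apply, hyp_apply, dotProduct_comm x.1, dotProduct_comm x.2, add_comm]

theorem act_mul_act (x y : HyperbolicSpace R n) :
    act x * act y + act y * act x = hyp x y • (1 : Module.End R (Spinor R n)) := by
  have key := linearCombination_mul_add_mul_linearCombination (R := R)
    (A := Module.End R (Spinor R n)) (ι := Fin n) (κ := Fin n)
  have hcc := key x.1 y.1 create create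
  have haa := key x.2 y.2 annih annih
  have hca := key x.1 y.2 create annih
  have hac := key y.1 x.2 create annih
  simp only [create_mul_create, annih_mul_annih, create_mul_annih, smul_zero,
    Finset.sum_const_zero, smul_ite, Finset.sum_ite_eq, Finset.mem_univ, if_true,
    ← Finset.sum_smul] at hcc haa hca hac
  have hexpand (c c' a a' : Module.End R (Spinor R n)) :
      (c + a) * (c' + a') + (c' + a') * (c + a) =
        (c * c' + c' * c) + (a * a' + a' * a) + (c * a' + a' * c) + (c' * a + a * c') := by
    noncomm_ring
  rw [act_eq, act_eq, hexpand, hcc, haa, hca, hac, hyp_apply, dotProduct_comm x.2, add_zero,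
    zero_add, dotProduct, dotProduct, add_smul]

theorem act_act (x y : HyperbolicSpace R n) (s : Spinor R n) :
    act x (act y s) + act y (act x s) = hyp x y • s := by
  simpa using LinearMap.congr_fun (act_mul_act x y) s

theorem act_left_mul_self (α : Fin n → R) :
    act (α, (0 : Fin n → R)) * act (α, (0 : Fin n → R)) = 0 := by
  rw [act_eq, map_zero, add_zero,
    linearCombination_mul_self_eq_zero create_mul_self create_mul_create]

theorem act_single_zero (j : Fin n) (r : R) :
    act (Pi.single j r, (0 : Fin n → R)) = r • create j := by
  rw [act_eq, map_zero, add_zero, Fintype.linearCombination_apply_single]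

theorem act_zero_single (j : Fin n) (r : R) :
    act ((0 : Fin n → R), Pi.single j r) = r • annih j := by
  rw [act_eq, map_zero, zero_add, Fintype.linearCombination_apply_single]

theorem hyp_single_zero (j : Fin n) (r : R) (y : HyperbolicSpace R n) :
    hyp (Pi.single j r, (0 : Fin n → R)) y = r * y.2 j := by
  simp [hyp_apply]

theorem hyp_zero_single (j : Fin n) (r : R) (y : HyperbolicSpace R n) :
    hyp ((0 : Fin n → R), Pi.single j r) y = r * y.1 j := by
  simp [hyp_apply]

theorem create_act (j : Fin n) (y : HyperbolicSpace R n) (s : Spinor R n) :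
    create j (act y s) = y.2 j • s - act y (create j s) := by
  have h := act_act (Pi.single j (1 : R), (0 : Fin n → R)) y s
  rw [hyp_single_zero, act_single_zero, one_smul, one_mul] at h
  exact eq_sub_of_add_eq h

theorem annih_act (j : Fin n) (y : HyperbolicSpace R n) (s : Spinor R n) :
    annih j (act y s) = y.1 j • s - act y (annih j s) := by
  have h := act_act ((0 : Fin n → R), Pi.single j (1 : R)) y s
  rw [hyp_zero_single, act_zero_single, one_smul, one_mul] at h
  exact eq_sub_of_add_eq h

theorem annih_annih_comm (i j : Fin n) (s : Spinor R n) :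
    annih i (annih j s) = -annih j (annih i s) :=
  eq_neg_of_add_eq_zero_left (LinearMap.congr_fun (annih_mul_annih (R := R) i j) s)

theorem annih_annih_annih (j k : Fin n) (s : Spinor R n) :
    annih k (annih j (annih k s)) = 0 := by
  rw [annih_annih_comm j k, map_neg, annih_annih_self, neg_zero]

theorem annih_annih_dvd {T : Finset (Fin n)} {j k : Fin n} (hjk : j ≠ k) (hj : j ∈ T)
    (hk : k ∈ T) (s : Spinor R n) : annih j (annih k s) ((T.erase j).erase k) ∣ s T := by
  have hjT : insert j ((T.erase j).erase k) = T.erase k := by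
    rw [Finset.erase_right_comm, Finset.insert_erase (by simp [hjk, hj])]
  rw [annih_apply, if_neg (by simp), hjT, annih_apply, if_neg (by simp), Finset.insert_erase hk]
  refine ⟨sgn R j ((T.erase j).erase k) * sgn R k (T.erase k), ?_⟩
  linear_combination (-s T * sgn R k (T.erase k) * sgn R k (T.erase k)) *
    sgn_mul_self (R := R) j ((T.erase j).erase k) - s T * sgn_mul_self (R := R) k (T.erase k)

theorem annih_annih_eq_zero {K : Finset (Fin n)} {j k : Fin n} (h : j ∈ K ∨ k ∈ K)
    (s : Spinor R n) : annih j (annih k s) K = 0 := by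
  rcases h with h | h <;> simp [annih_apply, h]

theorem annih_mem {P : Ideal R} {s : Spinor R n} (h : ∀ K, s K ∈ P) (j : Fin n)
    (K : Finset (Fin n)) : annih j s K ∈ P := by
  rw [annih_apply]
  split_ifs
  · exact zero_mem _
  · exact P.mul_mem_left _ (h _)

/-- The spinor spanning the scalars of the exterior algebra. -/
def vac : Spinor R n := Pi.single ∅ 1

theorem annih_vac (i : Fin n) : annih i (vac : Spinor R n) = 0 := by
  ext K
  simp [annih_apply, vac]

theorem create_single (i : Fin n) {K : Finset (Fin n)} (hi : i ∉ K) :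
    sgn R i K • create i (Pi.single K (1 : R)) = Pi.single (insert i K) (1 : R) := by
  ext K'
  simp only [Pi.smul_apply, create_apply, Pi.single_apply, smul_eq_mul]
  by_cases h : K' = insert i K
  · subst h
    simp [Finset.erase_insert hi, sgn_insert hi, sgn_mul_self]
  · rw [if_neg h]
    split_ifs with h1 h2
    · exact absurd (by rw [← h2, Finset.insert_erase h1]) h
    · simp
    · simp

/-! ### Parity of spinors -/

/-- `s` is supported on subsets whose cardinality has parity `e`. -/
def HasParity (e : ZMod 2) (s : Spinor R n) : Prop :=
  ∀ K : Finset (Fin n), (K.card : ZMod 2) ≠ e → s K = 0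

theorem HasParity.create {e : ZMod 2} {s : Spinor R n} (h : HasParity e s) (i : Fin n) :
    HasParity (e + 1) (create i s) := by
  intro K hK
  rw [create_apply]
  split_ifs with hi
  · rw [h _ fun he => hK ?_, mul_zero]
    rw [← Finset.card_erase_add_one hi, Nat.cast_add, Nat.cast_one, he]
  · rfl

theorem HasParity.annih {e : ZMod 2} {s : Spinor R n} (h : HasParity e s) (i : Fin n) :
    HasParity (e + 1) (annih i s) := by
  intro K hK
  rw [annih_apply]
  split_ifs with hi
  · rfl
  · rw [h _ fun he => hK ?_, mul_zero]
    rw [← he, Finset.card_insert_of_notMem hi, Nat.cast_add, Nat.cast_one, add_assoc,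
      CharTwo.add_self_eq_zero, add_zero]

theorem HasParity.act {e : ZMod 2} {s : Spinor R n} (h : HasParity e s)
    (x : HyperbolicSpace R n) : HasParity (e + 1) (act x s) := by
  intro K hK
  rw [act_apply, Finset.sum_apply]
  exact Finset.sum_eq_zero fun i _ => by simp [h.create i K hK, h.annih i K hK]

theorem HasParity.annih_annih {e : ZMod 2} {s : Spinor R n} (h : HasParity e s) (j k : Fin n) :
    HasParity e (Spinor.annih j (Spinor.annih k s)) := by
  simpa [add_assoc, CharTwo.add_self_eq_zero] using (h.annih k).annih j

/-! ### Shears of the hyperbolic space -/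

/-- The skew map `(α, β) ↦ (0, x (αₖ eⱼ - αⱼ eₖ))`. -/
def shearMap (j k : Fin n) (x : R) : HyperbolicSpace R n →ₗ[R] HyperbolicSpace R n :=
  LinearMap.inr R (Fin n → R) (Fin n → R) ∘ₗ
    ((LinearMap.proj k ∘ₗ LinearMap.fst R (Fin n → R) (Fin n → R)).smulRight (Pi.single j x)
      - (LinearMap.proj j ∘ₗ LinearMap.fst R (Fin n → R) (Fin n → R)).smulRight (Pi.single k x))

theorem shearMap_apply (j k : Fin n) (x : R) (y : HyperbolicSpace R n) :
    shearMap j k x y =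
      ((0 : Fin n → R), Pi.single j (y.1 k * x)) - ((0 : Fin n → R), Pi.single k (y.1 j * x)) := by
  ext i <;> simp [shearMap, Pi.single_apply]

/-- The isometry of the hyperbolic form which fixes the second summand and moves the `j`-th and
the `k`-th basis vector of the first. -/
def shear (j k : Fin n) (x : R) : HyperbolicSpace R n ≃ₗ[R] HyperbolicSpace R n :=
  LinearEquiv.ofLinearMap (LinearMap.id + shearMap j k x) (LinearMap.id - shearMap j k x)
    (by ext1 <;> (refine LinearMap.ext fun y => ?_) <;> simp [shearMap_apply])
    (by ext1 <;> (refine LinearMap.ext fun y => ?_) <;> simp [shearMap_apply])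

theorem shear_apply (j k : Fin n) (x : R) (y : HyperbolicSpace R n) :
    shear j k x y = y + shearMap j k x y := rfl

theorem hyp_shearMap (j k : Fin n) (x : R) (y z : HyperbolicSpace R n) :
    hyp (shearMap j k x y) z = x * (y.1 k * z.1 j - y.1 j * z.1 k) := by
  rw [shearMap_apply, map_sub, LinearMap.sub_apply, hyp_zero_single, hyp_zero_single]
  ring

theorem hyp_shear (j k : Fin n) (x : R) (y z : HyperbolicSpace R n) :
    hyp (shear j k x y) (shear j k x z) = hyp y z := by
  have hfst : (shearMap j k x z).1 = 0 := by simp [shearMap_apply]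
  rw [shear_apply, shear_apply, map_add, map_add, LinearMap.add_apply, LinearMap.add_apply,
    hyp_comm y (shearMap j k x z)]
  simp only [hyp_shearMap, hfst, Pi.zero_apply]
  ring

theorem act_shearMap (j k : Fin n) (x : R) (y : HyperbolicSpace R n) :
    act (shearMap j k x y) = (y.1 k * x) • annih j - (y.1 j * x) • annih k := by
  rw [shearMap_apply, map_sub, act_zero_single, act_zero_single]

/-- The action of `shear j k x` on spinors. -/
def shearSpinor (j k : Fin n) (x : R) : Module.End R (Spinor R n) := 1 + x • (annih j * annih k)

theorem shearSpinor_apply (j k : Fin n) (x : R) (s : Spinor R n) :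
    shearSpinor j k x s = s + x • annih j (annih k s) := rfl

theorem act_shear (j k : Fin n) (x : R) (y : HyperbolicSpace R n) (s : Spinor R n) :
    act (shear j k x y) (shearSpinor j k x s) = shearSpinor j k x (act y s) := by
  rw [shear_apply, map_add, act_shearMap, shearSpinor_apply, shearSpinor_apply, annih_act,
    map_sub, annih_act]
  simp only [LinearMap.add_apply, LinearMap.sub_apply, LinearMap.smul_apply, map_add, map_smul,
    annih_annih_self, annih_annih_annih, smul_zero, smul_sub, smul_smul]
  module

theorem shearSpinor_neg (j k : Fin n) (x : R) (s : Spinor R n) :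
    shearSpinor j k (-x) (shearSpinor j k x s) = s := by
  simp [shearSpinor_apply, annih_annih_annih]

theorem shearSpinor_shearSpinor_shearSpinor (i j k : Fin n) (x y z : R) (s : Spinor R n) :
    shearSpinor i j z (shearSpinor i k y (shearSpinor j k x s)) =
      s + x • annih j (annih k s) + y • annih i (annih k s) + z • annih i (annih j s) := by
  simp only [shearSpinor_apply, map_add, map_smul, annih_annih_self, annih_annih_annih,
    smul_zero, map_zero, add_zero, map_neg, neg_zero, annih_annih_comm j i (annih k _)]
  abel

/-! ### Generic spinor coordinates -/

variable {E : Type v} [AddCommGroup E] [Module R E]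

/-- `ε` are hyperbolic coordinates of the quadratic module `(E, form)`, with respect to which the
odd spinor `s` is annihilated by the submodule `L` and vanishes at no prime of `U`. -/
structure IsSpinorOf (form : LinearMap.BilinForm R E) (L : Submodule R E)
    (U : Set (PrimeSpectrum R)) (ε : E ≃ₗ[R] HyperbolicSpace R n) (s : Spinor R n) : Prop where
  isometry : ∀ x y, form x y = hyp (ε x) (ε y)
  isOdd : HasParity 1 s
  annihilated : ∀ x ∈ L, act (ε x) s = 0
  nonvanishing : ∀ P ∈ U, ∃ K, s K ∉ P.asIdeal

variable {form : LinearMap.BilinForm R E} {L : Submodule R E} {U : Set (PrimeSpectrum R)}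
  {ε : E ≃ₗ[R] HyperbolicSpace R n} {s : Spinor R n}

theorem IsSpinorOf.shear (h : IsSpinorOf form L U ε s) (j k : Fin n) (x : R) :
    IsSpinorOf form L U (ε.trans (shear j k x)) (shearSpinor j k x s) where
  isometry y z := by
    rw [LinearEquiv.trans_apply, LinearEquiv.trans_apply, hyp_shear, h.isometry]
  isOdd K hK := by
    simp [shearSpinor_apply, h.isOdd K hK, h.isOdd.annih_annih j k K hK]
  annihilated y hy := by
    rw [LinearEquiv.trans_apply, act_shear, h.annihilated y hy, map_zero]
  nonvanishing P hP := by
    by_contra! hmem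
    obtain ⟨K, hK⟩ := h.nonvanishing P hP
    refine hK ?_
    rw [← shearSpinor_neg j k x s, shearSpinor_apply]
    exact add_mem (hmem K) (Ideal.mul_mem_left _ _ (annih_mem (annih_mem hmem k) j K))

theorem IsSpinorOf.exists_localGradeGE_erase [IsNoetherianRing R] [IsLocalRing R]
    [Infinite (IsLocalRing.ResidueField R)] {p : Ideal R} [p.IsPrime]
    (h : IsSpinorOf form L U ε s) {𝒯 : Finset (Finset (Fin n))} {T : Finset (Fin n)}
    (hT : 2 < T.card) (herase : ∀ j ∈ T, ∀ k ∈ T, j ≠ k → (T.erase j).erase k ∈ 𝒯)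
    (hg : LocalGradeGE p (Ideal.span (s '' (𝒯 : Set (Finset (Fin n))))) 3) :
    ∃ (ε' : E ≃ₗ[R] HyperbolicSpace R n) (s' : Spinor R n), IsSpinorOf form L U ε' s' ∧
      LocalGradeGE p (Ideal.span (s' '' (𝒯.erase T : Set (Finset (Fin n))))) 3 := by
  obtain ⟨i, j, k, hi, hj, hk, hij, hik, hjk⟩ := Finset.two_lt_card_iff.mp hT
  have herase' : ∀ l ∈ T, ∀ m ∈ T, l ≠ m → (T.erase l).erase m ∈ 𝒯.erase T :=
    fun l hl m hm hlm => Finset.mem_erase.mpr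
      ⟨fun h => by rw [← h] at hl; simp at hl, herase l hl m hm hlm⟩
  have hle : Ideal.span (s '' (𝒯 : Set (Finset (Fin n)))) ≤
      Ideal.span (Set.range fun K : 𝒯.erase T => s K.1) ⊔ Ideal.span {s T} := by
    rw [Ideal.span_le]
    rintro _ ⟨K, hK, rfl⟩
    rcases eq_or_ne K T with rfl | hKT
    · exact Ideal.mem_sup_right (Ideal.mem_span_singleton_self _)
    · exact Ideal.mem_sup_left (Ideal.subset_span ⟨⟨K, Finset.mem_erase.mpr ⟨hKT, hK⟩⟩, rfl⟩)
  obtain ⟨x, y, z, hxyz⟩ := (hg.mono le_rfl hle).exists_linear_family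
    (b := fun K : 𝒯.erase T => annih j (annih k s) K.1)
    (c := fun K : 𝒯.erase T => annih i (annih k s) K.1)
    (d := fun K : 𝒯.erase T => annih i (annih j s) K.1)
    (i₁ := ⟨_, herase' j hj k hk hjk⟩) (i₂ := ⟨_, herase' i hi k hk hik⟩)
    (i₃ := ⟨_, herase' i hi j hj hij⟩)
    (annih_annih_dvd hjk hj hk s) (annih_annih_eq_zero (Or.inl (by simp [hi, hij, hik])) s)
    (annih_annih_eq_zero (Or.inl (by simp [hi, hij, hik])) s) (annih_annih_dvd hik hi hk s)
    (annih_annih_eq_zero (Or.inr (by simp [hj, hjk, hij.symm])) s) (annih_annih_dvd hij hi hj s)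
  refine ⟨_, _, ((h.shear j k x).shear i k y).shear i j z, hxyz.mono le_rfl ?_⟩
  rw [Ideal.span_le]
  rintro _ ⟨⟨K, hK⟩, rfl⟩
  refine Ideal.subset_span ⟨K, hK, ?_⟩
  rw [shearSpinor_shearSpinor_shearSpinor]
  simp

theorem IsSpinorOf.exists_generic_of_lowerClosed [IsNoetherianRing R] [IsLocalRing R]
    [Infinite (IsLocalRing.ResidueField R)] {p : Ideal R} [p.IsPrime]
    (𝒯 : Finset (Finset (Fin n))) (hodd : ∀ K ∈ 𝒯, Odd K.card)
    (hlow : ∀ K ∈ 𝒯, ∀ K' : Finset (Fin n), Odd K'.card → K'.card < K.card → K' ∈ 𝒯)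
    (h : IsSpinorOf form L U ε s)
    (hg : LocalGradeGE p (Ideal.span (s '' (𝒯 : Set (Finset (Fin n))))) 3) :
    ∃ (ε' : E ≃ₗ[R] HyperbolicSpace R n) (s' : Spinor R n), IsSpinorOf form L U ε' s' ∧
      LocalGradeGE p (Ideal.span (Set.range fun i : Fin n => s' {i})) 3 := by
  induction 𝒯 using Finset.strongInduction generalizing ε s with | _ 𝒯 ih
  by_cases hcard : ∀ K ∈ 𝒯, K.card ≤ 1
  · refine ⟨ε, s, h, hg.mono le_rfl (Ideal.span_le.mpr ?_)⟩
    rintro _ ⟨K, hK, rfl⟩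
    obtain ⟨i, rfl⟩ := Finset.card_eq_one.mp (le_antisymm (hcard K hK) (hodd K hK).pos)
    exact Ideal.subset_span ⟨i, rfl⟩
  push Not at hcard
  obtain ⟨K₀, hK₀, hK₀card⟩ := hcard
  obtain ⟨T, hT, hTmax⟩ := Finset.exists_max_image 𝒯 Finset.card ⟨K₀, hK₀⟩
  obtain ⟨m, hm⟩ := hodd T hT
  have hT3 : 2 < T.card := by have := hTmax K₀ hK₀; lia
  have herase : ∀ j ∈ T, ∀ k ∈ T, j ≠ k → (T.erase j).erase k ∈ 𝒯 := by
    intro j hj k hk hjk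
    have hcard : ((T.erase j).erase k).card = T.card - 1 - 1 := by
      rw [Finset.card_erase_of_mem (by simp [hk, hjk.symm]), Finset.card_erase_of_mem hj]
    exact hlow T hT _ ⟨m - 1, by lia⟩ (by lia)
  obtain ⟨ε', s', h', hg'⟩ := h.exists_localGradeGE_erase hT3 herase hg
  refine ih _ (Finset.erase_ssubset hT) (fun K hK => hodd K (Finset.mem_of_mem_erase hK)) ?_ h' hg'
  intro K hK K' hK' hlt
  have hK𝒯 := Finset.mem_of_mem_erase hK
  refine Finset.mem_erase.mpr ⟨?_, hlow K hK𝒯 K' hK' hlt⟩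
  rintro rfl
  exact (hTmax K hK𝒯).not_gt hlt

theorem IsSpinorOf.exists_generic [IsNoetherianRing R] [IsLocalRing R]
    [Infinite (IsLocalRing.ResidueField R)] {p : Ideal R} [p.IsPrime]
    (h : IsSpinorOf form L U ε s) (hg : LocalGradeGE p (Ideal.span (Set.range s)) 3) :
    ∃ (ε' : E ≃ₗ[R] HyperbolicSpace R n) (s' : Spinor R n), IsSpinorOf form L U ε' s' ∧
      LocalGradeGE p (Ideal.span (Set.range fun i : Fin n => s' {i})) 3 := by
  refine exists_generic_of_lowerClosed (Finset.univ.filter fun K => Odd K.card) (by simp)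
    (fun _ _ _ hK' _ => by simpa using hK') h (hg.mono le_rfl (Ideal.span_le.mpr ?_))
  rintro _ ⟨K, rfl⟩
  by_cases hK : Odd K.card
  · exact Ideal.subset_span ⟨K, by simpa using hK, rfl⟩
  · rw [h.isOdd K fun h1 => hK (ZMod.natCast_eq_one_iff_odd.mp h1)]
    exact zero_mem _

end Spinor

/-! ### Exterior algebras in hyperbolic coordinates -/

section ExteriorAlgebra

variable {R M : Type*} [CommRing R] [AddCommGroup M] [Module R M]

theorem ιInv_algebraMap (r : R) :
    ExteriorAlgebra.ιInv (algebraMap R (ExteriorAlgebra R M) r) = 0 := by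
  let _ : Module Rᵐᵒᵖ M := Module.compHom _ ((RingHom.id R).fromOpposite mul_comm)
  have : IsCentralScalar R M := ⟨fun r m => rfl⟩
  change TrivSqZeroExt.snd (ExteriorAlgebra.toTrivSqZeroExt (algebraMap R _ r)) = 0
  rw [AlgHom.commutes]
  rfl

theorem ιInv_ι_mul (m : M) (s : ExteriorAlgebra R M) :
    ExteriorAlgebra.ιInv (ExteriorAlgebra.ι R m * s) = ExteriorAlgebra.algebraMapInv s • m := by
  let _ : Module Rᵐᵒᵖ M := Module.compHom _ ((RingHom.id R).fromOpposite mul_comm)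
  have : IsCentralScalar R M := ⟨fun r m => rfl⟩
  have hfst : (TrivSqZeroExt.fstHom R R M).comp ExteriorAlgebra.toTrivSqZeroExt =
      ExteriorAlgebra.algebraMapInv := by
    apply ExteriorAlgebra.hom_ext
    ext m
    simp [ExteriorAlgebra.algebraMapInv]
  change TrivSqZeroExt.snd (ExteriorAlgebra.toTrivSqZeroExt (ExteriorAlgebra.ι R m * s)) = _
  rw [map_mul, ExteriorAlgebra.toTrivSqZeroExt_ι, TrivSqZeroExt.snd_mul, ← hfst]
  simp

end ExteriorAlgebra

namespace IsotropicDecomposition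

open Spinor

variable {R : Type u} [CommRing R] {E : Type v} [AddCommGroup E] [Module R E]
  {form : LinearMap.BilinForm R E} (D : IsotropicDecomposition form) {n : ℕ}

theorem sub_projectionOnto_mem (x : E) : x - D.H.projectionOnto D.H' D.isCompl x ∈ D.H' := by
  rw [← Submodule.projectionOnto_apply_eq_zero_iff D.isCompl, map_sub,
    Submodule.projectionOnto_apply_left, sub_self]

/-- Hyperbolic coordinates whose coordinate subspaces are the summands of a decomposition. -/
structure IsAdapted (ε : E ≃ₗ[R] HyperbolicSpace R n) : Prop where
  isometry : ∀ x y, form x y = hyp (ε x) (ε y)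
  mem_H : ∀ x, x ∈ D.H ↔ (ε x).2 = 0
  mem_H' : ∀ x, x ∈ D.H' ↔ (ε x).1 = 0

namespace IsAdapted

variable {D} {ε : E ≃ₗ[R] HyperbolicSpace R n}

theorem apply_coe (hε : D.IsAdapted ε) (h : D.H) : ε h = ((ε h).1, 0) :=
  Prod.ext rfl ((hε.mem_H _).1 h.2)

theorem apply_projectionOnto (hε : D.IsAdapted ε) (x : E) :
    ε (D.H.projectionOnto D.H' D.isCompl x) = ((ε x).1, 0) := by
  have h := (hε.mem_H' _).1 (D.sub_projectionOnto_mem x)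
  rw [map_sub, Prod.fst_sub, sub_eq_zero] at h
  rw [hε.apply_coe, h]

variable (hε : D.IsAdapted ε)

/-- The first summand is free on the coordinates. -/
def equivH : D.H ≃ₗ[R] (Fin n → R) where
  toFun h := (ε h).1
  invFun α := ⟨ε.symm (α, 0), by rw [hε.mem_H]; simp⟩
  map_add' x y := by simp
  map_smul' r x := by simp
  left_inv h := by
    apply Subtype.ext
    change ε.symm ((ε h).1, 0) = h
    rw [← hε.apply_coe, LinearEquiv.symm_apply_apply]
  right_inv α := by simp

theorem equivH_apply (h : D.H) : hε.equivH h = (ε h).1 := rfl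

/-- The basis of the first summand. -/
noncomputable def basisH : Basis (Fin n) R D.H :=
  Basis.ofEquivFun hε.equivH

theorem apply_basisH (i : Fin n) : ε (hε.basisH i) = (Pi.single i 1, 0) := by
  rw [hε.apply_coe, ← hε.equivH_apply, basisH, Basis.coe_ofEquivFun, LinearEquiv.apply_symm_apply]

theorem dual_apply (d : Dual R D.H) (h : D.H) : d h = ∑ i, (ε h).1 i * d (hε.basisH i) := by
  conv_lhs => rw [← hε.basisH.sum_repr h]
  simp only [map_sum, map_smul, smul_eq_mul]
  rfl

/-- The isomorphism of `⋀ H` with its coordinate model. -/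
noncomputable def toSpinor : ExteriorAlgebra R D.H →ₗ[R] Spinor R n :=
  (LinearMap.applyₗ (vac : Spinor R n)) ∘ₗ
    (ExteriorAlgebra.lift R ⟨act ∘ₗ ε.toLinearMap ∘ₗ D.H.subtype, fun h => by
      change act (ε h) * act (ε h) = 0
      rw [hε.apply_coe, act_left_mul_self]⟩).toLinearMap

theorem toSpinor_algebraMap (r : R) :
    hε.toSpinor (algebraMap R (CliffordAlgebra (0 : QuadraticForm R D.H)) r) = r • vac := by
  change hε.toSpinor (algebraMap R (ExteriorAlgebra R D.H) r) = _
  simp [toSpinor]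

theorem toSpinor_ι_mul (h : D.H) (s : ExteriorAlgebra R D.H) :
    hε.toSpinor (CliffordAlgebra.ι 0 h * s) = act (ε h) (hε.toSpinor s) := by
  change hε.toSpinor (ExteriorAlgebra.ι R h * s) = _
  simp [toSpinor]

theorem toSpinor_contractLeft (d : Dual R D.H) (s : ExteriorAlgebra R D.H) :
    hε.toSpinor (CliffordAlgebra.contractLeft (Q := (0 : QuadraticForm R D.H)) d s) =
      act (0, fun i => d (hε.basisH i)) (hε.toSpinor s) := by
  induction s using CliffordAlgebra.left_induction with
  | algebraMap r =>
    rw [CliffordAlgebra.contractLeft_algebraMap, map_zero, toSpinor_algebraMap]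
    simp [act_apply, annih_vac]
  | add x y hx hy => simp only [map_add, hx, hy]
  | ι_mul x m hx =>
    rw [CliffordAlgebra.contractLeft_ι_mul, map_sub, map_smul, toSpinor_ι_mul, toSpinor_ι_mul, hx,
      eq_comm, eq_sub_iff_add_eq, act_act, hε.dual_apply d m]
    simp [hyp_apply, dotProduct, mul_comm]

theorem toSpinor_cliffordAction (x : E) (s : ExteriorAlgebra R D.H) :
    hε.toSpinor (D.cliffordAction x s) = act (ε x) (hε.toSpinor s) := by
  have hx : ε x = ε (D.H.projectionOnto D.H' D.isCompl x) +
      ((0 : Fin n → R), fun i => form x (hε.basisH i)) := by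
    rw [hε.apply_projectionOnto]
    refine Prod.ext (by simp) (funext fun i => ?_)
    simp [hε.isometry, hε.apply_basisH, hyp_comm (ε x), hyp_single_zero]
  rw [hx, map_add, LinearMap.add_apply, ← toSpinor_ι_mul]
  exact (map_add hε.toSpinor _ _).trans (congrArg _ (hε.toSpinor_contractLeft _ s))

theorem toSpinor_surjective : Function.Surjective hε.toSpinor := by
  have hsingle (K : Finset (Fin n)) : Pi.single K (1 : R) ∈ LinearMap.range hε.toSpinor := by
    induction K using Finset.induction_on with
    | empty => exact ⟨algebraMap R _ 1, (hε.toSpinor_algebraMap 1).trans (one_smul ..)⟩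
    | insert i K hi ih =>
      obtain ⟨s, hs⟩ := ih
      refine ⟨sgn R i K • (CliffordAlgebra.ι 0 (hε.basisH i) * s), ?_⟩
      rw [map_smul, hε.toSpinor_ι_mul, hε.apply_basisH, act_single_zero, one_smul, hs,
        create_single i hi]
  rw [← LinearMap.range_eq_top, eq_top_iff]
  intro s _
  rw [← Finset.univ_sum_single s]
  refine sum_mem fun K _ => ?_
  simpa [← Pi.single_smul] using Submodule.smul_mem _ (s K) (hsingle K)

theorem toSpinor_injective : Function.Injective hε.toSpinor := by
  let e := hε.basisH.ExteriorAlgebra.equivFun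
  intro x y hxy
  exact e.injective (OrzechProperty.injective_of_surjective_endomorphism
    (hε.toSpinor ∘ₗ e.symm.toLinearMap) (hε.toSpinor_surjective.comp e.symm.surjective)
    (by simpa using hxy))

theorem hasParity_toSpinor_of_mem_pow {k : ℕ} {s : ExteriorAlgebra R D.H}
    (hs : s ∈ LinearMap.range (CliffordAlgebra.ι (0 : QuadraticForm R D.H)) ^ k) :
    HasParity (k : ZMod 2) (hε.toSpinor s) := by
  induction hs using Submodule.pow_induction_on_left' with
  | algebraMap r =>
    intro K hK
    have hK' : K ≠ ∅ := by rintro rfl; simp at hK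
    simp [toSpinor_algebraMap, vac, hK']
  | add x y i _ _ ihx ihy =>
    intro K hK
    simp [ihx K hK, ihy K hK]
  | mem_mul m hm i x _ ih =>
    obtain ⟨h, rfl⟩ := hm
    rw [toSpinor_ι_mul, Nat.cast_succ]
    exact ih.act _

theorem hasParity_toSpinor {e : ZMod 2} {s : ExteriorAlgebra R D.H}
    (hs : s ∈ CliffordAlgebra.evenOdd (0 : QuadraticForm R D.H) e) :
    HasParity e (hε.toSpinor s) := by
  induction hs using Submodule.iSup_induction' with
  | mem k x hx => exact k.2 ▸ hε.hasParity_toSpinor_of_mem_pow hx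
  | zero => simp [HasParity]
  | add x y _ _ hx hy =>
    intro K hK
    simp [hx K hK, hy K hK]

theorem exists_toSpinor_eq {s : Spinor R n} (hs : HasParity 1 s) :
    ∃ a : D.VOdd, hε.toSpinor a = s := by
  obtain ⟨t, rfl⟩ := hε.toSpinor_surjective s
  obtain ⟨t₀, h₀, t₁, h₁, rfl⟩ := Submodule.mem_sup.mp (show t ∈ D.VEven ⊔ D.VOdd from
    (CliffordAlgebra.evenOdd_isCompl (0 : QuadraticForm R D.H)).sup_eq_top ▸ Submodule.mem_top)
  refine ⟨⟨t₁, h₁⟩, funext fun K => ?_⟩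
  by_cases hK : (K.card : ZMod 2) = 1
  · rw [map_add, Pi.add_apply, hε.hasParity_toSpinor h₀ K (by rw [hK]; exact one_ne_zero), zero_add]
  · rw [hs K hK, hε.hasParity_toSpinor h₁ K hK]

theorem algebraMapInv_eq (s : ExteriorAlgebra R D.H) :
    ExteriorAlgebra.algebraMapInv s = hε.toSpinor s ∅ := by
  induction s using CliffordAlgebra.left_induction with
  | algebraMap r =>
    rw [toSpinor_algebraMap]
    exact (ExteriorAlgebra.algebraMap_leftInverse _ r).trans (by simp [vac])
  | add x y hx hy => simp only [map_add, hx, hy, Pi.add_apply]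
  | ι_mul x m _ =>
    have hm : ExteriorAlgebra.algebraMapInv (CliffordAlgebra.ι 0 m) = (0 : R) := by
      simp [ExteriorAlgebra.algebraMapInv, ← ExteriorAlgebra.ι.eq_1]
    rw [toSpinor_ι_mul, map_mul, hm, zero_mul, hε.apply_coe, act_apply]
    simp [create_apply]

theorem ιInv_eq (s : ExteriorAlgebra R D.H) (i : Fin n) :
    (ε (ExteriorAlgebra.ιInv s : D.H)).1 i = hε.toSpinor s {i} := by
  induction s using CliffordAlgebra.left_induction with
  | algebraMap r =>
    rw [toSpinor_algebraMap, show ExteriorAlgebra.ιInv _ = (0 : D.H) from ιInv_algebraMap r]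
    simp [vac]
  | add x y hx hy => simp only [map_add, Submodule.coe_add, Prod.fst_add, Pi.add_apply, hx, hy]
  | ι_mul x m _ =>
    rw [show ExteriorAlgebra.ιInv (CliffordAlgebra.ι 0 m * x) = _ from ιInv_ι_mul m x,
      toSpinor_ι_mul, hε.apply_coe m, act_apply, hε.algebraMapInv_eq, Finset.sum_apply,
      Finset.sum_eq_single i (fun j _ hj => by simp [create_apply, hj]) (by simp)]
    simp [create_apply, sgn, Finset.filter_singleton, mul_comm]

end IsAdapted

/-! ### Existence of hyperbolic coordinates -/

/-- The decomposition given by hyperbolic coordinates. -/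
def ofCoordinates (ε : E ≃ₗ[R] HyperbolicSpace R n) (h : ∀ x y, form x y = hyp (ε x) (ε y)) :
    IsotropicDecomposition form where
  H := LinearMap.ker (LinearMap.snd R (Fin n → R) (Fin n → R) ∘ₗ ε.toLinearMap)
  H' := LinearMap.ker (LinearMap.fst R (Fin n → R) (Fin n → R) ∘ₗ ε.toLinearMap)
  isCompl := by
    constructor
    · rw [Submodule.disjoint_def]
      intro x hx hx'
      exact ε.map_eq_zero_iff.mp (Prod.ext hx' hx)
    · rw [codisjoint_iff, eq_top_iff]
      intro x _
      refine Submodule.mem_sup.mpr ⟨ε.symm ((ε x).1, 0), by simp, ε.symm (0, (ε x).2), by simp, ?_⟩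
      rw [← map_add, LinearEquiv.symm_apply_eq]
      simp
  isotropic x hx y hy := by
    have hx : (ε x).2 = 0 := hx
    have hy : (ε y).2 = 0 := hy
    simp [h, hyp_apply, hx, hy]
  isotropic' x hx y hy := by
    have hx : (ε x).1 = 0 := hx
    have hy : (ε y).1 = 0 := hy
    simp [h, hyp_apply, hx, hy]

theorem isAdapted_ofCoordinates (ε : E ≃ₗ[R] HyperbolicSpace R n)
    (h : ∀ x y, form x y = hyp (ε x) (ε y)) : (ofCoordinates ε h).IsAdapted ε :=
  ⟨h, fun _ => Iff.rfl, fun _ => Iff.rfl⟩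

/-- The coordinates of `x` are those of its component in `H` and its pairings with the basis of
`H`. -/
noncomputable def coordinates (b : Basis (Fin n) R D.H) : E →ₗ[R] HyperbolicSpace R n :=
  (b.equivFun.toLinearMap ∘ₗ D.H.projectionOnto D.H' D.isCompl).prod
    (LinearMap.pi fun i => form.flip (b i))

variable {D}

theorem coordinates_apply (b : Basis (Fin n) R D.H) (x : E) :
    D.coordinates b x =
      (b.equivFun (D.H.projectionOnto D.H' D.isCompl x), fun i => form x (b i)) := rfl

theorem hyp_coordinates (hsymm : ∀ x y, form x y = form y x) (b : Basis (Fin n) R D.H) (x y : E) :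
    hyp (D.coordinates b x) (D.coordinates b y) = form x y := by
  let π := D.H.projectionOnto D.H' D.isCompl
  have hpair (x y : E) : b.equivFun (π x) ⬝ᵥ (fun i => form y (b i)) = form y (π x) := by
    conv_rhs => rw [← b.sum_equivFun (π x), Submodule.coe_sum, map_sum]
    simp only [dotProduct, Submodule.coe_smul, map_smul, smul_eq_mul]
  have hsplit (x y : E) : form x (π y) = form (x - π x) (π y) := by
    rw [map_sub, LinearMap.sub_apply, D.isotropic _ (π x).2 _ (π y).2, sub_zero]
  calc hyp (D.coordinates b x) (D.coordinates b y)
    _ = form y (π x) + form x (π y) := by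
      rw [hyp_apply, dotProduct_comm (D.coordinates b x).2]
      exact congrArg₂ _ (hpair x y) (hpair y x)
    _ = form (π x) (y - π y) + form (x - π x) (π y) := by
      rw [hsplit x, hsplit y, hsymm (π x : E)]
    _ = form (π x + (x - π x)) (π y + (y - π y)) := by
      simp only [map_add, LinearMap.add_apply,
        D.isotropic' _ (D.sub_projectionOnto_mem x) _ (D.sub_projectionOnto_mem y),
        D.isotropic _ (π x).2 _ (π y).2, π]
      ring
    _ = form x y := by rw [add_sub_cancel, add_sub_cancel]

theorem coordinates_injective (hsymm : ∀ x y, form x y = form y x)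
    (hinj : Function.Injective form) (b : Basis (Fin n) R D.H) :
    Function.Injective (D.coordinates b) := by
  rw [injective_iff_map_eq_zero]
  intro x hx
  refine (injective_iff_map_eq_zero form).mp hinj x (LinearMap.ext fun y => ?_)
  rw [← hyp_coordinates hsymm b, hx, map_zero]
  rfl

theorem coordinates_surjective (hsurj : Function.Surjective form) (b : Basis (Fin n) R D.H) :
    Function.Surjective (D.coordinates b) := by
  rintro ⟨α, β⟩
  let π := D.H.projectionOnto D.H' D.isCompl
  obtain ⟨x, hx⟩ := hsurj (b.constr R β ∘ₗ π)
  refine ⟨(b.equivFun.symm α : D.H) + (x - π x), Prod.ext ?_ (funext fun i => ?_)⟩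
  · rw [coordinates_apply, map_add, Submodule.projectionOnto_apply_left,
      (Submodule.projectionOnto_apply_eq_zero_iff D.isCompl).mpr (D.sub_projectionOnto_mem x),
      add_zero, LinearEquiv.apply_symm_apply]
  · change form _ _ = β i
    rw [map_add, map_sub, LinearMap.add_apply, LinearMap.sub_apply,
      D.isotropic _ (Subtype.mem _) _ (Subtype.mem _),
      D.isotropic _ (Subtype.mem _) _ (Subtype.mem _), hx]
    simp [π]

theorem exists_isAdapted_of_basis (hsymm : ∀ x y, form x y = form y x)
    (hbij : Function.Bijective form) (b : Basis (Fin n) R D.H) :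
    ∃ ε : E ≃ₗ[R] HyperbolicSpace R n, D.IsAdapted ε := by
  have hinj := coordinates_injective hsymm hbij.1 b
  refine ⟨LinearEquiv.ofBijective (D.coordinates b) ⟨hinj, coordinates_surjective hbij.2 b⟩,
    fun x y => (hyp_coordinates hsymm b x y).symm, fun x => ⟨fun hx => ?_, fun hx => ?_⟩, ?_⟩
  · exact funext fun i => D.isotropic x hx _ (b i).2
  · have hx' : x - D.H.projectionOnto D.H' D.isCompl x = 0 := by
      refine (injective_iff_map_eq_zero _).mp hinj _ (Prod.ext ?_ (funext fun i => ?_))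
      · rw [coordinates_apply, map_sub, Submodule.projectionOnto_apply_left, sub_self, map_zero]
        rfl
      · change form (x - _) (b i) = 0
        rw [map_sub, LinearMap.sub_apply, D.isotropic _ (Subtype.mem _) _ (b i).2, sub_zero]
        exact congrFun hx i
    exact sub_eq_zero.mp hx' ▸ Subtype.mem _
  · intro x
    change x ∈ D.H' ↔ b.equivFun (D.H.projectionOnto D.H' D.isCompl x) = 0
    rw [LinearEquiv.map_eq_zero_iff, Submodule.projectionOnto_apply_eq_zero_iff]

theorem exists_isAdapted [IsLocalRing R] (D : IsotropicDecomposition form)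
    (hsymm : ∀ x y, form x y = form y x) (hbij : Function.Bijective form)
    (e : E ≃ₗ[R] HyperbolicSpace R n) :
    ∃ ε : E ≃ₗ[R] HyperbolicSpace R n, D.IsAdapted ε := by
  have : Module.Free R E := Module.Free.of_equiv e.symm
  have : Module.Finite R E := Module.Finite.equiv e.symm
  have : Module.Finite R D.H := Module.Finite.of_surjective (D.H.projectionOnto D.H' D.isCompl)
    (Submodule.projectionOnto_surjective D.isCompl)
  have : Module.Projective R D.H := Module.Projective.of_split D.H.subtype
    (D.H.projectionOnto D.H' D.isCompl) (Submodule.projectionOnto_comp_subtype D.isCompl)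
  have : Module.Free R D.H := Module.free_of_flat_of_isLocalRing
  obtain ⟨ε, -⟩ := exists_isAdapted_of_basis hsymm hbij (Module.finBasis R D.H)
  have hrank := (ε.symm.trans e).finrank_eq
  simp only [Module.finrank_prod, Module.finrank_fin_fun] at hrank
  exact exists_isAdapted_of_basis hsymm hbij
    (Module.finBasisOfFinrankEq R D.H (show _ = n by lia))

end IsotropicDecomposition

theorem exists_hyperbolicSpace_equiv {R : Type u} [CommRing R] {E : Type v}
    [AddCommGroup E] [Module R E] {form : LinearMap.BilinForm R E} {n : ℕ}
    (h : HasHyperbolicBasis form n) (hsymm : ∀ x y, form x y = form y x) :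
    ∃ ε : E ≃ₗ[R] HyperbolicSpace R n, ∀ x y, form x y = Spinor.hyp (ε x) (ε y) := by
  obtain ⟨e, hll, hrr, hlr⟩ := h
  have hrl (i j : Fin n) : form (e (.inr i)) (e (.inl j)) = if j = i then 1 else 0 := by
    rw [hsymm, hlr]
  refine ⟨e.equivFun.trans (LinearEquiv.sumArrowLequivProdArrow (Fin n) (Fin n) R R),
    fun x y => ?_⟩
  conv_lhs => rw [← e.sum_equivFun x, ← e.sum_equivFun y]
  simp only [Fintype.sum_sum_type, map_add, map_sum, LinearMap.add_apply, LinearMap.sum_apply,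
    map_smul, LinearMap.smul_apply, hll, hrr, hlr, hrl, smul_eq_mul, mul_zero,
    Finset.sum_const_zero, zero_add, add_zero, mul_ite, mul_one, Finset.sum_ite_eq,
    Finset.sum_ite_eq', Finset.mem_univ, if_true]
  rw [Spinor.hyp_comm, Spinor.hyp_apply]
  rfl

/-! ### Exactness modulo a regular sequence -/

section ExactModulo

variable {R : Type*} [CommRing R] {M' M N K : Type*} [AddCommGroup M'] [Module R M']
  [AddCommGroup M] [Module R M] [AddCommGroup N] [Module R N] [AddCommGroup K] [Module R K]

theorem mem_smul_top_iff_forall_dual [Module.Free R M] [Module.Finite R M] (c : Ideal R) (x : M) :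
    x ∈ c • (⊤ : Submodule R M) ↔ ∀ l : Dual R M, l x ∈ c := by
  refine ⟨fun hx l => ?_, fun h => ?_⟩
  · simpa using Submodule.smul_top_le_comap_smul_top c l hx
  · let b := Module.Free.chooseBasis R M
    rw [← b.sum_repr x]
    exact sum_mem fun i _ => Submodule.smul_mem_smul (h (b.coord i)) trivial

theorem mem_smul_top_dual_iff [Module.Free R M] [Module.Finite R M] (c : Ideal R) (l : Dual R M) :
    l ∈ c • (⊤ : Submodule R (Dual R M)) ↔ ∀ x, l x ∈ c :=
  (mem_smul_top_iff_forall_dual c l).trans (evalEquiv R M).surjective.forall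

/-- Exactness of `M → N → K` at `N` modulo an ideal. -/
def ExactModulo (c : Ideal R) (f : M →ₗ[R] N) (g : N →ₗ[R] K) : Prop :=
  ∀ y, g y ∈ c • (⊤ : Submodule R K) → ∃ x, y - f x ∈ c • (⊤ : Submodule R N)

theorem exactModulo_bot {f : M →ₗ[R] N} {g : N →ₗ[R] K} (h : Function.Exact f g) :
    ExactModulo ⊥ f g := by
  intro y hy
  rw [Submodule.bot_smul, Submodule.mem_bot] at hy
  obtain ⟨x, rfl⟩ := (h y).mp hy
  exact ⟨x, by simp⟩

theorem ExactModulo.span_singleton_sup [Module.Free R K] [Module.Finite R K] {c : Ideal R} {x : R}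
    (hx : ∀ g, x * g ∈ c → g ∈ c) {e : M' →ₗ[R] M} {f : M →ₗ[R] N} {g : N →ₗ[R] K}
    (hef : ExactModulo c e f) (hfg : ExactModulo c f g) (hgf : ∀ y, g (f y) = 0) :
    ExactModulo (Ideal.span {x} ⊔ c) e f := by
  intro y hy
  rw [Submodule.sup_smul, Submodule.ideal_span_singleton_smul] at hy ⊢
  obtain ⟨_, ⟨n, -, rfl⟩, w, hw, hnw⟩ := Submodule.mem_sup.mp hy
  change x • n + w = f y at hnw
  have hgn : g n ∈ c • (⊤ : Submodule R K) := by
    rw [mem_smul_top_iff_forall_dual]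
    intro l
    have hsum : x * l (g n) + l (g w) = 0 := by
      rw [← smul_eq_mul, ← map_smul, ← map_add, ← map_smul, ← map_add, hnw, hgf, map_zero]
    refine hx _ ?_
    rw [eq_neg_of_add_eq_zero_left hsum]
    exact neg_mem ((mem_smul_top_iff_forall_dual c _).mp
      (Submodule.smul_top_le_comap_smul_top c g hw) l)
  obtain ⟨m, hm⟩ := hfg n hgn
  have hfym : f (y - x • m) = x • (n - f m) + w := by
    rw [map_sub, ← hnw, map_smul]
    module
  obtain ⟨m', hm'⟩ := hef (y - x • m) (hfym ▸ add_mem (Submodule.smul_mem _ _ hm) hw)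
  refine ⟨m', ?_⟩
  rw [show y - e m' = x • m + (y - x • m - e m') by abel]
  exact Submodule.add_mem_sup (Submodule.smul_mem_pointwise_smul m x _ trivial) hm'

open IsLocalRing in
theorem IsRegularModAt.mem_of_mul_mem [IsLocalRing R] {c : Ideal R} {x : R}
    (h : IsRegularModAt (maximalIdeal R) c x) (g : R) (hg : x * g ∈ c) : g ∈ c := by
  obtain ⟨s, hs, hsg⟩ := h g hg
  exact (c.unit_mul_mem_iff_mem (notMem_maximalIdeal.mp hs)).mp hsg

end ExactModulo

/-! ### The support of a cokernel -/

section Support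

open TensorProduct

variable {R : Type*} [CommRing R] (P : Ideal R) [P.IsPrime]

theorem exists_notMem_algebraMap_eq_mul {ι : Type*} [Finite ι] (c : ι → P.ResidueField) :
    ∃ s, s ∉ P ∧ ∃ r : ι → R, ∀ i, algebraMap R P.ResidueField (r i) =
      algebraMap R P.ResidueField s * c i := by
  obtain ⟨b, hb⟩ := IsLocalization.exist_integer_multiples_of_finite
    (nonZeroDivisors (R ⧸ P)) c
  obtain ⟨s, hs⟩ := Ideal.Quotient.mk_surjective (b : R ⧸ P)
  choose r hr using hb
  choose r' hr' using fun i => Ideal.Quotient.mk_surjective (r i)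
  refine ⟨s, fun h => nonZeroDivisors.ne_zero b.2 ?_, r', fun i => ?_⟩
  · rw [← hs]
    exact Ideal.Quotient.eq_zero_iff_mem.mpr h
  · rw [← Ideal.algebraMap_quotient_residueField_mk, hr', hr,
      ← Ideal.algebraMap_quotient_residueField_mk, hs, Algebra.smul_def]

theorem exists_dual_notMem_of_mem_support {M N : Type*} [AddCommGroup M] [Module R M]
    [Module.Free R M] [Module.Finite R M] [AddCommGroup N] [Module R N] (f : N →ₗ[R] M)
    (hP : ⟨P, ‹_›⟩ ∈ Module.support R (M ⧸ LinearMap.range f)) :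
    ∃ l : Dual R M, (∃ x, l x ∉ P) ∧ ∀ y, l (f y) ∈ P := by
  obtain ⟨χ, hχ⟩ : ∃ χ : (M ⧸ LinearMap.range f) →ₗ[R] P.ResidueField, χ ≠ 0 := by
    rw [Module.mem_support_iff_nontrivial_residueField_tensorProduct] at hP
    have : Nontrivial (P.ResidueField ⊗[R] (M ⧸ LinearMap.range f)) := hP
    have : Nontrivial ((M ⧸ LinearMap.range f) →ₗ[R] P.ResidueField) :=
      (LinearMap.liftBaseChangeEquiv P.ResidueField).toEquiv.nontrivial
    exact exists_ne 0
  let v : M →ₗ[R] P.ResidueField := χ ∘ₗ (LinearMap.range f).mkQ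
  let b := Module.Free.chooseBasis R M
  obtain ⟨s, hs, r, hr⟩ := exists_notMem_algebraMap_eq_mul P fun i => v (b i)
  have hl (x : M) : algebraMap R P.ResidueField (b.constr R r x) =
      algebraMap R P.ResidueField s * v x := by
    refine LinearMap.congr_fun (f := Algebra.linearMap R P.ResidueField ∘ₗ b.constr R r)
      (g := LinearMap.mulLeft R (algebraMap R P.ResidueField s) ∘ₗ v) (b.ext fun i => ?_) x
    simpa using hr i
  refine ⟨b.constr R r, ?_, fun y => ?_⟩
  · by_contra! hmem
    refine hχ (Submodule.linearMap_qext _ (LinearMap.ext fun x => ?_))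
    have hx := hl x
    rw [Ideal.algebraMap_residueField_eq_zero.mpr (hmem x), zero_eq_mul,
      Ideal.algebraMap_residueField_eq_zero] at hx
    exact hx.resolve_left hs
  · rw [← Ideal.algebraMap_residueField_eq_zero, hl]
    simp [v, (Submodule.Quotient.mk_eq_zero _).mpr (LinearMap.mem_range_self f y)]

end Support

namespace SelfDualSequence

open IsLocalRing

variable {R : Type u} [CommRing R] {B₀ B₁ B₂ : Type v}
  [AddCommGroup B₀] [Module R B₀] [AddCommGroup B₁] [Module R B₁]
  [AddCommGroup B₂] [Module R B₂] {B : SelfDualSequence R B₀ B₁ B₂}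

theorem form_δ₃ (φ : Dual R B₁) (x : B₂) : B.form (B.δ₃ φ) x = φ (B.δ₂ x) :=
  LinearMap.congr_fun (B.formEquiv.apply_symm_apply (B.δ₂.dualMap φ)) x

variable [IsLocalRing R] [Module.Free R B₀] [Module.Finite R B₀] [Module.Free R B₁]
  [Module.Finite R B₁] [Module.Free R B₂] [Module.Finite R B₂]

theorem IsAcyclic.exactModulo_of_isRegularSeqAt (hB : B.IsAcyclic) {l : List R}
    (hl : l.length < 4) (hreg : IsRegularSeqAt (maximalIdeal R) l) :
    ExactModulo (Ideal.ofList l) (0 : Dual R B₀ →ₗ[R] Dual R B₀) B.δ₄ ∧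
    (l.length < 3 → ExactModulo (Ideal.ofList l) B.δ₄ B.δ₃) ∧
    (l.length < 2 → ExactModulo (Ideal.ofList l) B.δ₃ B.δ₂) ∧
    (l.length < 1 → ExactModulo (Ideal.ofList l) B.δ₂ B.δ₁) := by
  induction l with
  | nil =>
    rw [Ideal.ofList_nil]
    exact ⟨exactModulo_bot ((LinearMap.exact_zero_iff_injective _ _).mpr hB.injective),
      fun _ => exactModulo_bot hB.exact₃, fun _ => exactModulo_bot hB.exact₂,
      fun _ => exactModulo_bot hB.exact₁⟩
  | cons x l ih =>
    rw [List.length_cons] at hl ⊢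
    obtain ⟨h₄, h₃, h₂, h₁⟩ := ih (by lia) hreg.2
    have hx := hreg.1.mem_of_mul_mem
    rw [Ideal.ofList_cons]
    exact ⟨h₄.span_singleton_sup hx (h₃ (by lia)) hB.exact₃.apply_apply_eq_zero,
      fun h => (h₃ (by lia)).span_singleton_sup hx (h₂ (by lia)) hB.exact₂.apply_apply_eq_zero,
      fun h => (h₂ (by lia)).span_singleton_sup hx (h₁ (by lia)) hB.exact₁.apply_apply_eq_zero,
      fun h => by lia⟩

theorem IsAcyclic.notMem_support [IsNoetherianRing R] (hB : B.IsAcyclic) {l : List R}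
    (hl : l.length < 4) (hreg : IsRegularSeqAt (maximalIdeal R) l) {Q : PrimeSpectrum R}
    (hQ : Q.asIdeal ∈ associatedPrimes R (R ⧸ Ideal.ofList l)) :
    Q ∉ Module.support R (B₀ ⧸ LinearMap.range B.δ₁) := by
  intro hsupp
  obtain ⟨-, g, hg⟩ := mem_associatedPrimes_quotient_iff.mp hQ
  obtain ⟨ψ, ⟨x, hx⟩, hψ⟩ := exists_dual_notMem_of_mem_support Q.asIdeal B.δ₁ hsupp
  obtain ⟨_, hgψ⟩ := (hB.exactModulo_of_isRegularSeqAt hl hreg).1 (g • ψ) (by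
    rw [mem_smul_top_dual_iff]
    intro y
    change g * ψ (B.δ₁ y) ∈ _
    rw [mul_comm]
    exact (hg _).mp (hψ y))
  rw [LinearMap.zero_apply, sub_zero, mem_smul_top_dual_iff] at hgψ
  exact hx ((hg _).mpr (mul_comm g _ ▸ hgψ x))

end SelfDualSequence

/-! ### Spinors annihilated by a coisotropic submodule -/

namespace Spinor

section Annihilated

variable {R : Type*} [CommRing R] {n : ℕ} {L : Submodule R (HyperbolicSpace R n)}
  {s t : Spinor R n}

theorem hyp_apply_annih_create (l : Dual R (Spinor R n)) (s : Spinor R n)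
    (x : HyperbolicSpace R n) :
    hyp x (fun i => l (annih i s), fun i => l (create i s)) = l (act x s) := by
  simp only [hyp_apply, dotProduct, act_apply, map_sum, map_add, map_smul, smul_eq_mul,
    Finset.sum_add_distrib]

theorem annih_create_mem (hL : hyp.orthogonal L ≤ L) (hs : ∀ x ∈ L, act x s = 0)
    (l : Dual R (Spinor R n)) : (fun i => l (annih i s), fun i => l (create i s)) ∈ L :=
  hL fun x hx => (hyp_apply_annih_create l s x).trans (by rw [hs x hx, map_zero])

theorem annih_apply_empty (i : Fin n) (s : Spinor R n) : annih i s ∅ = s {i} := by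
  simp [annih_apply, sgn]

theorem create_apply_empty (i : Fin n) (s : Spinor R n) : create i s ∅ = 0 := by
  simp [create_apply]

theorem act_apply_empty (x : HyperbolicSpace R n) (s : Spinor R n) :
    act x s ∅ = ∑ i, x.2 i * s {i} := by
  rw [act_apply, Finset.sum_apply]
  exact Finset.sum_congr rfl fun i _ => by simp [annih_apply_empty, create_apply_empty]

theorem exists_smul_mem_of_sum_eq_zero (hL : hyp.orthogonal L ≤ L) (hs : ∀ x ∈ L, act x s = 0)
    {h : Fin n → R} (hh : ∑ i, h i * s {i} = 0) (j : Fin n) :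
    ∃ y : Fin n → R, (y, s {j} • h) ∈ L := by
  let l : Dual R (Spinor R n) := LinearMap.proj ∅ ∘ₗ act (0, h) ∘ₗ annih j
  have hcreate (k : Fin n) : l (create k s) = - (s {j} * h k) := by
    have hanti : annih j (create k s) = (Pi.single k (1 : R) : Fin n → R) j • s -
        create k (annih j s) := by
      simpa [act_single_zero] using annih_act j (Pi.single k (1 : R), 0) s
    have hact := congrFun (create_act k (0, h) (annih j s)) ∅
    rw [create_apply_empty, Pi.sub_apply, Pi.smul_apply, smul_eq_mul, annih_apply_empty] at hact
    change act (0, h) (annih j (create k s)) ∅ = _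
    rw [hanti, map_sub, map_smul, Pi.sub_apply, Pi.smul_apply, act_apply_empty, hh, smul_zero]
    linear_combination -hact
  refine ⟨fun i => - l (annih i s), ?_⟩
  convert neg_mem (annih_create_mem hL hs l) using 1
  exact Prod.ext rfl (funext fun k => by simp [hcreate])

theorem mul_eq_mul_of_mem (hs : ∀ x ∈ L, act x s = 0) {z : Fin n → R} (hz : (z, 0) ∈ L)
    (i j : Fin n) : s {j} * z i = z j * s {i} := by
  have hzero : annih i (annih j (act (z, 0) s)) ∅ = 0 := by rw [hs _ hz]; simp
  rw [annih_act, map_sub, map_smul, annih_act, Pi.sub_apply, Pi.sub_apply, Pi.smul_apply,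
    Pi.smul_apply, annih_apply_empty, annih_apply_empty, act_apply_empty] at hzero
  simp only [Pi.zero_apply, zero_mul, Finset.sum_const_zero, sub_zero, smul_eq_mul] at hzero
  linear_combination -hzero

theorem exists_annih_sub_eq_act (hL : hyp.orthogonal L ≤ L) (hs : ∀ x ∈ L, act x s = 0)
    (ht : ∀ x ∈ L, act x t = 0) (j k : Fin n) :
    ∃ y : Fin n → R, s {j} • (s {j} • annih k t - s {k} • annih j t) = act (y, 0) t := by
  let h : Fin n → R := Pi.single k (s {j}) - Pi.single j (s {k})
  obtain ⟨y, hy⟩ := exists_smul_mem_of_sum_eq_zero hL hs (h := h) (by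
    simp [h, sub_mul, Finset.sum_sub_distrib, Pi.single_apply, mul_comm]) j
  have hsplit : (-y, 0) = s {j} • (0, h) - (y, s {j} • h) := by ext <;> simp
  have hh : ((0 : Fin n → R), h) = (0, Pi.single k (s {j})) - (0, Pi.single j (s {k})) := by
    ext <;> simp [h]
  refine ⟨-y, ?_⟩
  rw [hsplit, map_sub, LinearMap.sub_apply, ht _ hy, sub_zero, map_smul, LinearMap.smul_apply, hh,
    map_sub, LinearMap.sub_apply, act_zero_single, act_zero_single, LinearMap.smul_apply,
    LinearMap.smul_apply]

variable {Q : Ideal R}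

theorem act_left_mem {K : Finset (Fin n)} (ht : ∀ i ∈ K, t (K.erase i) ∈ Q) (y : Fin n → R) :
    act (y, 0) t K ∈ Q := by
  rw [act_apply, Finset.sum_apply]
  refine sum_mem fun i _ => ?_
  simp only [Pi.zero_apply, zero_smul, add_zero, Pi.smul_apply, smul_eq_mul, create_apply]
  refine Q.mul_mem_left _ ?_
  split_ifs with hi
  · exact Q.mul_mem_left _ (ht i hi)
  · exact zero_mem _

theorem annih_erase_mem_iff {K : Finset (Fin n)} {k : Fin n} (hk : k ∈ K) :
    annih k t (K.erase k) ∈ Q ↔ t K ∈ Q := by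
  rw [annih_apply, if_neg (Finset.notMem_erase _ _), Finset.insert_erase hk]
  refine ⟨fun h => ?_, Q.mul_mem_left _⟩
  simpa [← mul_assoc, sgn_mul_self] using Q.mul_mem_left (sgn R k (K.erase k)) h

/-- A spinor annihilated by `L` is determined up to a scalar by any other one, on the locus where
the degree one part of the latter does not vanish. -/
theorem mem_of_forall_singleton_mem [Q.IsPrime] (hL : hyp.orthogonal L ≤ L)
    (hs : ∀ x ∈ L, act x s = 0) {j : Fin n} (hj : s {j} ∉ Q) (ht : ∀ x ∈ L, act x t = 0)
    (h0 : t ∅ ∈ Q) (h1 : ∀ i, t {i} ∈ Q) (K : Finset (Fin n)) : t K ∈ Q := by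
  induction hN : K.card using Nat.strong_induction_on generalizing K with | _ N ih
  subst hN
  rcases Nat.lt_or_ge 1 K.card with hcard | hcard
  swap
  · rcases Nat.le_one_iff_eq_zero_or_eq_one.mp hcard with hK | hK
    · rwa [Finset.card_eq_zero.mp hK]
    · obtain ⟨i, rfl⟩ := Finset.card_eq_one.mp hK
      exact h1 i
  have hannih (K' : Finset (Fin n)) (hK' : K'.card = K.card) (k) (hk : k ∈ K')
      (hmem : annih j t (K'.erase k) ∈ Q) : t K' ∈ Q := by
    obtain ⟨y, hy⟩ := exists_annih_sub_eq_act hL hs ht j k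
    have hact : act (y, 0) t (K'.erase k) ∈ Q := by
      refine act_left_mem (fun i hi => ih _ ?_ _ rfl) y
      exact hK' ▸ (Finset.card_erase_lt_of_mem hi).trans (Finset.card_erase_lt_of_mem hk)
    rw [← hy] at hact
    have hsub := (Ideal.IsPrime.mem_or_mem ‹_› hact).resolve_left hj
    have hk' := (Submodule.sub_mem_iff_left _ (Q.mul_mem_left (s {k}) hmem)).mp hsub
    exact (annih_erase_mem_iff hk).mp ((Ideal.IsPrime.mem_or_mem ‹_› hk').resolve_left hj)
  have hmem (K' : Finset (Fin n)) (hK' : K'.card = K.card) (hjK : j ∈ K') : t K' ∈ Q := by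
    obtain ⟨k, hk, hkj⟩ := Finset.exists_mem_ne (hK' ▸ hcard) j
    refine hannih K' hK' k hk ?_
    rw [annih_apply, if_pos (Finset.mem_erase.mpr ⟨hkj.symm, hjK⟩)]
    exact zero_mem _
  by_cases hjK : j ∈ K
  · exact hmem K rfl hjK
  obtain ⟨k, hk⟩ := Finset.card_pos.mp (zero_lt_one.trans hcard)
  have hjk : j ∉ K.erase k := fun h => hjK (Finset.mem_of_mem_erase h)
  refine hannih K rfl k hk ?_
  rw [annih_apply, if_neg hjk]
  refine Q.mul_mem_left _ (hmem _ ?_ (Finset.mem_insert_self _ _))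
  rw [Finset.card_insert_of_notMem hjk, Finset.card_erase_add_one hk]

end Annihilated

end Spinor

/-! ### Generic decompositions for a self-dual sequence -/

open Spinor in
theorem IsotropicDecomposition.IsAdapted.exists_dual_notMem_iff {R : Type u} [CommRing R]
    {E : Type v} [AddCommGroup E] [Module R E] {form : LinearMap.BilinForm R E}
    {D : IsotropicDecomposition form} {n : ℕ} {ε : E ≃ₗ[R] HyperbolicSpace R n}
    (hε : D.IsAdapted ε) (a : D.VOdd) (P : Ideal R) :
    (∃ l : Dual R D.VOdd, l a ∉ P) ↔ ∃ K, hε.toSpinor a K ∉ P := by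
  constructor
  · rintro ⟨l, hl⟩
    by_contra! hmem
    let e := LinearEquiv.ofBijective hε.toSpinor ⟨hε.toSpinor_injective, hε.toSpinor_surjective⟩
    let π := D.VOdd.projectionOnto D.VEven (CliffordAlgebra.evenOdd_isCompl _).symm
    have hla : l a = (l ∘ₗ π ∘ₗ e.symm.toLinearMap) (hε.toSpinor a) := by
      change l a = l (π (e.symm (e a)))
      rw [LinearEquiv.symm_apply_apply, Submodule.projectionOnto_apply_left]
    rw [hla, LinearMap.pi_apply_eq_sum_univ] at hl
    exact hl (sum_mem fun K _ => P.mul_mem_right _ (hmem K))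
  · rintro ⟨K, hK⟩
    exact ⟨LinearMap.proj K ∘ₗ hε.toSpinor ∘ₗ D.VOdd.subtype, hK⟩

namespace SelfDualSequence

open Spinor IsLocalRing

variable {R : Type u} [CommRing R] {B₀ B₁ B₂ : Type v}
  [AddCommGroup B₀] [Module R B₀] [AddCommGroup B₁] [Module R B₁]
  [AddCommGroup B₂] [Module R B₂] {B : SelfDualSequence R B₀ B₁ B₂} {n : ℕ}
  {D : IsotropicDecomposition B.form} {ε ε' : B₂ ≃ₗ[R] HyperbolicSpace R n} {s t : Spinor R n}

theorem isSpinorCoordinates_iff (hε : D.IsAdapted ε) (a : D.VOdd) :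
    B.IsSpinorCoordinates D a ↔ IsSpinorOf B.form (LinearMap.range B.δ₃)
      (Module.support R (B₀ ⧸ LinearMap.range B.δ₁))ᶜ ε (hε.toSpinor a) := by
  have hann (x : B₂) : D.actOn a x = 0 ↔ act (ε x) (hε.toSpinor a) = 0 := by
    rw [← hε.toSpinor_cliffordAction, map_eq_zero_iff _ hε.toSpinor_injective]
    exact Subtype.ext_iff
  constructor
  · rintro ⟨hannihilated, hnonvanishing⟩
    refine ⟨hε.isometry, hε.hasParity_toSpinor a.2, ?_, fun P hP =>
      (hε.exists_dual_notMem_iff a P.asIdeal).mp (hnonvanishing P hP)⟩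
    rintro _ ⟨φ, rfl⟩
    exact (hann _).mp (hannihilated φ)
  · intro h
    exact ⟨fun φ => (hann _).mpr (h.annihilated _ ⟨φ, rfl⟩), fun P hP =>
      (hε.exists_dual_notMem_iff a P.asIdeal).mpr (h.nonvanishing P hP)⟩

variable [Module.Free R B₁]

theorem IsAcyclic.orthogonal_range_δ₃_le (hB : B.IsAcyclic) :
    B.form.orthogonal (LinearMap.range B.δ₃) ≤ LinearMap.range B.δ₃ := by
  intro y hy
  refine (hB.exact₂ y).mp ((forall_dual_apply_eq_zero_iff R _).mp fun φ => ?_)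
  rw [← form_δ₃]
  exact hy _ ⟨φ, rfl⟩

theorem IsAcyclic.orthogonal_map_range_δ₃_le (hB : B.IsAcyclic)
    (hiso : ∀ x y, B.form x y = hyp (ε x) (ε y)) :
    hyp.orthogonal ((LinearMap.range B.δ₃).map ε.toLinearMap) ≤
      (LinearMap.range B.δ₃).map ε.toLinearMap := by
  refine fun y hy => ⟨ε.symm y, hB.orthogonal_range_δ₃_le fun x hx => ?_, by simp⟩
  refine (hiso x _).trans ?_
  rw [LinearEquiv.apply_symm_apply]
  exact hy _ ⟨x, hx, rfl⟩

variable [IsNoetherianRing R] [IsLocalRing R] [Module.Free R B₀] [Module.Finite R B₀]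
  [Module.Finite R B₁] [Module.Free R B₂] [Module.Finite R B₂]

theorem IsAcyclic.localGradeGE_of_isSpinorOf (hB : B.IsAcyclic) {k : ℕ} (hk : k ≤ 4)
    (hs : IsSpinorOf B.form (LinearMap.range B.δ₃)
      (Module.support R (B₀ ⧸ LinearMap.range B.δ₁))ᶜ ε s) :
    LocalGradeGE (maximalIdeal R) (Ideal.span (Set.range s)) k := by
  refine .of_forall_associatedPrimes fun l hl _ hreg Q hQ _ hle => ?_
  obtain ⟨K, hK⟩ := hs.nonvanishing ⟨Q, hQ.1⟩ (hB.notMem_support (by lia) hreg hQ)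
  exact hK (hle (Ideal.subset_span ⟨K, rfl⟩))

theorem IsAcyclic.localGradeGE_singleton (hB : B.IsAcyclic) {k : ℕ} (hk : k ≤ 4)
    (hs : ∀ x ∈ LinearMap.range B.δ₃, act (ε x) s = 0)
    (hsgrade : LocalGradeGE (maximalIdeal R) (Ideal.span (Set.range fun i => s {i})) k)
    (ht : IsSpinorOf B.form (LinearMap.range B.δ₃)
      (Module.support R (B₀ ⧸ LinearMap.range B.δ₁))ᶜ ε t) :
    LocalGradeGE (maximalIdeal R) (Ideal.span (Set.range fun i => t {i})) k := by
  refine .of_forall_associatedPrimes fun l hl hlF hreg Q hQ hQm hle => ?_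
  have hprime := hQ.1
  have hnot := (hsgrade.mono hQm le_rfl).not_le_of_mem_associatedPrimes (hreg.mono hQm)
    (fun x hx => hle (hlF x hx)) hl hQ
  obtain ⟨j, hj⟩ : ∃ j, s {j} ∉ Q := by
    simpa [Ideal.span_le, Set.range_subset_iff] using hnot
  obtain ⟨K, hK⟩ := ht.nonvanishing ⟨Q, hprime⟩ (hB.notMem_support (by lia) hreg hQ)
  refine hK (mem_of_forall_singleton_mem (hB.orthogonal_map_range_δ₃_le ht.isometry) ?_ hj ?_
    (ht.isOdd ∅ (by simp) ▸ zero_mem _) (fun i => hle (Ideal.subset_span ⟨i, rfl⟩)) K)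
  · rintro _ ⟨x, hx, rfl⟩
    exact hs x hx
  · rintro _ ⟨x, hx, rfl⟩
    exact ht.annihilated x hx

theorem HasSpinorCoordinates.exists_generic [Infinite (ResidueField R)] (hB : B.IsAcyclic)
    (e : B₂ ≃ₗ[R] HyperbolicSpace R n) (h : B.HasSpinorCoordinates) :
    ∃ (D : IsotropicDecomposition B.form) (ε : B₂ ≃ₗ[R] HyperbolicSpace R n)
      (hε : D.IsAdapted ε), (∃ a : D.VOdd, B.IsSpinorCoordinates D a) ∧
      ∀ a : D.VOdd, B.IsSpinorCoordinates D a → LocalGradeGE (maximalIdeal R)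
        (Ideal.span (Set.range fun i => hε.toSpinor a {i})) 3 := by
  obtain ⟨D₀, a₀, ha₀⟩ := h
  obtain ⟨ε₀, hε₀⟩ := D₀.exists_isAdapted B.form_symm B.form_bijective e
  rw [isSpinorCoordinates_iff hε₀] at ha₀
  obtain ⟨ε, s, hs, hgrade⟩ := ha₀.exists_generic
    (hB.localGradeGE_of_isSpinorOf (by lia) ha₀)
  let D := IsotropicDecomposition.ofCoordinates ε hs.isometry
  have hε : D.IsAdapted ε := IsotropicDecomposition.isAdapted_ofCoordinates ε hs.isometry
  obtain ⟨a, ha⟩ := hε.exists_toSpinor_eq hs.isOdd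
  refine ⟨D, ε, hε, ⟨a, ?_⟩, fun a' ha' => ?_⟩
  · rwa [isSpinorCoordinates_iff hε, ha]
  · exact hB.localGradeGE_singleton (by lia) hs.annihilated hgrade
      ((isSpinorCoordinates_iff hε a').mp ha')

end SelfDualSequence

/-! ### Acyclicity in grade three -/

section Acyclicity

open RingTheory.Sequence IsLocalRing

variable {R : Type*} [CommRing R]

theorem isWeaklyRegular_of_flat (M : Type*) [AddCommGroup M] [Module R M] [Module.Flat R M]
    {l : List R} (h : IsWeaklyRegular R l) : IsWeaklyRegular M l :=
  ((TensorProduct.lid R M).isWeaklyRegular_congr l).mp h.isWeaklyRegular_rTensor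

theorem isWeaklyRegular_append_singleton_iff {l : List R} {x : R} :
    IsWeaklyRegular R (l ++ [x]) ↔
      IsWeaklyRegular R l ∧ ∀ g, x * g ∈ Ideal.ofList l → g ∈ Ideal.ofList l := by
  rw [isWeaklyRegular_append_iff, isWeaklyRegular_singleton_iff,
    isSMulRegular_quotient_iff_mem_of_smul_mem]
  simp only [smul_eq_mul, Ideal.mul_top]

theorem IsRegularSeqAt.isWeaklyRegular_reverse [IsLocalRing R] :
    ∀ {l : List R}, IsRegularSeqAt (maximalIdeal R) l → IsWeaklyRegular R l.reverse
  | [], _ => .nil R R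
  | x :: l, h => by
    have hofList : Ideal.ofList l.reverse = Ideal.ofList l := by simp [Ideal.ofList]
    rw [List.reverse_cons, isWeaklyRegular_append_singleton_iff, hofList]
    exact ⟨h.2.isWeaklyRegular_reverse, h.1.mem_of_mul_mem⟩

theorem LocalGradeGE.exists_isWeaklyRegular [IsLocalRing R] {I : Ideal R} {k : ℕ}
    (h : LocalGradeGE (maximalIdeal R) I k) :
    ∃ l : List R, l.length = k ∧ (∀ x ∈ l, x ∈ I) ∧ IsWeaklyRegular R l := by
  obtain ⟨l, hlength, hmem, hl⟩ := h
  exact ⟨l.reverse, by simpa using hlength, by simpa using hmem, hl.isWeaklyRegular_reverse⟩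

theorem exists_eq_smul_of_smul_eq_smul {M : Type*} [AddCommGroup M] [Module R M] {x y : R}
    (h : IsWeaklyRegular M [x, y]) {m p : M} (hm : y • m = x • p) : ∃ p', m = x • p' := by
  rw [isWeaklyRegular_cons_iff, isWeaklyRegular_singleton_iff,
    isSMulRegular_quotient_iff_mem_of_smul_mem] at h
  obtain ⟨p', -, hp'⟩ := h.2 m ⟨p, trivial, hm.symm⟩
  exact ⟨p', hp'.symm⟩

theorem exists_eq_smul_add_smul_of_smul_eq {M : Type*} [AddCommGroup M] [Module R M] {x y z : R}
    (h : IsWeaklyRegular M [x, y, z]) {m p q : M} (hm : z • m = x • p + y • q) :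
    ∃ p' q', m = x • p' + y • q' := by
  have hmem (m : M) :
      m ∈ Ideal.ofList [x, y] • (⊤ : Submodule R M) ↔ ∃ p q, x • p + y • q = m := by
    simp [Ideal.ofList_cons, Submodule.sup_smul, Submodule.ideal_span_singleton_smul,
      Submodule.mem_sup, Submodule.mem_smul_pointwise_iff_exists]
  have hz := ((isWeaklyRegular_append_iff M [x, y] [z]).mp h).2
  rw [isWeaklyRegular_singleton_iff, isSMulRegular_quotient_iff_mem_of_smul_mem] at hz
  obtain ⟨p', q', h'⟩ := (hmem m).mp (hz m ((hmem _).mpr ⟨p, q, hm.symm⟩))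
  exact ⟨p', q', h'.symm⟩

variable {F₃ F₂ F₁ : Type*} [AddCommGroup F₃] [Module R F₃] [AddCommGroup F₂] [Module R F₂]
  [AddCommGroup F₁] [Module R F₁] {d₃ : F₃ →ₗ[R] F₂} {d₂ : F₂ →ₗ[R] F₁} {x y z : R}

theorem mem_range_of_smul_mem_range_of_injective (hF₃ : IsWeaklyRegular F₃ [x, y])
    (hF₂ : IsWeaklyRegular F₂ [x]) (hinj : Function.Injective d₃) {m : F₂}
    (hx : x • m ∈ LinearMap.range d₃) (hy : y • m ∈ LinearMap.range d₃) :
    m ∈ LinearMap.range d₃ := by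
  obtain ⟨u, hu⟩ := hx
  obtain ⟨v, hv⟩ := hy
  obtain ⟨p, rfl⟩ := exists_eq_smul_of_smul_eq_smul hF₃ (m := u) (p := v) (hinj (by
    rw [map_smul, map_smul, hu, hv, smul_comm]))
  rw [map_smul] at hu
  exact ⟨p, (isWeaklyRegular_singleton_iff F₂ x).mp hF₂ hu⟩

theorem mem_range_of_smul_mem_range_of_exact (hF₃ : IsWeaklyRegular F₃ [x, y, z])
    (hF₂ : IsWeaklyRegular F₂ [x, y]) (hF₁ : IsWeaklyRegular F₁ [x]) (hinj : Function.Injective d₃)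
    (hexact : Function.Exact d₃ d₂) {m : F₁} (hx : x • m ∈ LinearMap.range d₂)
    (hy : y • m ∈ LinearMap.range d₂) (hz : z • m ∈ LinearMap.range d₂) :
    m ∈ LinearMap.range d₂ := by
  obtain ⟨u, hu⟩ := hx
  obtain ⟨v, hv⟩ := hy
  obtain ⟨w, hw⟩ := hz
  have hsyzygy {r s : R} {p q : F₂} (hp : d₂ p = r • m) (hq : d₂ q = s • m) :
      ∃ t, d₃ t = r • q - s • p :=
    (hexact _).mp (by rw [map_sub, map_smul, map_smul, hp, hq, smul_comm, sub_self])
  obtain ⟨tuv, huv⟩ := hsyzygy hu hv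
  obtain ⟨tuw, huw⟩ := hsyzygy hu hw
  obtain ⟨tvw, hvw⟩ := hsyzygy hv hw
  obtain ⟨p, q, rfl⟩ := exists_eq_smul_add_smul_of_smul_eq hF₃ (m := tuv) (p := -tvw) (q := tuw)
    (hinj (by
      rw [map_add, map_smul, map_smul, map_smul, map_neg, huv, huw, hvw]
      module))
  obtain ⟨t, ht⟩ := exists_eq_smul_of_smul_eq_smul hF₂ (m := u + d₃ q) (p := v - d₃ p) (by
    rw [map_add, map_smul, map_smul] at huv
    rw [eq_sub_iff_add_eq] at huv
    rw [smul_add, smul_sub, eq_sub_iff_add_eq, ← huv]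
    module)
  refine ⟨t, (isWeaklyRegular_singleton_iff F₁ x).mp hF₁ (?_ : x • d₂ t = x • m)⟩
  rw [← map_smul, ← ht, map_add, hexact.apply_apply_eq_zero, add_zero, hu]

end Acyclicity

namespace IsotropicDecomposition.IsAdapted

open Spinor

variable {R : Type u} [CommRing R] {E : Type v} [AddCommGroup E] [Module R E]
  {form : LinearMap.BilinForm R E} {D : IsotropicDecomposition form} {n : ℕ}
  {ε : E ≃ₗ[R] HyperbolicSpace R n}

theorem d₁_apply (hε : D.IsAdapted ε) (a : D.VOdd) (d : Dual R D.H) :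
    D.d₁ a d = ∑ i, d (hε.basisH i) * hε.toSpinor a {i} := by
  change d (ExteriorAlgebra.ιInv (a : ExteriorAlgebra R D.H)) = _
  rw [hε.dual_apply]
  exact Finset.sum_congr rfl fun i _ => by rw [hε.ιInv_eq, mul_comm]

theorem idealOf_eq_span (hε : D.IsAdapted ε) (a : D.VOdd) :
    D.idealOf a = Ideal.span (Set.range fun i => hε.toSpinor a {i}) := by
  refine le_antisymm ?_ (Ideal.span_le.mpr ?_)
  · rintro _ ⟨d, rfl⟩
    rw [hε.d₁_apply]
    exact sum_mem fun i _ => Ideal.mul_mem_left _ _ (Ideal.subset_span ⟨i, rfl⟩)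
  · rintro _ ⟨i, rfl⟩
    refine ⟨hε.basisH.coord i, ?_⟩
    rw [hε.d₁_apply, Finset.sum_eq_single i (fun j _ hj => by simp [hj]) (by simp)]
    simp

theorem smul_mem_of_mem_idealOf (hε : D.IsAdapted ε) {a : D.VOdd} {M : Type*} [AddCommGroup M]
    [Module R M] {N : Submodule R M} {z : M} (h : ∀ j, hε.toSpinor a {j} • z ∈ N) {x : R}
    (hx : x ∈ D.idealOf a) : x • z ∈ N := by
  obtain ⟨d, rfl⟩ := hx
  rw [hε.d₁_apply, Finset.sum_smul]
  exact sum_mem fun j _ => mul_smul (d (hε.basisH j)) _ z ▸ N.smul_mem _ (h j)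

end IsotropicDecomposition.IsAdapted

namespace SelfDualSequence

open Spinor IsLocalRing RingTheory.Sequence

variable {R : Type u} [CommRing R] {B₀ B₁ B₂ : Type v}
  [AddCommGroup B₀] [Module R B₀] [AddCommGroup B₁] [Module R B₁]
  [AddCommGroup B₂] [Module R B₂] {B : SelfDualSequence R B₀ B₁ B₂} {n : ℕ}
  {D : IsotropicDecomposition B.form} {ε : B₂ ≃ₗ[R] HyperbolicSpace R n}

theorem d₂_apply (φ : Dual R B₁) (h : D.H) : B.d₂ D φ h = B.form (B.δ₃ φ) h := by
  rw [form_δ₃]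
  rfl

theorem d₂_apply_eq_sum (hε : D.IsAdapted ε) (φ : Dual R B₁) (h : D.H) :
    B.d₂ D φ h = ∑ i, (ε h).1 i * (ε (B.δ₃ φ)).2 i := by
  rw [d₂_apply, hε.isometry, hyp_comm, hyp_apply, hε.apply_coe]
  simp [dotProduct]

theorem d₂_eq_zero_iff (hε : D.IsAdapted ε) (φ : Dual R B₁) :
    B.d₂ D φ = 0 ↔ (ε (B.δ₃ φ)).2 = 0 := by
  refine ⟨fun h => funext fun i => ?_, fun h => LinearMap.ext fun x => ?_⟩
  · have hi := LinearMap.congr_fun h (hε.basisH i)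
    rwa [d₂_apply, hε.isometry, hε.apply_basisH, hyp_comm, hyp_single_zero, one_mul] at hi
  · simp [d₂_apply_eq_sum hε, h]

variable {a : D.VOdd} {w : Dual R D.VEven →ₗ[R] Dual R B₁}

theorem IsSpinorLift.δ₃_dualOneEven (hε : D.IsAdapted ε) (hw : B.IsSpinorLift D a w) :
    B.δ₃ (w D.dualOneEven) = (ExteriorAlgebra.ιInv (a : ExteriorAlgebra R D.H) : D.H) := by
  refine (LinearMap.congr_fun hw D.dualOneEven).trans ((LinearEquiv.symm_apply_eq _).mpr ?_)
  ext x
  change ExteriorAlgebra.algebraMapInv (D.cliffordAction x a) = B.form _ x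
  rw [hε.algebraMapInv_eq, hε.toSpinor_cliffordAction, act_apply_empty, hε.isometry, hyp_apply,
    hε.apply_coe]
  simp [dotProduct, hε.ιInv_eq, mul_comm]

theorem IsSpinorLift.apply_δ₃_dualOneEven (hε : D.IsAdapted ε) (hw : B.IsSpinorLift D a w) :
    ε (B.δ₃ (w D.dualOneEven)) = (fun i => hε.toSpinor a {i}, 0) := by
  rw [hw.δ₃_dualOneEven hε, hε.apply_coe]
  exact Prod.ext (funext fun i => hε.ιInv_eq _ i) rfl

theorem IsSpinorCoordinates.act_eq_zero (hε : D.IsAdapted ε) (ha : B.IsSpinorCoordinates D a) :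
    ∀ x ∈ (LinearMap.range B.δ₃).map ε.toLinearMap, act x (hε.toSpinor a) = 0 := by
  rintro _ ⟨x, hx, rfl⟩
  exact ((isSpinorCoordinates_iff hε a).mp ha).annihilated x hx

theorem IsAcyclic.δ₃_d₃ (hB : B.IsAcyclic) (y : Dual R B₀ × R) :
    B.δ₃ (B.d₃ D w y) = y.2 • B.δ₃ (w D.dualOneEven) := by
  change B.δ₃ (B.δ₄ y.1 + y.2 • w D.dualOneEven) = _
  rw [map_add, hB.exact₃.apply_apply_eq_zero, zero_add, map_smul]

theorem IsAcyclic.d₃_injective (hε : D.IsAdapted ε) (hB : B.IsAcyclic) (hw : B.IsSpinorLift D a w)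
    {x : R} (hx : x ∈ D.idealOf a) (hreg : IsSMulRegular R x) : Function.Injective (B.d₃ D w) := by
  refine (injective_iff_map_eq_zero _).mpr ?_
  rintro ⟨ψ, r⟩ hy
  have hδ : r • ε (B.δ₃ (w D.dualOneEven)) = 0 := by
    rw [← map_smul, ← hB.δ₃_d₃ (ψ, r), hy, map_zero, map_zero]
  rw [hw.apply_δ₃_dualOneEven hε] at hδ
  obtain rfl : r = 0 := by
    refine hreg.right_eq_zero_of_smul (hε.smul_mem_of_mem_idealOf (N := ⊥) (fun j => ?_) hx)
    simpa [mul_comm] using congrFun (congrArg Prod.fst hδ) j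
  have hψ : B.δ₄ ψ = B.δ₄ 0 := by simpa [SelfDualSequence.d₃] using hy
  rw [hB.injective hψ, Prod.mk_zero_zero]

theorem IsAcyclic.d₂_d₃ (hε : D.IsAdapted ε) (hB : B.IsAcyclic) (hw : B.IsSpinorLift D a w)
    (y : Dual R B₀ × R) : B.d₂ D (B.d₃ D w y) = 0 := by
  rw [d₂_eq_zero_iff hε, hB.δ₃_d₃, map_smul, hw.apply_δ₃_dualOneEven hε, Prod.smul_snd, smul_zero]

theorem IsAcyclic.smul_mem_range_d₃ (hε : D.IsAdapted ε) (hB : B.IsAcyclic)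
    (ha : B.IsSpinorCoordinates D a) (hw : B.IsSpinorLift D a w) {φ : Dual R B₁}
    (hφ : B.d₂ D φ = 0) {x : R} (hx : x ∈ D.idealOf a) : x • φ ∈ LinearMap.range (B.d₃ D w) := by
  refine hε.smul_mem_of_mem_idealOf (fun j => ?_) hx
  set z := (ε (B.δ₃ φ)).1
  have hδφ : ε (B.δ₃ φ) = (z, 0) := Prod.ext rfl ((d₂_eq_zero_iff hε φ).mp hφ)
  have hmul := mul_eq_mul_of_mem (ha.act_eq_zero hε) (z := z) ⟨B.δ₃ φ, ⟨φ, rfl⟩, hδφ⟩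
  obtain ⟨ψ, hψ⟩ := (hB.exact₃ (hε.toSpinor a {j} • φ - z j • w D.dualOneEven)).mp (by
    refine ε.injective ?_
    rw [map_sub, map_smul, map_smul, map_sub, map_smul, map_smul, hδφ,
      hw.apply_δ₃_dualOneEven hε, map_zero]
    exact Prod.ext (funext fun i => sub_eq_zero.mpr (hmul i j)) (by simp))
  refine ⟨(ψ, z j), ?_⟩
  change B.δ₄ ψ + z j • w D.dualOneEven = _
  rw [hψ, sub_add_cancel]

theorem IsAcyclic.d₁_d₂ (hε : D.IsAdapted ε) (hB : B.IsAcyclic) (hw : B.IsSpinorLift D a w)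
    (φ : Dual R B₁) : D.d₁ a (B.d₂ D φ) = 0 := by
  change B.d₂ D φ (ExteriorAlgebra.ιInv (a : ExteriorAlgebra R D.H)) = 0
  rw [d₂_apply, ← hw.δ₃_dualOneEven hε, B.form_symm, form_δ₃, hB.exact₂.apply_apply_eq_zero,
    map_zero]

variable [Module.Free R B₁]

theorem IsAcyclic.smul_mem_range_d₂ (hε : D.IsAdapted ε) (hB : B.IsAcyclic)
    (ha : B.IsSpinorCoordinates D a) {d : Dual R D.H} (hd : D.d₁ a d = 0) {x : R}
    (hx : x ∈ D.idealOf a) : x • d ∈ LinearMap.range (B.d₂ D) := by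
  refine hε.smul_mem_of_mem_idealOf (fun j => ?_) hx
  rw [hε.d₁_apply] at hd
  obtain ⟨y, _, ⟨φ, rfl⟩, hφ⟩ := exists_smul_mem_of_sum_eq_zero
    (hB.orthogonal_map_range_δ₃_le hε.isometry) (ha.act_eq_zero hε) hd j
  refine ⟨φ, LinearMap.ext fun h => ?_⟩
  rw [d₂_apply_eq_sum hε, LinearMap.smul_apply, hε.dual_apply d h, Finset.smul_sum,
    show ε (B.δ₃ φ) = _ from hφ]
  exact Finset.sum_congr rfl fun i _ => mul_left_comm _ _ _

theorem IsAcyclic.exists_isSpinorLift (hε : D.IsAdapted ε) (hB : B.IsAcyclic)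
    (ha : B.IsSpinorCoordinates D a) :
    ∃ w : Dual R D.VEven →ₗ[R] Dual R B₁, B.IsSpinorLift D a w := by
  have : Module.Free R (ExteriorAlgebra R D.H) :=
    .of_equiv (LinearEquiv.ofBijective hε.toSpinor
      ⟨hε.toSpinor_injective, hε.toSpinor_surjective⟩).symm
  have : Module.Finite R (ExteriorAlgebra R D.H) :=
    .equiv (LinearEquiv.ofBijective hε.toSpinor
      ⟨hε.toSpinor_injective, hε.toSpinor_surjective⟩).symm
  have hcompl := CliffordAlgebra.evenOdd_isCompl (0 : QuadraticForm R D.H)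
  have hsplit : D.VEven.projectionOnto D.VOdd hcompl ∘ₗ D.VEven.subtype = LinearMap.id :=
    LinearMap.ext fun x => Submodule.projectionOnto_apply_left hcompl x
  have : Module.Projective R D.VEven := .of_split _ _ hsplit
  have : Module.Finite R D.VEven := .of_surjective _ (LinearMap.surjective_of_comp_eq_id _ _ hsplit)
  let f : Dual R D.VEven →ₗ[R] B₂ := B.formEquiv.symm.toLinearMap ∘ₗ (D.actOn a).dualMap
  have hf (l) : f l ∈ LinearMap.range B.δ₃ := by
    refine hB.orthogonal_range_δ₃_le ?_
    rintro _ ⟨φ, rfl⟩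
    have hform : B.formEquiv (f l) = (D.actOn a).dualMap l := LinearEquiv.apply_symm_apply _ _
    refine (B.form_symm _ _).trans ((LinearMap.congr_fun hform _).trans ?_)
    rw [LinearMap.dualMap_apply, ha.annihilated, map_zero]
  obtain ⟨w, hw⟩ := Module.projective_lifting_property B.δ₃.rangeRestrict
    (f.codRestrict _ hf) B.δ₃.surjective_rangeRestrict
  exact ⟨w, LinearMap.ext fun l => congrArg Subtype.val (LinearMap.congr_fun hw l)⟩

variable [IsLocalRing R] [Module.Finite R B₁] [Module.Free R B₀] [Module.Finite R B₀]

theorem IsAcyclic.isAcyclicA (hε : D.IsAdapted ε) (hB : B.IsAcyclic)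
    (ha : B.IsSpinorCoordinates D a) (hw : B.IsSpinorLift D a w)
    (hgrade : LocalGradeGE (maximalIdeal R) (D.idealOf a) 3) : B.IsAcyclicA D a w := by
  obtain ⟨l, hl, hmem, hreg⟩ := hgrade.exists_isWeaklyRegular
  obtain ⟨x, y, z, rfl⟩ := List.length_eq_three.mp hl
  simp only [List.forall_mem_cons] at hmem
  obtain ⟨hx, hy, hz, -⟩ := hmem
  have : Module.Free R D.H := .of_basis hε.basisH
  have : Module.Finite R D.H := .of_basis hε.basisH
  have hregTwo := ((isWeaklyRegular_append_iff R [x, y] [z]).mp hreg).1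
  have hregOne := ((isWeaklyRegular_append_iff R [x] [y]).mp hregTwo).1
  have hinjective := hB.d₃_injective hε hw hx ((isWeaklyRegular_singleton_iff R x).mp hregOne)
  have hexact : Function.Exact (B.d₃ D w) (B.d₂ D) := by
    refine fun φ => ⟨fun hφ => ?_, fun ⟨ψ, hψ⟩ => hψ ▸ hB.d₂_d₃ hε hw ψ⟩
    exact mem_range_of_smul_mem_range_of_injective (isWeaklyRegular_of_flat _ hregTwo)
      (isWeaklyRegular_of_flat _ hregOne) hinjective (hB.smul_mem_range_d₃ hε ha hw hφ hx)
      (hB.smul_mem_range_d₃ hε ha hw hφ hy)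
  refine ⟨hinjective, hexact, fun d => ⟨fun hd => ?_, fun ⟨φ, hφ⟩ => hφ ▸ hB.d₁_d₂ hε hw φ⟩⟩
  exact mem_range_of_smul_mem_range_of_exact (isWeaklyRegular_of_flat _ hreg)
    (isWeaklyRegular_of_flat _ hregTwo) (isWeaklyRegular_of_flat _ hregOne) hinjective hexact
    (hB.smul_mem_range_d₂ hε ha hd hx) (hB.smul_mem_range_d₂ hε ha hd hy)
    (hB.smul_mem_range_d₂ hε ha hd hz)

end SelfDualSequence

/-! ### Perfect ideals of grade three -/

section Resolution

variable {R : Type u} [CommRing R] {M N K Y : Type u} [AddCommGroup M] [Module R M]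
  [AddCommGroup N] [Module R N] [AddCommGroup K] [Module R K] [AddCommGroup Y] [Module R Y]

theorem subsingleton_ext_of_shortExact {S : ShortComplex (ModuleCat.{u} R)} (hS : S.ShortExact)
    [Projective S.X₂] (Y : ModuleCat.{u} R) (n : ℕ) [Subsingleton (Abelian.Ext S.X₃ Y (n + 2))] :
    Subsingleton (Abelian.Ext S.X₁ Y (n + 1)) := by
  refine subsingleton_of_forall_eq 0 fun x => ?_
  obtain ⟨y, rfl⟩ := Abelian.Ext.contravariant_sequence_exact₁ hS Y x (n₁ := n + 2) (by lia)
    (Subsingleton.elim _ _)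
  rw [y.eq_zero_of_projective, Abelian.Ext.comp_zero]

theorem exists_comp_eq_of_subsingleton_ext {S : ShortComplex (ModuleCat.{u} R)}
    (hS : S.ShortExact) {Y : ModuleCat.{u} R} [Subsingleton (Abelian.Ext S.X₃ Y 1)]
    (φ : S.X₁ ⟶ Y) : ∃ ψ : S.X₂ ⟶ Y, S.f ≫ ψ = φ := by
  obtain ⟨y, hy⟩ := Abelian.Ext.contravariant_sequence_exact₁ hS Y (Abelian.Ext.mk₀ φ) (n₁ := 1)
    (by lia) (Subsingleton.elim _ _)
  obtain ⟨ψ, rfl⟩ := Abelian.Ext.homEquiv₀.symm.surjective y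
  rw [Abelian.Ext.homEquiv₀_symm_apply, Abelian.Ext.mk₀_comp_mk₀] at hy
  exact ⟨ψ, Abelian.Ext.homEquiv₀.symm.injective hy⟩

theorem shortExact_rangeRestrict {f : M →ₗ[R] N} {g : N →ₗ[R] K} (h : Function.Exact f g) :
    (ModuleCat.shortComplexOfCompEqZero _ _
      h.linearMap_rangeRestrict.linearMap_comp_eq_zero).ShortExact :=
  ModuleCat.shortComplex_shortExact _ h.linearMap_rangeRestrict
    (LinearMap.range f).subtype_injective g.surjective_rangeRestrict

theorem shortExact_range_mkQ (f : M →ₗ[R] N) :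
    (ModuleCat.shortComplexOfCompEqZero _ _
      (LinearMap.exact_subtype_mkQ (LinearMap.range f)).linearMap_comp_eq_zero).ShortExact :=
  ModuleCat.shortComplex_shortExact _ (LinearMap.exact_subtype_mkQ _)
    (LinearMap.range f).subtype_injective (Submodule.mkQ_surjective _)

theorem exact_rangeRestrict_of_exact {f : M →ₗ[R] N} {g : N →ₗ[R] K} (h : Function.Exact f g) :
    Function.Exact f g.rangeRestrict := fun x => by
  rw [← LinearMap.mem_ker, LinearMap.ker_rangeRestrict, LinearMap.mem_ker, h x]

variable {F₀ F₁ F₂ F₃ : Type u} [AddCommGroup F₀] [Module R F₀] [Module.Projective R F₀]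
  [AddCommGroup F₁] [Module R F₁] [Module.Projective R F₁]
  [AddCommGroup F₂] [Module R F₂] [AddCommGroup F₃] [Module R F₃]
  {d₃ : F₃ →ₗ[R] F₂} {d₂ : F₂ →ₗ[R] F₁} {d₁ : F₁ →ₗ[R] F₀}

theorem hasProjectiveDimensionLT_four_of_exact [Module.Projective R F₂]
    [Module.Projective R F₃] (hinj : Function.Injective d₃) (h₂ : Function.Exact d₃ d₂)
    (h₁ : Function.Exact d₂ d₁) :
    HasProjectiveDimensionLT (ModuleCat.of R (F₀ ⧸ LinearMap.range d₁)) 4 := by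
  have S₃ := ModuleCat.shortComplex_shortExact
    (ModuleCat.shortComplexOfCompEqZero _ _
      (exact_rangeRestrict_of_exact h₂).linearMap_comp_eq_zero)
    (exact_rangeRestrict_of_exact h₂) hinj d₂.surjective_rangeRestrict
  refine (shortExact_range_mkQ d₁).hasProjectiveDimensionLT_X₃ 3 ?_ inferInstance
  refine (shortExact_rangeRestrict h₁).hasProjectiveDimensionLT_X₃ 2 ?_ inferInstance
  exact S₃.hasProjectiveDimensionLT_X₃ 1 inferInstance inferInstance

theorem nontrivial_ext_three_of_exact (hinj : Function.Injective d₃) (h₂ : Function.Exact d₃ d₂)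
    (h₁ : Function.Exact d₂ d₁) {φ : F₃ →ₗ[R] Y} (hφ : ∀ ψ : F₂ →ₗ[R] Y, ψ ∘ₗ d₃ ≠ φ) :
    Nontrivial
      (Abelian.Ext (ModuleCat.of R (F₀ ⧸ LinearMap.range d₁)) (ModuleCat.of R Y) 3) := by
  by_contra htriv
  have : Subsingleton (Abelian.Ext (ModuleCat.of R (F₀ ⧸ LinearMap.range d₁))
      (ModuleCat.of R Y) 3) := not_nontrivial_iff_subsingleton.mp htriv
  have : Subsingleton (Abelian.Ext (ModuleCat.of R (LinearMap.range d₁)) (ModuleCat.of R Y) 2) :=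
    subsingleton_ext_of_shortExact (shortExact_range_mkQ d₁) _ 1
  have : Subsingleton (Abelian.Ext (ModuleCat.of R (LinearMap.range d₂)) (ModuleCat.of R Y) 1) :=
    subsingleton_ext_of_shortExact (shortExact_rangeRestrict h₁) _ 0
  have S₃ := ModuleCat.shortComplex_shortExact
    (ModuleCat.shortComplexOfCompEqZero _ _
      (exact_rangeRestrict_of_exact h₂).linearMap_comp_eq_zero)
    (exact_rangeRestrict_of_exact h₂) hinj d₂.surjective_rangeRestrict
  obtain ⟨ψ, hψ⟩ := exists_comp_eq_of_subsingleton_ext S₃ (ModuleCat.ofHom φ)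
  exact hφ ψ.hom (congrArg ModuleCat.Hom.hom hψ)

theorem isPerfectModule_of_hasProjectiveDimensionLT {k : ℕ} (hgrade : moduleGrade R M = k)
    (hdim : HasProjectiveDimensionLT (ModuleCat.of R M) (k + 1)) : IsPerfectModule R M := by
  have hne : moduleGrade R M ≠ ⊤ := hgrade ▸ ENat.natCast_ne_top k
  obtain ⟨i, hi, hext⟩ : moduleGrade R M ∈ {n : ℕ∞ | ∃ i : ℕ, n = i ∧
      Nontrivial (Abelian.Ext (ModuleCat.of R M) (ModuleCat.of R R) i)} :=
    csInf_mem (Set.nonempty_iff_ne_empty.mpr fun h => hne (by rw [moduleGrade, h, sInf_empty]))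
  obtain rfl : k = i := by exact_mod_cast hgrade.symm.trans hi
  rw [IsPerfectModule, hgrade]
  refine le_antisymm ((projectiveDimension_le_iff _ k).mpr hdim)
    ((projectiveDimension_ge_iff _ k).mpr fun h => not_subsingleton_iff_nontrivial.mpr hext ?_)
  exact HasProjectiveDimensionLT.subsingleton _ k k le_rfl (ModuleCat.of R R) (hX := h)

variable [IsNoetherianRing R]

theorem moduleGrade_quotient_eq {I : Ideal R} (hI : I ≠ ⊤) {l : List R} (hl : ∀ x ∈ l, x ∈ I)
    (hreg : RingTheory.Sequence.IsWeaklyRegular R l)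
    (hext : Nontrivial (Abelian.Ext (ModuleCat.of R (R ⧸ I)) (ModuleCat.of R R) l.length)) :
    moduleGrade R (R ⧸ I) = l.length := by
  have hlI : Ideal.ofList l ≤ I := Ideal.span_le.mpr hl
  have hsub := ModuleCat.subsingleton_ext_of_exists_isRegular I (ModuleCat.of R (R ⧸ I))
    (by rw [Module.support_eq_zeroLocus]
        exact PrimeSpectrum.zeroLocus_anti_mono Ideal.annihilator_quotient.ge)
    (ModuleCat.of R R) (by rw [smul_eq_mul, Ideal.mul_top]; exact hI.lt_top) l hl
    ⟨hreg, fun h => hI (top_le_iff.mp (by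
      rw [smul_eq_mul, Ideal.mul_top] at h
      exact h.trans_le hlI))⟩
  refine le_antisymm (sInf_le ⟨_, rfl, hext⟩) (le_sInf ?_)
  rintro _ ⟨i, rfl, hi⟩
  by_contra hlt
  have := hsub i (by exact_mod_cast not_le.mp hlt)
  exact not_subsingleton _ this

end Resolution

section Perfect

variable {R : Type u} [CommRing R] [IsNoetherianRing R] {F₁ F₂ F₃ : Type*}
  [AddCommGroup F₁] [Module R F₁] [Module.Free R F₁] [Module.Finite R F₁]
  [AddCommGroup F₂] [Module R F₂] [Module.Free R F₂] [Module.Finite R F₂]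
  [AddCommGroup F₃] [Module R F₃] [Module.Free R F₃] [Module.Finite R F₃]
  {d₃ : F₃ →ₗ[R] F₂} {d₂ : F₂ →ₗ[R] F₁} {d₁ : F₁ →ₗ[R] R}

-- Ext groups are formed in one universe, so the resolution is first moved to modules of vectors.
theorem moduleGrade_eq_three_and_isPerfectModule_of_exact (hinj : Function.Injective d₃)
    (h₂ : Function.Exact d₃ d₂) (h₁ : Function.Exact d₂ d₁) (htop : LinearMap.range d₁ ≠ ⊤)
    {l : List R} (hlen : l.length = 3) (hl : ∀ x ∈ l, x ∈ LinearMap.range d₁)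
    (hreg : RingTheory.Sequence.IsWeaklyRegular R l) {φ : Dual R F₃}
    (hφ : ∀ ψ : Dual R F₂, ψ ∘ₗ d₃ ≠ φ) :
    moduleGrade R (R ⧸ LinearMap.range d₁) = 3 ∧ IsPerfectModule R (R ⧸ LinearMap.range d₁) := by
  have : Nontrivial R := Submodule.nontrivial_iff R |>.mp ⟨_, _, htop⟩
  let e₁ := (Module.finBasis R F₁).equivFun
  let e₂ := (Module.finBasis R F₂).equivFun
  let e₃ := (Module.finBasis R F₃).equivFun
  let d₁' := d₁ ∘ₗ e₁.symm.toLinearMap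
  let d₂' := e₁.toLinearMap ∘ₗ d₂ ∘ₗ e₂.symm.toLinearMap
  let d₃' := e₂.toLinearMap ∘ₗ d₃ ∘ₗ e₃.symm.toLinearMap
  have hinj' : Function.Injective d₃' := e₂.injective.comp (hinj.comp e₃.symm.injective)
  have h₂' : Function.Exact d₃' d₂' :=
    .of_ladder_linearEquiv_of_exact (e₁ := e₃) (e₂ := e₂) (e₃ := e₁)
      (by ext; simp [d₃']) (by ext; simp [d₂']) h₂
  have h₁' : Function.Exact d₂' d₁' :=
    .of_ladder_linearEquiv_of_exact (e₁ := e₂) (e₂ := e₁) (e₃ := .refl R R)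
      (by ext; simp [d₂']) (by ext; simp [d₁']) h₁
  have hrange : LinearMap.range d₁' = LinearMap.range d₁ :=
    LinearMap.range_comp_of_range_eq_top _ e₁.symm.range
  have hφ' (ψ) : ψ ∘ₗ d₃' ≠ φ ∘ₗ e₃.symm.toLinearMap := fun h =>
    hφ (ψ ∘ₗ e₂.toLinearMap) (LinearMap.ext fun x => by
      simpa [d₃'] using LinearMap.congr_fun h (e₃ x))
  rw [← hrange] at htop hl ⊢
  have hgrade : moduleGrade R (R ⧸ LinearMap.range d₁') = (3 : ℕ) :=
    hlen ▸ moduleGrade_quotient_eq htop hl hreg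
      (hlen ▸ nontrivial_ext_three_of_exact hinj' h₂' h₁' hφ')
  exact ⟨hgrade, isPerfectModule_of_hasProjectiveDimensionLT hgrade
    (hasProjectiveDimensionLT_four_of_exact hinj' h₂' h₁')⟩

end Perfect

namespace SelfDualSequence

open Spinor IsLocalRing

variable {R : Type u} [CommRing R] {B₀ B₁ B₂ : Type v}
  [AddCommGroup B₀] [Module R B₀] [Module.Free R B₀]
  [AddCommGroup B₁] [Module R B₁] [Module.Free R B₁] [Module.Finite R B₁]
  [AddCommGroup B₂] [Module R B₂] {B : SelfDualSequence R B₀ B₁ B₂} {n : ℕ}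
  {D : IsotropicDecomposition B.form} {ε : B₂ ≃ₗ[R] HyperbolicSpace R n}
  {a : D.VOdd} {w : Dual R D.VEven →ₗ[R] Dual R B₁}

-- A functional on `B₁*` restricting to the projection `B₀* ⊕ R → R` along `d₃` would be evaluation
-- at an element of `ker δ₁ = im δ₂`, and would make `1` a value of `d₁`.
theorem IsSpinorLift.comp_d₃_ne_snd (hε : D.IsAdapted ε) (hB : B.IsAcyclic)
    (hw : B.IsSpinorLift D a w) (htop : D.idealOf a ≠ ⊤) (g : Dual R (Dual R B₁)) :
    g ∘ₗ B.d₃ D w ≠ LinearMap.snd R (Dual R B₀) R := by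
  refine fun hg => htop ?_
  obtain ⟨b, rfl⟩ := (Module.bijective_dual_eval R B₁).2 g
  have hwb : w D.dualOneEven b = 1 := by
    simpa [SelfDualSequence.d₃] using LinearMap.congr_fun hg (0, 1)
  have hδb : B.δ₁ b = 0 := (forall_dual_apply_eq_zero_iff R _).mp fun ψ => by
    simpa [SelfDualSequence.d₃, δ₄] using LinearMap.congr_fun hg (ψ, 0)
  obtain ⟨e, rfl⟩ := (hB.exact₁ b).mp hδb
  rw [← form_δ₃, hw.δ₃_dualOneEven hε, B.form_symm] at hwb
  exact (Ideal.eq_top_iff_one _).mpr ⟨B.form e ∘ₗ D.H.subtype, hwb⟩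

variable [IsNoetherianRing R] [IsLocalRing R] [Module.Finite R B₀]

theorem IsAcyclicA.moduleGrade_eq_three_and_isPerfectModule (hε : D.IsAdapted ε)
    (hB : B.IsAcyclic) (hw : B.IsSpinorLift D a w) (hA : B.IsAcyclicA D a w)
    (hgrade : LocalGradeGE (maximalIdeal R) (D.idealOf a) 3) (htop : D.idealOf a ≠ ⊤) :
    moduleGrade R (R ⧸ D.idealOf a) = 3 ∧ IsPerfectModule R (R ⧸ D.idealOf a) := by
  have : Module.Free R D.H := .of_basis hε.basisH
  have : Module.Finite R D.H := .of_basis hε.basisH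
  obtain ⟨l, hlen, hmem, hreg⟩ := hgrade.exists_isWeaklyRegular
  exact moduleGrade_eq_three_and_isPerfectModule_of_exact hA.injective hA.exact₂ hA.exact₁ htop
    hlen hmem hreg (hw.comp_d₃_ne_snd hε hB htop)

end SelfDualSequence

/-! ### The line of spinors annihilated by a Lagrangian -/

theorem finrank_range_add_finrank_ker {R : Type*} [CommRing R] [IsDomain R]
    {M N : Type*} [AddCommGroup M] [Module R M] [Module.Finite R M] [AddCommGroup N] [Module R N]
    (f : M →ₗ[R] N) :
    finrank R (LinearMap.range f) + finrank R (LinearMap.ker f) = finrank R M := by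
  rw [← f.quotKerEquivRange.finrank_eq, Submodule.finrank_quotient_add_finrank]

theorem finrank_eq_two_mul_finrank_ker {R : Type*} [CommRing R] [IsDomain R] [IsNoetherianRing R]
    {M : Type*} [AddCommGroup M] [Module R M] [Module.Finite R M] [Module.IsTorsionFree R M]
    {f : Module.End R M} {r : R} (hr : r ≠ 0) (hle : LinearMap.range f ≤ LinearMap.ker f)
    (hge : ∀ x ∈ LinearMap.ker f, r • x ∈ LinearMap.range f) :
    finrank R M = 2 * finrank R (LinearMap.ker f) := by
  have hker : finrank R (LinearMap.ker f) ≤ finrank R (LinearMap.range f) :=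
    LinearMap.finrank_le_finrank_of_injective
      (f := (r • (LinearMap.ker f).subtype).codRestrict (LinearMap.range f) fun x => hge x x.2)
      fun x y hxy => Subtype.ext (smul_right_injective M hr (congrArg Subtype.val hxy))
  rw [← finrank_range_add_finrank_ker f, two_mul, le_antisymm (Submodule.finrank_mono hle) hker]

namespace Spinor

variable {R : Type u} [CommRing R] {n : ℕ}

/-- The spinors with all coordinates in an ideal. -/
def coordsIn (n : ℕ) (P : Ideal R) : Submodule R (Spinor R n) :=
  Submodule.pi Set.univ fun _ => P

theorem mem_coordsIn {P : Ideal R} {s : Spinor R n} : s ∈ coordsIn n P ↔ ∀ K, s K ∈ P := by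
  simp [coordsIn]

theorem act_mem_coordsIn {P : Ideal R} {s : Spinor R n} (hs : s ∈ coordsIn n P)
    (x : HyperbolicSpace R n) : act x s ∈ coordsIn n P := by
  rw [mem_coordsIn] at hs ⊢
  intro K
  rw [act_apply, Finset.sum_apply]
  refine sum_mem fun i _ => add_mem (P.mul_mem_left _ ?_) (P.mul_mem_left _ (annih_mem hs i K))
  rw [create_apply]
  split_ifs
  · exact P.mul_mem_left _ (hs _)
  · exact zero_mem _

section ActProd

variable {P : Ideal R} {y x : HyperbolicSpace R n} {xs : List (HyperbolicSpace R n)}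

theorem exists_act_prod_sub_mem (hy : ∀ x ∈ xs, hyp y x ∈ P) :
    ∃ c : R, ∀ t, act y ((xs.map act).prod t) - c • (xs.map act).prod (act y t) ∈
      coordsIn n P := by
  induction xs with
  | nil => exact ⟨1, fun t => by simp⟩
  | cons x xs ih =>
    obtain ⟨c, hc⟩ := ih fun z hz => hy z (by simp [hz])
    refine ⟨-c, fun t => ?_⟩
    simp only [List.map_cons, List.prod_cons, Module.End.mul_apply]
    set s := (xs.map act).prod t
    set s' := (xs.map act).prod (act y t)
    have hswap : act y (act x s) - -c • act x s' = hyp y x • s - act x (act y s - c • s') := by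
      rw [← act_act y x, map_sub, map_smul]
      module
    rw [hswap]
    exact sub_mem (mem_coordsIn.mpr fun K => P.mul_mem_right _ (hy x (by simp)))
      (act_mem_coordsIn (hc t) x)

theorem prod_mem_coordsIn_of_cons [P.IsPrime] (hyx : hyp y x ∉ P) (hy : ∀ z ∈ xs, hyp y z ∈ P)
    (h : ∀ t, ((x :: xs).map act).prod t ∈ coordsIn n P) (t : Spinor R n) :
    (xs.map act).prod t ∈ coordsIn n P := by
  simp only [List.map_cons, List.prod_cons, Module.End.mul_apply] at h
  obtain ⟨c, hc⟩ := exists_act_prod_sub_mem hy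
  have hxy : act x (act y ((xs.map act).prod t)) ∈ coordsIn n P := by
    have := add_mem (act_mem_coordsIn (hc t) x) (Submodule.smul_mem _ c (h (act y t)))
    rwa [map_sub, map_smul, sub_add_cancel] at this
  have hsmul := add_mem (act_mem_coordsIn (h t) y) hxy
  rw [act_act] at hsmul
  exact mem_coordsIn.mpr fun K =>
    (Ideal.IsPrime.mem_or_mem ‹_› (mem_coordsIn.mp hsmul K)).resolve_left hyx

theorem exists_prod_notMem [P.IsPrime] {ι : Type*} {l m : ι → HyperbolicSpace R n}
    (hdiag : ∀ i, hyp (m i) (l i) ∉ P) (hoff : Pairwise fun i j => hyp (m i) (l j) ∈ P)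
    {is : List ι} (his : is.Nodup) :
    ∃ t, ((is.map l).map act).prod t ∉ coordsIn n P := by
  induction is with
  | nil =>
    refine ⟨vac, fun h => (Ideal.ne_top_iff_one P).mp (Ideal.IsPrime.ne_top ‹_›) ?_⟩
    simpa [vac] using mem_coordsIn.mp h ∅
  | cons i is ih =>
    obtain ⟨hi, his⟩ := List.nodup_cons.mp his
    by_contra! hmem
    obtain ⟨t, ht⟩ := ih his
    refine ht (prod_mem_coordsIn_of_cons (y := m i) (hdiag i) (fun z hz => ?_) hmem t)
    obtain ⟨j, hj, rfl⟩ := List.mem_map.mp hz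
    exact hoff (by rintro rfl; exact hi hj)

theorem act_self_eq_zero (h2 : IsUnit (2 : R)) (hx : hyp x x = 0) (s : Spinor R n) :
    act x (act x s) = 0 := by
  have := act_act x x s
  rw [hx, zero_smul, ← two_smul R] at this
  exact h2.smul_eq_zero.mp this

theorem act_prod_eq_zero (h2 : IsUnit (2 : R)) (hx : hyp x x = 0) (hxs : ∀ z ∈ xs, hyp x z = 0)
    (hmem : x ∈ xs) (t : Spinor R n) : act x ((xs.map act).prod t) = 0 := by
  induction xs with
  | nil => simp at hmem
  | cons z xs ih =>
    simp only [List.map_cons, List.prod_cons, Module.End.mul_apply]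
    rcases List.mem_cons.mp hmem with rfl | hmem
    · exact act_self_eq_zero h2 hx _
    · have := act_act x z ((xs.map act).prod t)
      rwa [ih (fun w hw => hxs w (by simp [hw])) hmem, map_zero, add_zero, hxs z (by simp),
        zero_smul] at this

end ActProd

section Annihilated

variable {ι : Type*} {l m : ι → HyperbolicSpace R n}

/-- The spinors annihilated by the vectors with indices in a finite set. -/
noncomputable def annihilated (l : ι → HyperbolicSpace R n) (A : Finset ι) :
    Submodule R (Spinor R n) :=
  ⨅ i ∈ A, LinearMap.ker (act (l i))

theorem mem_annihilated {A : Finset ι} {s : Spinor R n} :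
    s ∈ annihilated l A ↔ ∀ i ∈ A, act (l i) s = 0 := by
  simp [annihilated]

theorem act_mem_annihilated {A : Finset ι} {x : HyperbolicSpace R n}
    (hx : ∀ i ∈ A, hyp (l i) x = 0) {s : Spinor R n} (hs : s ∈ annihilated l A) :
    act x s ∈ annihilated l A := by
  rw [mem_annihilated] at hs ⊢
  intro i hi
  have := act_act (l i) x s
  rwa [hs i hi, map_zero, add_zero, hx i hi, zero_smul] at this

/-- The action of `l i` on the spinors annihilated by the `l j` with `j ∈ A` is a differential
with kernel the spinors which are also annihilated by `l i`, and a dual vector of `l i` is a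
contracting homotopy up to a nonzero scalar. -/
theorem finrank_annihilated_eq_two_mul [IsDomain R] [IsNoetherianRing R] [DecidableEq ι]
    (h2 : IsUnit (2 : R)) (hl : ∀ i j, hyp (l i) (l j) = 0) {A : Finset ι} {i : ι}
    {y : HyperbolicSpace R n} (hyi : hyp y (l i) ≠ 0) (hyA : ∀ j ∈ A, hyp y (l j) = 0) :
    finrank R (annihilated l A) = 2 * finrank R (annihilated l (insert i A)) := by
  let f : Module.End R (annihilated l A) :=
    (act (l i)).restrict fun s hs => act_mem_annihilated (fun j _ => hl j i) hs
  have hker : annihilated l (insert i A) = (LinearMap.ker f).map (annihilated l A).subtype := by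
    rw [LinearMap.ker_restrict]
    refine .trans ?_ ((Submodule.map_comap_subtype _ _).trans (inf_comm _ _)).symm
    exact Finset.iInf_insert i A _
  rw [hker, Submodule.finrank_map_subtype_eq]
  refine finrank_eq_two_mul_finrank_ker hyi ?_ fun s hs => ?_
  · rintro _ ⟨s, rfl⟩
    exact Subtype.ext (act_self_eq_zero h2 (hl i i) _)
  · refine ⟨⟨act y s, act_mem_annihilated (fun j hj => by rw [hyp_comm, hyA j hj]) s.2⟩,
      Subtype.ext ?_⟩
    have hs0 : act (l i) (s : Spinor R n) = 0 := congrArg Subtype.val hs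
    have := act_act y (l i) (s : Spinor R n)
    rwa [hs0, map_zero, zero_add] at this

theorem two_pow_mul_finrank_annihilated [IsDomain R] [IsNoetherianRing R]
    (h2 : IsUnit (2 : R)) (hl : ∀ i j, hyp (l i) (l j) = 0)
    (hdiag : ∀ i, hyp (m i) (l i) ≠ 0) (hoff : Pairwise fun i j => hyp (m i) (l j) = 0)
    (A : Finset ι) : 2 ^ A.card * finrank R (annihilated l A) = 2 ^ n := by
  classical
  induction A using Finset.induction_on with
  | empty =>
    have htop : annihilated l ∅ = ⊤ := by simp [annihilated]
    rw [htop, finrank_top]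
    simp [Module.finrank_fintype_fun_eq_card]
  | insert i A hi ih =>
    rw [Finset.card_insert_of_notMem hi, pow_succ, mul_assoc, ← ih,
      finrank_annihilated_eq_two_mul (A := A) h2 hl (hdiag i) fun j hj =>
        hoff (by rintro rfl; exact hi hj)]

end Annihilated

end Spinor

theorem mul_eq_mul_of_finrank_le_one {R : Type*} [CommRing R] [IsDomain R] {ι : Type*}
    {W : Submodule R (ι → R)} [Module.Finite R W] (hW : finrank R W ≤ 1) {a b : ι → R}
    (ha : a ∈ W) (hb : b ∈ W) (i j : ι) : b i * a j = a i * b j := by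
  by_contra hne
  have hne' : b i * a j - a i * b j ≠ 0 := sub_ne_zero.mpr hne
  have hind : LinearIndependent R ![(⟨a, ha⟩ : W), ⟨b, hb⟩] := by
    rw [LinearIndependent.pair_iff]
    intro x y hxy
    have hsum : x • a + y • b = 0 := congrArg Subtype.val hxy
    have hi : x * a i + y * b i = 0 := congrFun hsum i
    have hj : x * a j + y * b j = 0 := congrFun hsum j
    constructor
    · refine (mul_eq_zero.mp (?_ : x * (b i * a j - a i * b j) = 0)).resolve_right hne'
      linear_combination b i * hj - b j * hi
    · refine (mul_eq_zero.mp (?_ : y * (b i * a j - a i * b j) = 0)).resolve_right hne'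
      linear_combination a j * hi - a i * hj
  have hcard := hind.fintype_card_le_finrank
  rw [Fintype.card_fin] at hcard
  lia

theorem Spinor.mul_eq_mul_of_annihilated {R : Type u} [CommRing R] [IsDomain R]
    [IsNoetherianRing R] (h2 : IsUnit (2 : R)) {n : ℕ} {l m : Fin n → HyperbolicSpace R n}
    (hl : ∀ i j, hyp (l i) (l j) = 0) (hdiag : ∀ i, hyp (m i) (l i) ≠ 0)
    (hoff : Pairwise fun i j => hyp (m i) (l j) = 0) {a b : Spinor R n}
    (ha : ∀ i, act (l i) a = 0) (hb : ∀ i, act (l i) b = 0) (T K : Finset (Fin n)) :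
    b T * a K = a T * b K := by
  have hrank := two_pow_mul_finrank_annihilated h2 hl hdiag hoff Finset.univ
  rw [Finset.card_univ, Fintype.card_fin] at hrank
  have hone := Nat.eq_of_mul_eq_mul_left (pow_pos two_pos n) (hrank.trans (mul_one _).symm)
  exact mul_eq_mul_of_finrank_le_one hone.le (mem_annihilated.mpr fun i _ => ha i)
    (mem_annihilated.mpr fun i _ => hb i) T K

/-! ### Isotropic families outside the support -/

section BaseChange

open TensorProduct

variable {R : Type*} [CommRing R] {B₀ B₁ B₂ : Type*} [AddCommGroup B₀] [Module R B₀]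
  [AddCommGroup B₁] [Module R B₁] [AddCommGroup B₂] [Module R B₂]
  {δ₁ : B₁ →ₗ[R] B₀} {δ₂ : B₂ →ₗ[R] B₁} (P : Ideal R) [P.IsPrime]

theorem exists_notMem_homotopy [Module.Projective R B₀] [Module.Finite R B₀]
    [Module.Projective R B₁] (hexact : Function.Exact δ₂ δ₁)
    (hP : ⟨P, ‹_›⟩ ∉ Module.support R (B₀ ⧸ LinearMap.range δ₁)) :
    ∃ t ∉ P, ∃ (σ : B₀ →ₗ[R] B₁) (τ : B₁ →ₗ[R] B₂),
      δ₂ ∘ₗ τ + σ ∘ₗ δ₁ = t • LinearMap.id := by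
  rw [Module.mem_support_iff_of_finite, SetLike.not_le_iff_exists] at hP
  obtain ⟨t, ht, htP⟩ := hP
  have hrange (y : B₀) : t • y ∈ LinearMap.range δ₁ := by
    rw [← Submodule.Quotient.mk_eq_zero, Submodule.Quotient.mk_smul]
    exact Module.mem_annihilator.mp ht _
  obtain ⟨σ, hσ⟩ := Module.projective_lifting_property δ₁.rangeRestrict
    ((t • LinearMap.id).codRestrict _ hrange) δ₁.surjective_rangeRestrict
  have hσ' (y : B₀) : δ₁ (σ y) = t • y := congrArg Subtype.val (LinearMap.congr_fun hσ y)
  obtain ⟨τ, hτ⟩ := Module.projective_lifting_property δ₂.rangeRestrict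
    ((t • LinearMap.id - σ ∘ₗ δ₁).codRestrict _ fun x => (hexact _).mp (by simp [hσ']))
    δ₂.surjective_rangeRestrict
  refine ⟨t, htP, σ, τ, LinearMap.ext fun x => ?_⟩
  have hτ' : δ₂ (τ x) = t • x - σ (δ₁ x) := congrArg Subtype.val (LinearMap.congr_fun hτ x)
  simp [hτ']

theorem finrank_le_finrank_range_baseChange_add [Module.Free R B₀] [Module.Finite R B₀]
    [Module.Free R B₁] [Module.Finite R B₁] (hexact : Function.Exact δ₂ δ₁)
    (hP : ⟨P, ‹_›⟩ ∉ Module.support R (B₀ ⧸ LinearMap.range δ₁)) :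
    finrank R B₁ ≤
      finrank P.ResidueField (LinearMap.range (δ₂.baseChange P.ResidueField)) + finrank R B₀ := by
  have : Nontrivial R := ⟨0, 1, fun h => Ideal.IsPrime.one_notMem ‹_› (h ▸ P.zero_mem)⟩
  obtain ⟨t, htP, σ, τ, h⟩ := exists_notMem_homotopy P hexact hP
  let k := P.ResidueField
  have ht : algebraMap R k t ≠ 0 := mt Ideal.algebraMap_residueField_eq_zero.mp htP
  have htop : LinearMap.range (δ₂.baseChange k) ⊔ LinearMap.range (σ.baseChange k) = ⊤ := by
    rw [eq_top_iff]
    intro z _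
    refine (Submodule.smul_mem_iff _ ht).mp ?_
    have hz := LinearMap.congr_fun (congrArg (LinearMap.baseChange k) h) z
    rw [LinearMap.baseChange_add, LinearMap.baseChange_comp, LinearMap.baseChange_comp,
      LinearMap.baseChange_smul, LinearMap.baseChange_id, LinearMap.smul_apply,
      LinearMap.id_apply, ← algebraMap_smul k] at hz
    rw [← hz]
    exact Submodule.add_mem_sup ⟨_, rfl⟩ ⟨_, rfl⟩
  calc finrank R B₁ = finrank k (k ⊗[R] B₁) := finrank_baseChange.symm
    _ ≤ finrank k (LinearMap.range (δ₂.baseChange k)) +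
        finrank k (LinearMap.range (σ.baseChange k)) := by
      rw [← finrank_top k, ← htop]
      exact Submodule.finrank_add_le_finrank_add_finrank _ _
    _ ≤ _ := by
      gcongr
      exact (LinearMap.finrank_range_le _).trans finrank_baseChange.le

theorem exists_notMem_dual_algebraMap_eq_mul {M : Type*} [AddCommGroup M] [Module R M]
    [Module.Free R M] [Module.Finite R M] {ι : Type*} [Finite ι]
    (g : ι → Dual P.ResidueField (P.ResidueField ⊗[R] M)) :
    ∃ r ∉ P, ∃ φ : ι → Dual R M, ∀ i x,
      algebraMap R P.ResidueField (φ i x) = algebraMap R P.ResidueField r * g i (1 ⊗ₜ x) := by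
  let b := Module.Free.chooseBasis R M
  obtain ⟨r, hr, c, hc⟩ := exists_notMem_algebraMap_eq_mul P
    fun ia : ι × Module.Free.ChooseBasisIndex R M => g ia.1 (1 ⊗ₜ b ia.2)
  refine ⟨r, hr, fun i => b.constr R fun a => c (i, a), fun i x => ?_⟩
  conv_rhs => rw [← b.sum_repr x]
  rw [Basis.constr_apply_fintype]
  simp only [TensorProduct.tmul_sum, TensorProduct.tmul_smul, map_sum, Finset.mul_sum]
  refine Finset.sum_congr rfl fun a _ => ?_
  rw [smul_eq_mul, map_mul, hc, Basis.equivFun_apply, ← algebraMap_smul P.ResidueField, map_smul,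
    smul_eq_mul]
  ring

theorem exists_dual_families {M N : Type*} [AddCommGroup M] [Module R M] [Module.Free R M]
    [Module.Finite R M] [AddCommGroup N] [Module R N] (f : N →ₗ[R] M) {n : ℕ}
    (hn : n ≤ finrank P.ResidueField (LinearMap.range (f.baseChange P.ResidueField))) :
    ∃ (φ : Fin n → Dual R M) (m : Fin n → N),
      (∀ i, φ i (f (m i)) ∉ P) ∧ Pairwise fun i j => φ i (f (m j)) ∈ P := by
  let k := P.ResidueField
  have hspan : LinearMap.range (f.baseChange k) =
      Submodule.span k (Set.range fun x => (1 : k) ⊗ₜ[R] f x) := by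
    rw [LinearMap.range_eq_map, ← Submodule.baseChange_top, Submodule.baseChange_eq_span,
      Submodule.map_span, Submodule.map_top, LinearMap.coe_range, ← Set.range_comp]
    rfl
  rw [hspan] at hn
  obtain ⟨v, hvmem, -, hvind⟩ := Submodule.exists_fun_fin_finrank_span_eq k
    (Set.range fun x => (1 : k) ⊗ₜ[R] f x)
  choose m hm using hvmem
  beta_reduce at hm
  have hind := hvind.comp (Fin.castLE hn) (Fin.castLE_injective hn)
  obtain ⟨g, hg⟩ := LinearMap.exists_leftInverse_of_injective
    (Finsupp.linearCombination k (v ∘ Fin.castLE hn)) (LinearMap.ker_eq_bot.mpr hind)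
  have hgv (j : Fin n) : g (v (Fin.castLE hn j)) = Finsupp.single j 1 := by
    simpa using LinearMap.congr_fun hg (Finsupp.single j 1)
  obtain ⟨r, hr, φ, hφ⟩ := exists_notMem_dual_algebraMap_eq_mul P
    fun i : Fin n => Finsupp.lapply i ∘ₗ g
  have hφm (i j : Fin n) : algebraMap R k (φ i (f (m (Fin.castLE hn j)))) =
      algebraMap R k r * Finsupp.single j 1 i := by
    rw [hφ, hm, LinearMap.comp_apply, hgv, Finsupp.lapply_apply]
  refine ⟨φ, fun j => m (Fin.castLE hn j), fun i => ?_, fun i j hij => ?_⟩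
  · rw [← Ideal.algebraMap_residueField_eq_zero, hφm, Finsupp.single_eq_same, mul_one]
    exact mt Ideal.algebraMap_residueField_eq_zero.mp hr
  · exact Ideal.algebraMap_residueField_eq_zero.mp
      (by rw [hφm, Finsupp.single_eq_of_ne hij, mul_zero])

end BaseChange

/-! ### Pure spinors over factorial rings -/

section CoprimeFamilies

variable {R : Type*} [CommRing R] [IsDomain R] [UniqueFactorizationMonoid R] {ι : Type*}

theorem exists_eq_smul_forall_dvd_isUnit [Finite ι] {a₀ : ι → R} (ha₀ : a₀ ≠ 0) :
    ∃ (d : R) (a : ι → R), d ≠ 0 ∧ a₀ = d • a ∧ ∀ π, (∀ K, π ∣ a K) → IsUnit π := by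
  have := Fintype.ofFinite ι
  obtain ⟨K₀, -⟩ := Function.ne_iff.mp ha₀
  let _ : NormalizationMonoid R := Classical.choice inferInstance
  let _ : NormalizedGCDMonoid R := UniqueFactorizationMonoid.toNormalizedGCDMonoid R
  obtain ⟨a, ha, hgcd⟩ := Finset.extract_gcd a₀ ⟨K₀, Finset.mem_univ K₀⟩
  have heq : a₀ = Finset.univ.gcd a₀ • a := funext fun K => ha K (Finset.mem_univ K)
  refine ⟨_, a, fun h => ha₀ (by rw [heq, h, zero_smul]), heq, fun π hπ => ?_⟩
  exact isUnit_of_dvd_one (hgcd ▸ Finset.dvd_gcd fun K _ => hπ K)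

/-- A prime factor in `P` of a nonzero coordinate of `a` divides all of them, since it divides
`b T * a K₀ = a T * b K₀` but not `b K₀`. -/
theorem exists_notMem_of_mul_eq_mul {P : Ideal R} [P.IsPrime] {a b : ι → R}
    (ha : ∀ π, (∀ K, π ∣ a K) → IsUnit π) (hab : ∀ T K, b T * a K = a T * b K) {K₀ : ι}
    (hK₀ : b K₀ ∉ P) : ∃ K, a K ∉ P := by
  by_contra! hP
  have hb : b K₀ ≠ 0 := fun h => hK₀ (h ▸ P.zero_mem)
  have hne : a K₀ ≠ 0 := by
    intro h0
    have hzero (T : ι) : a T = 0 := by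
      simpa [h0, hb] using (hab T K₀).symm
    exact not_isUnit_zero (ha 0 fun T => (hzero T).symm.dvd)
  obtain ⟨f, hf, hassoc⟩ := UniqueFactorizationMonoid.exists_prime_factors _ hne
  obtain ⟨π, hπf, hπP⟩ := (Ideal.IsPrime.multiset_prod_mem_iff_exists_mem ‹_› f).mp
    (P.mem_of_dvd hassoc.dvd' (hP K₀))
  refine (hf π hπf).not_isUnit (ha π fun T => ?_)
  have hdvd : π ∣ a T * b K₀ :=
    hab T K₀ ▸ ((Multiset.dvd_prod hπf).trans hassoc.dvd).mul_left _
  exact ((hf π hπf).dvd_or_dvd hdvd).resolve_right fun h => hK₀ (P.mem_of_dvd h hπP)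

end CoprimeFamilies

namespace Spinor

variable {R : Type u} [CommRing R] {n : ℕ}

/-- The component of a spinor of parity `e`. -/
def parityPart (e : ZMod 2) (s : Spinor R n) : Spinor R n :=
  fun K => if (K.card : ZMod 2) = e then s K else 0

theorem hasParity_parityPart (e : ZMod 2) (s : Spinor R n) : HasParity e (parityPart e s) :=
  fun _ hK => if_neg hK

theorem parityPart_add (e : ZMod 2) (s : Spinor R n) :
    parityPart e s + parityPart (e + 1) s = s := by
  ext K
  simp only [Pi.add_apply, parityPart]
  rcases eq_or_ne (K.card : ZMod 2) e with h | h
  · simp [h]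
  · have h' : (K.card : ZMod 2) = e + 1 := by generalize (K.card : ZMod 2) = c at h; decide +revert
    simp [h']

theorem act_parityPart_eq_zero {x : HyperbolicSpace R n} {s : Spinor R n} (h : act x s = 0)
    (e : ZMod 2) : act x (parityPart e s) = 0 := by
  rw [← parityPart_add e s, map_add] at h
  ext K
  by_cases hK : (K.card : ZMod 2) = e + 1
  · have := congrFun h K
    rwa [Pi.add_apply, (hasParity_parityPart (e + 1) s).act x K (by simp [hK]), add_zero] at this
  · exact (hasParity_parityPart e s).act x K hK

theorem exists_hasParity [IsDomain R] {s : Spinor R n}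
    (h : ∀ T K, parityPart 0 s T * parityPart 1 s K = parityPart 1 s T * parityPart 0 s K) :
    ∃ e, HasParity e s := by
  by_cases hs : HasParity 1 s
  · exact ⟨1, hs⟩
  have eq_zero_of_ne_one : ∀ c : ZMod 2, c ≠ 1 → c = 0 := by decide
  have eq_one_of_ne_zero : ∀ c : ZMod 2, c ≠ 0 → c = 1 := by decide
  simp only [HasParity, not_forall] at hs
  obtain ⟨T, hT, hsT⟩ := hs
  refine ⟨0, fun K hK => ?_⟩
  have hTK : s T * s K = 0 := by
    simpa [parityPart, eq_zero_of_ne_one _ hT, eq_one_of_ne_zero _ hK] using h T K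
  exact (mul_eq_zero.mp hTK).resolve_left hsT

theorem act_act_of_hyp_self (h2 : IsUnit (2 : R)) {u : HyperbolicSpace R n} (hu : hyp u u = 2)
    (s : Spinor R n) : act u (act u s) = s := by
  have := act_act u u s
  rw [hu, ← two_smul R] at this
  exact h2.smul_left_cancel.mp this

theorem hyp_reflection {u : HyperbolicSpace R n} (hu : hyp u u = 2) (x y : HyperbolicSpace R n) :
    hyp (reflection hu x) (reflection hu y) = hyp x y := by
  simp only [reflection_apply, map_sub, map_smul, LinearMap.sub_apply, LinearMap.smul_apply,
    smul_eq_mul, hu, hyp_comm x u]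
  ring

theorem act_reflection (h2 : IsUnit (2 : R)) {u : HyperbolicSpace R n} (hu : hyp u u = 2)
    (x : HyperbolicSpace R n) (s : Spinor R n) :
    act (reflection hu x) (act u s) = -act u (act x s) := by
  rw [reflection_apply, map_sub, map_smul, LinearMap.sub_apply, LinearMap.smul_apply,
    act_act_of_hyp_self h2 hu, ← act_act u x]
  abel

/-- Reflecting the hyperbolic coordinates in a vector of length `2` exchanges the parities. -/
theorem exists_isSpinorOf {E : Type v} [AddCommGroup E] [Module R E]
    {form : LinearMap.BilinForm R E} {L : Submodule R E} {U : Set (PrimeSpectrum R)}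
    {ε : E ≃ₗ[R] HyperbolicSpace R n} {s : Spinor R n} {e : ZMod 2} (h2 : IsUnit (2 : R))
    (hn : 0 < n) (hε : ∀ x y, form x y = hyp (ε x) (ε y)) (hs : HasParity e s)
    (hL : ∀ x ∈ L, act (ε x) s = 0) (hU : ∀ P ∈ U, ∃ K, s K ∉ P.asIdeal) :
    ∃ (ε' : E ≃ₗ[R] HyperbolicSpace R n) (s' : Spinor R n), IsSpinorOf form L U ε' s' := by
  obtain rfl | rfl := (by decide : ∀ e : ZMod 2, e = 1 ∨ e = 0) e
  · exact ⟨ε, s, hε, hs, hL, hU⟩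
  let u : HyperbolicSpace R n := (Pi.single ⟨0, hn⟩ 1, Pi.single ⟨0, hn⟩ 1)
  have hu : hyp u u = 2 := by simp [u, hyp_apply, one_add_one_eq_two]
  refine ⟨ε.trans (reflection hu), act u s, fun x y => ?_, hs.act u, fun x hx => ?_,
    fun P hP => ?_⟩
  · rw [LinearEquiv.trans_apply, LinearEquiv.trans_apply, hyp_reflection, hε]
  · rw [LinearEquiv.trans_apply, act_reflection h2, hL x hx, map_zero, neg_zero]
  · by_contra! hP'
    obtain ⟨K, hK⟩ := hU P hP
    refine hK ?_
    rw [← act_act_of_hyp_self h2 hu s]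
    exact mem_coordsIn.mp (act_mem_coordsIn (mem_coordsIn.mpr hP') u) K

end Spinor

/-! ### Spinor coordinates over factorial rings -/

theorem det_notMem_of_diag_notMem {R m : Type*} [CommRing R] [Fintype m] [DecidableEq m]
    {P : Ideal R} [P.IsPrime] {A : Matrix m m R} (hdiag : ∀ i, A i i ∉ P)
    (hoff : Pairwise fun i j => A i j ∈ P) : A.det ∉ P := by
  have hA : (Ideal.Quotient.mk P).mapMatrix A =
      Matrix.diagonal fun i => Ideal.Quotient.mk P (A i i) := by
    ext i j
    rcases eq_or_ne i j with rfl | hij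
    · simp
    · simpa [hij] using Ideal.Quotient.eq_zero_iff_mem.mpr (hoff hij)
  rw [← Ideal.Quotient.eq_zero_iff_mem, RingHom.map_det, hA, Matrix.det_diagonal,
    Finset.prod_eq_zero_iff]
  simpa [Ideal.Quotient.eq_zero_iff_mem] using hdiag

section IsDomain

variable {R M : Type*} [CommRing R] [IsDomain R] [AddCommGroup M] [Module R M]

theorem linearIndependent_of_diag_notMem {ι : Type*} [Finite ι] {P : Ideal R} [P.IsPrime]
    {v : ι → M} {f : ι → Dual R M} (hdiag : ∀ i, f i (v i) ∉ P)
    (hoff : Pairwise fun i j => f i (v j) ∈ P) : LinearIndependent R v := by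
  have := Fintype.ofFinite ι
  classical
  refine LinearIndependent.of_comp (LinearMap.pi f)
    (Matrix.linearIndependent_rows_of_det_ne_zero (A := fun i j => f j (v i)) fun h => ?_)
  exact det_notMem_of_diag_notMem hdiag (fun _ _ hij => hoff hij.symm) (h ▸ P.zero_mem)

theorem exists_smul_mem_span_of_finrank_le_card [Module.Finite R M] {ι : Type*} [Fintype ι]
    {v : ι → M} (hv : LinearIndependent R v) (h : finrank R M ≤ Fintype.card ι) (x : M) :
    ∃ c : R, c ≠ 0 ∧ c • x ∈ Submodule.span R (Set.range v) := by
  have hquot : finrank R (M ⧸ Submodule.span R (Set.range v)) = 0 := by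
    have := (Submodule.span R (Set.range v)).finrank_quotient_add_finrank
    rw [finrank_span_eq_card hv] at this
    lia
  obtain ⟨c, hc, hcx⟩ := Module.finrank_eq_zero_iff.mp hquot (Submodule.Quotient.mk x)
  exact ⟨c, hc, (Submodule.Quotient.mk_eq_zero _).mp hcx⟩

end IsDomain

namespace SelfDualSequence

open Spinor

variable {R : Type u} [CommRing R] {B₀ B₁ B₂ : Type v}
  [AddCommGroup B₀] [Module R B₀] [AddCommGroup B₁] [Module R B₁]
  [AddCommGroup B₂] [Module R B₂] {B : SelfDualSequence R B₀ B₁ B₂} {n : ℕ}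

theorem IsAcyclic.form_δ₃_δ₃ (hB : B.IsAcyclic) (φ ψ : Dual R B₁) :
    B.form (B.δ₃ φ) (B.δ₃ ψ) = 0 := by
  rw [form_δ₃, hB.exact₂.apply_apply_eq_zero, map_zero]

variable [Module.Free R B₀] [Module.Finite R B₀] [Module.Free R B₁] [Module.Finite R B₁]

theorem IsAcyclic.finrank_range_δ₃_add [IsDomain R] (hB : B.IsAcyclic) :
    finrank R (LinearMap.range B.δ₃) + finrank R B₀ = finrank R B₁ := by
  have h := finrank_range_add_finrank_ker B.δ₃
  rwa [hB.exact₃.linearMap_ker_eq, LinearMap.finrank_range_of_inj hB.injective,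
    ← (Module.Free.chooseBasis R B₀).toDualEquiv.finrank_eq,
    ← (Module.Free.chooseBasis R B₁).toDualEquiv.finrank_eq] at h

theorem IsAcyclic.exists_dual_families (hB : B.IsAcyclic) (hn : n + finrank R B₀ ≤ finrank R B₁)
    {ε : B₂ ≃ₗ[R] HyperbolicSpace R n} (hε : ∀ x y, B.form x y = hyp (ε x) (ε y))
    {P : PrimeSpectrum R} (hP : P ∉ Module.support R (B₀ ⧸ LinearMap.range B.δ₁)) :
    ∃ (φ : Fin n → Dual R B₁) (m : Fin n → HyperbolicSpace R n),
      (∀ i, hyp (m i) (ε (B.δ₃ (φ i))) ∉ P.asIdeal) ∧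
      Pairwise fun i j => hyp (m i) (ε (B.δ₃ (φ j))) ∈ P.asIdeal := by
  have hrank := finrank_le_finrank_range_baseChange_add P.asIdeal hB.exact₁ hP
  obtain ⟨φ, m, hdiag, hoff⟩ := _root_.exists_dual_families P.asIdeal B.δ₂ (n := n) (by lia)
  have hpair (i j : Fin n) : hyp (ε (m i)) (ε (B.δ₃ (φ j))) = φ j (B.δ₂ (m i)) := by
    rw [← hε, B.form_symm, form_δ₃]
  exact ⟨φ, fun i => ε (m i), by simpa only [hpair] using hdiag,
    fun i j hij => by simpa only [hpair] using hoff hij.symm⟩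

/-- Over the domain `R`, a spinor annihilated by `n` independent elements of the rank `n` module
`im δ₃` is annihilated by all of it. -/
theorem IsAcyclic.exists_annihilated_notMem [IsDomain R] (h2 : IsUnit (2 : R)) (hB : B.IsAcyclic)
    (hn : finrank R B₁ = n + finrank R B₀) {ε : B₂ ≃ₗ[R] HyperbolicSpace R n}
    (hε : ∀ x y, B.form x y = hyp (ε x) (ε y)) {P : PrimeSpectrum R}
    (hP : P ∉ Module.support R (B₀ ⧸ LinearMap.range B.δ₁)) :
    ∃ b : Spinor R n, (∀ x ∈ LinearMap.range B.δ₃, act (ε x) b = 0) ∧ ∃ K, b K ∉ P.asIdeal := by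
  obtain ⟨φ, m, hdiag, hoff⟩ := hB.exists_dual_families hn.ge hε hP
  let l : Fin n → HyperbolicSpace R n := fun i => ε (B.δ₃ (φ i))
  obtain ⟨t, ht⟩ := exists_prod_notMem (l := l) hdiag hoff (List.nodup_finRange n)
  set b := (((List.finRange n).map l).map act).prod t
  have hb (i : Fin n) : act (l i) b = 0 := by
    have hll (j : Fin n) : hyp (l i) (l j) = 0 := by rw [← hε, hB.form_δ₃_δ₃]
    exact act_prod_eq_zero h2 (hll i) (by simpa using hll)
      (List.mem_map_of_mem (List.mem_finRange i)) t
  refine ⟨b, ?_, by simpa [mem_coordsIn] using ht⟩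
  let v : Fin n → LinearMap.range B.δ₃ := fun i => ⟨B.δ₃ (φ i), φ i, rfl⟩
  have hv : LinearIndependent R v := linearIndependent_of_diag_notMem
    (f := fun i => hyp (m i) ∘ₗ ε.toLinearMap ∘ₗ (LinearMap.range B.δ₃).subtype) hdiag hoff
  have hspan : Submodule.span R (Set.range v) ≤
      LinearMap.ker (act.flip b ∘ₗ ε.toLinearMap ∘ₗ (LinearMap.range B.δ₃).subtype) :=
    Submodule.span_le.mpr (Set.range_subset_iff.mpr hb)
  intro x hx
  have hrank := hB.finrank_range_δ₃_add
  obtain ⟨c, hc, hcx⟩ :=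
    exists_smul_mem_span_of_finrank_le_card hv (by rw [Fintype.card_fin]; lia) ⟨x, hx⟩
  have hcb := LinearMap.mem_ker.mp (hspan hcx)
  rw [map_smul] at hcb
  exact (smul_eq_zero.mp hcb).resolve_left hc

theorem IsAcyclic.mul_eq_mul_of_annihilated [IsDomain R] [IsNoetherianRing R]
    (h2 : IsUnit (2 : R)) (hB : B.IsAcyclic) (hn : n + finrank R B₀ ≤ finrank R B₁)
    {ε : B₂ ≃ₗ[R] HyperbolicSpace R n} (hε : ∀ x y, B.form x y = hyp (ε x) (ε y))
    (hbot : ⊥ ∉ Module.support R (B₀ ⧸ LinearMap.range B.δ₁)) {a b : Spinor R n}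
    (ha : ∀ x ∈ LinearMap.range B.δ₃, act (ε x) a = 0)
    (hb : ∀ x ∈ LinearMap.range B.δ₃, act (ε x) b = 0) (T K : Finset (Fin n)) :
    b T * a K = a T * b K := by
  obtain ⟨φ, m, hdiag, hoff⟩ := hB.exists_dual_families hn hε hbot
  exact Spinor.mul_eq_mul_of_annihilated h2 (l := fun i => ε (B.δ₃ (φ i)))
    (fun i j => by rw [← hε, hB.form_δ₃_δ₃]) hdiag hoff
    (fun i => ha _ ⟨_, rfl⟩) (fun i => hb _ ⟨_, rfl⟩) T K

theorem IsAcyclic.hasSpinorCoordinates [IsNoetherianRing R] [IsLocalRing R] [IsDomain R]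
    [UniqueFactorizationMonoid R] (h2 : IsUnit (2 : R)) (hB : B.IsAcyclic)
    (hn : finrank R B₁ = n + finrank R B₀) (hn0 : 0 < n)
    (hB₂ : HasHyperbolicBasis B.form n) : B.HasSpinorCoordinates := by
  obtain ⟨ε, hε⟩ := exists_hyperbolicSpace_equiv hB₂ B.form_symm
  have : Module.Free R B₂ := Module.Free.of_equiv ε.symm
  have : Module.Finite R B₂ := Module.Finite.equiv ε.symm
  have hbot : ⊥ ∉ Module.support R (B₀ ⧸ LinearMap.range B.δ₁) :=
    hB.notMem_support (l := []) (by simp) trivial <|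
      mem_associatedPrimes_quotient_iff.mpr ⟨Ideal.isPrime_bot, 1, by simp⟩
  obtain ⟨a₀, ha₀, K₀, hK₀⟩ := hB.exists_annihilated_notMem h2 hn hε hbot
  obtain ⟨d, a, hd, had, hcoprime⟩ :=
    exists_eq_smul_forall_dvd_isUnit (a₀ := a₀) fun h => hK₀ (by simp [h])
  have ha (x : B₂) (hx : x ∈ LinearMap.range B.δ₃) : act (ε x) a = 0 := by
    have := ha₀ x hx
    rw [had, map_smul] at this
    exact (smul_eq_zero.mp this).resolve_left hd
  obtain ⟨e, hparity⟩ := exists_hasParity fun T K =>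
    hB.mul_eq_mul_of_annihilated h2 hn.ge hε hbot
      (fun x hx => act_parityPart_eq_zero (ha x hx) 1)
      (fun x hx => act_parityPart_eq_zero (ha x hx) 0) T K
  obtain ⟨ε', s, hs⟩ := exists_isSpinorOf h2 hn0 hε hparity ha fun P hP => by
    obtain ⟨b, hb, K, hK⟩ := hB.exists_annihilated_notMem h2 hn hε hP
    exact exists_notMem_of_mul_eq_mul hcoprime
      (hB.mul_eq_mul_of_annihilated h2 hn.ge hε hbot ha hb) hK
  have hε' := IsotropicDecomposition.isAdapted_ofCoordinates ε' hs.isometry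
  obtain ⟨a', ha'⟩ := hε'.exists_toSpinor_eq hs.isOdd
  exact ⟨_, a', (isSpinorCoordinates_iff hε' a').mpr (ha'.symm ▸ hs)⟩

end SelfDualSequence

theorem mainTheorem4_general {R : Type u} [CommRing R] [IsNoetherianRing R] [IsLocalRing R]
    [Infinite (IsLocalRing.ResidueField R)] (h2 : IsUnit (2 : R)) {n : ℕ} (hn : 0 < n)
    {B₀ B₁ B₂ : Type v}
    [AddCommGroup B₀] [Module R B₀] [Module.Free R B₀] [Module.Finite R B₀]
    [AddCommGroup B₁] [Module R B₁] [Module.Free R B₁] [Module.Finite R B₁]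
    [AddCommGroup B₂] [Module R B₂] (hB₁ : finrank R B₁ = n + finrank R B₀)
    (B : SelfDualSequence R B₀ B₁ B₂) (hB₂ : HasHyperbolicBasis B.form n) (hB : B.IsAcyclic) :
    (IsDomain R → UniqueFactorizationMonoid R → B.HasSpinorCoordinates) ∧
    (B.HasSpinorCoordinates →
      ∃ D : IsotropicDecomposition B.form,
        (∃ a : D.VOdd, B.IsSpinorCoordinates D a) ∧
        ∀ a : D.VOdd, B.IsSpinorCoordinates D a →
          (∃ w : Dual R D.VEven →ₗ[R] Dual R B₁, B.IsSpinorLift D a w) ∧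
          ∀ w : Dual R D.VEven →ₗ[R] Dual R B₁, B.IsSpinorLift D a w →
            B.IsAcyclicA D a w ∧
            ((moduleGrade R (R ⧸ D.idealOf a) = 3 ∧ IsPerfectModule R (R ⧸ D.idealOf a)) ∨
              D.idealOf a = ⊤)) := by
  refine ⟨fun _ _ => hB.hasSpinorCoordinates h2 hB₁ hn hB₂, fun h => ?_⟩
  obtain ⟨ε₀, -⟩ := exists_hyperbolicSpace_equiv hB₂ B.form_symm
  have : Module.Free R B₂ := .of_equiv ε₀.symm
  have : Module.Finite R B₂ := .equiv ε₀.symm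
  obtain ⟨D, ε, hε, hex, hgrade⟩ := h.exists_generic hB ε₀
  refine ⟨D, hex, fun a ha => ⟨hB.exists_isSpinorLift hε ha, fun w hw => ?_⟩⟩
  have hI := hgrade a ha
  rw [← hε.idealOf_eq_span] at hI
  have hA := hB.isAcyclicA hε ha hw hI
  refine ⟨hA, (em (D.idealOf a = ⊤)).symm.imp_left fun htop => ?_⟩
  exact hA.moduleGrade_eq_three_and_isPerfectModule hε hB hw hI htop

theorem mainTheorem4 {R : Type u} [CommRing R] [IsNoetherianRing R] [IsLocalRing R]
    [Infinite (IsLocalRing.ResidueField R)] [IrreducibleSpace (PrimeSpectrum R)]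
    (h2 : IsUnit (2 : R)) (p q : ℕ) (hp : 1 ≤ p) (hq : 3 ≤ q)
    {B₀ B₁ B₂ : Type v}
    [AddCommGroup B₀] [Module R B₀] [Module.Free R B₀] [Module.Finite R B₀]
    [AddCommGroup B₁] [Module R B₁] [Module.Free R B₁] [Module.Finite R B₁]
    [AddCommGroup B₂] [Module R B₂]
    (hB₀ : Module.finrank R B₀ = q - 2) (hB₁ : Module.finrank R B₁ = p + q)
    (B : SelfDualSequence R B₀ B₁ B₂) (hB₂ : HasHyperbolicBasis B.form (p + 2))
    (hB : B.IsAcyclic) :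
    -- over a factorial ring, spinor coordinates exist
    (IsDomain R → UniqueFactorizationMonoid R → B.HasSpinorCoordinates) ∧
    -- whenever they exist, some decomposition makes the constructed complex a resolution
    (B.HasSpinorCoordinates →
      ∃ D : IsotropicDecomposition B.form,
        (∃ a : D.VOdd, B.IsSpinorCoordinates D a) ∧
        ∀ a : D.VOdd, B.IsSpinorCoordinates D a →
          (∃ w : Module.Dual R D.VEven →ₗ[R] Module.Dual R B₁,
            B.IsSpinorLift D a w) ∧
          ∀ w : Module.Dual R D.VEven →ₗ[R] Module.Dual R B₁,
            B.IsSpinorLift D a w →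
              B.IsAcyclicA D a w ∧
              ((moduleGrade R (R ⧸ D.idealOf a) = 3 ∧
                  IsPerfectModule R (R ⧸ D.idealOf a)) ∨
                D.idealOf a = ⊤)) := by
  exact mainTheorem4_general h2 (by omega) (by omega) B hB₂ hB
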